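/- Let $v_1>v_2>0$ and $\lambda>0$. Slow cars $j\in\mathbb N$ enter a road $\mathbb R$ at the points $(x_j,t_j)$ (position, time) of a homogeneous Poisson field on $\mathbb R\times\mathbb R_+$ with intensity $\lambda\,dx\,dt$. The $j$-th slow car travels with constant speed $v_2$ a distance $\rho_j\ge 0$ and then leaves the road, that is, it is at $x_j+v_2(t-t_j)$ for $t_j\le t<t_j+\rho_j/v_2$. The $\rho_j$ are i.i.d. with distribution function $G$, with mean $m_G=E\rho_1>0$ and with $E\rho_1^2<\infty$. Fast car $i$ enters the road at a given position $x_{i,in}\in\mathbb R$ at a given time $t_{i,in}\ge 0$. It moves with speed $v_1$, except that after catching up with a slow car $j$ (coming to the same place while $j$ is on the road) it follows $j$ with speed $v_2$ until either an overtaking time $\tau_{i,j}$ has elapsed or $j$ leaves the road, whichever happens first, and then regains speed $v_1$ immediately. The overtaking times $\tau_{i,j}$ are i.i.d. with law $F$ on $[0,\infty]$; the case $\tau_{i,j}=\infty$ a.s. is that of prohibited overtaking. The field $(x_j,t_j)_j$, the family $(\rho_j)_j$ and the family $(\tau_{i,j})_{i,j}$ are independent of each other. Put $d=\lambda m_G\left(v_2^{-1}-v_1^{-1}\right)$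 and $c=E\min(v_2\tau,\beta)$, where $\tau$ has law $F$, $\beta$ has density $g(x)=m_G^{-1}(1-G(x))$ on $(0,\infty)$, and $\tau,\beta$ are independent. Then for every fast car $i$, with probability $1$, a trajectory obeying these rules exists, and for any such trajectory the time $T(x)$ that the car takes to travel the distance $x$ satisfies $$\frac{x}{T(x)}\longrightarrow \bar v_1=\frac{1+dc}{1+dc\,v_1v_2^{-1}}\,v_1\qquad (x\to\infty).$$ -/

import Mathlib

open MeasureTheory ProbabilityTheory Filter Topology Set
open scoped ENNReal NNReal

noncomputable section

/-- The number of indices `j` for which the point `p j` lies in `B`. -/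
def pointCount {E : Type*} (p : ℕ → E) (B : Set E) : ℝ≥0∞ :=
  ∑' j, B.indicator (fun _ => (1 : ℝ≥0∞)) (p j)

/-- The random points `p 0, p 1, …` of `E` form a Poisson field with intensity measure `ν`:
the number of points in a measurable set `B` of finite `ν`-measure is Poisson distributed with
parameter `ν B`, and the numbers of points in disjoint such sets are independent. -/
structure IsPoissonField {Ω E : Type*} [MeasurableSpace Ω] [MeasurableSpace E]
    (p : ℕ → Ω → E) (ν : Measure E) (P : Measure Ω) : Prop where
  measurable : ∀ j, Measurable (p j)
  law_count : ∀ B : Set E, MeasurableSet B → ν B ≠ ∞ →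
    P.map (fun ω => pointCount (fun j => p j ω) B) =
      (poissonMeasure (ν B).toNNReal).map (fun n : ℕ => (n : ℝ≥0∞))
  indep_count : ∀ (n : ℕ) (B : Fin n → Set E), (∀ k, MeasurableSet (B k)) →
    (∀ k, ν (B k) ≠ ∞) → Pairwise (fun k l => Disjoint (B k) (B l)) →
    iIndepFun (fun k ω => pointCount (fun j => p j ω) (B k)) P

/-- The homogeneous intensity measure `lam dx dt` on `ℝ × ℝ₊` (position, time). -/
def spaceTimeIntensity (lam : ℝ) : Measure (ℝ × ℝ) :=
  ENNReal.ofReal lam • (volume : Measure (ℝ × ℝ)).restrict (univ ×ˢ Ici 0)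

/-- The slow car entering at position `a.1` at time `a.2`, with speed `v₂` and route of length
`r`, is on the road at time `s`. -/
def SlowCarPresent (v₂ : ℝ) (a : ℝ × ℝ) (r s : ℝ) : Prop :=
  a.2 ≤ s ∧ s < a.2 + r / v₂

/-- The position at time `s` of a slow car that entered at position `a.1` at time `a.2`. -/
def slowCarPosition (v₂ : ℝ) (a : ℝ × ℝ) (s : ℝ) : ℝ :=
  a.1 + v₂ * (s - a.2)

/-- The times, from the entrance time `t₀` of a fast car with trajectory `X` on, at which
this fast car is at the place of the slow car with entrance `a` and route length `r`. -/
def meetingTimes (v₂ : ℝ) (a : ℝ × ℝ) (r t₀ : ℝ) (X : ℝ → ℝ) : Set ℝ :=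
  {s | t₀ ≤ s ∧ SlowCarPresent v₂ a r s ∧ X s = slowCarPosition v₂ a s}

/-- At time `s` the fast car with trajectory `X` follows some slow car `j`: it caught up with `j`
at some time `u ≤ s`, the time `τ j` needed to overtake `j` has not yet elapsed
(`τ j = ∞` means that `j` cannot be overtaken), and `j` is still on the road. -/
def FollowsSlowCar (v₂ : ℝ) (a : ℕ → ℝ × ℝ) (ρ : ℕ → ℝ) (τ : ℕ → ℝ≥0∞) (t₀ : ℝ)
    (X : ℝ → ℝ) (s : ℝ) : Prop :=
  ∃ j u, IsLeast (meetingTimes v₂ (a j) (ρ j) t₀ X) u ∧ u ≤ s ∧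
    ENNReal.ofReal (s - u) < τ j ∧ SlowCarPresent v₂ (a j) (ρ j) s

/-- `X` is, from time `t₀` on, the trajectory of a fast car that enters the road at position
`x₀` at time `t₀`: it moves continuously, with speed `v₂` while it follows a slow car
and with speed `v₁` otherwise. -/
structure IsFastTrajectory (v₁ v₂ : ℝ) (a : ℕ → ℝ × ℝ) (ρ : ℕ → ℝ) (τ : ℕ → ℝ≥0∞)
    (x₀ t₀ : ℝ) (X : ℝ → ℝ) : Prop where
  initial : X t₀ = x₀
  continuousOn : ContinuousOn X (Ici t₀)
  speed_following : ∀ s, t₀ ≤ s → FollowsSlowCar v₂ a ρ τ t₀ X s →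
    HasDerivWithinAt X v₂ (Ici s) s
  speed_free : ∀ s, t₀ ≤ s → ¬ FollowsSlowCar v₂ a ρ τ t₀ X s →
    HasDerivWithinAt X v₁ (Ici s) s

/-- The time that a car with trajectory `X`, entering at time `t₀`, takes to pass distance `x`. -/
def travelTime (t₀ : ℝ) (X : ℝ → ℝ) (x : ℝ) : ℝ :=
  sInf {T | 0 ≤ T ∧ X t₀ + x ≤ X (t₀ + T)}

/-- The law with density `g(x) = m_G⁻¹ (1 - G(x))`, `x > 0`, where `m_G` is the mean of `G`. -/
def residualLaw (G : Measure ℝ) : Measure ℝ :=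
  (volume.restrict (Ioi 0)).withDensity
    (fun x => ENNReal.ofReal ((∫ r, r ∂G)⁻¹ * (1 - cdf G x)))

/-- `E min(v₂ τ, β)` for independent `τ` with law `F` and `β` with law `residualLaw G`. -/
def meanFollowingConst (v₂ : ℝ) (F : Measure ℝ≥0∞) (G : Measure ℝ) : ℝ :=
  ∫ q, (min (ENNReal.ofReal v₂ * q.1) (ENNReal.ofReal q.2)).toReal ∂(F.prod (residualLaw G))

end

set_option linter.unusedSectionVars false

/-! ### Poisson fields: avoidance probabilities and mean counts of marked fields -/

/-! In the frame moving with speed `v₂` every slow car stands still at a point `y`, while the fast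
car's advance `Y` grows at rate `v₁ - v₂` when free and stays constant when following. Put `κ = v₂ /
(v₁ - v₂)`. The sheared clock `S = v₂ t - κ Y` is constant during free motion and runs at rate `v₂`
during following. As a function of `Y` it is therefore a jump process: a slow car with sheared start
`b` and route length `ρ`, met at clock reading `s`, adds `min (v₂ τ) (b + ρ - s)`. If `S / Y → R`,
then `v₂ t / Y → κ + R` and the speed tends to `v₂ + v₂ / (κ + R)`.

In the coordinates `(y, b)` the cars ahead of the fast car fill only the region `b ≥ -κ y`.
Reflecting the cars behind it into the complementary region yields a homogeneous field on `(0, ∞) ×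
ℝ` (`map_foldedPoint`). The law of the delay in a strip of `y`-values then does not depend on the
arrival time `s` (`map_cellDelay_congr`), and disjoint strips are independent
(`HasPoissonAvoidance.indep_voidAlgebra`). The delays met successively are therefore independent and
identically distributed although each arrival time depends on the earlier ones
(`measure_inter_schemeDelay`). The only property of the marked field that is used is its avoidance
function `exp (-μ A)`, which comes from the generating functional of the entrance field by
integrating out the marks.

The jump process is approximated by `delayScheme`, which on each cell of mesh `2⁻ᵐ` counts only the
largest single delay. The scheme increases under refinement of the mesh. In the limit its increments
over unit intervals are pairwise independent and identically distributed, by characteristic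
functions, with mean the intensity times `∫ delayTail`; the strong law applies
(`ae_tendsto_limitDelay_div`). By `toReal_lintegral_delayTail` the integral equals `m_G c`, so `R =
lam m_G c / v₂`.

Every trajectory is squeezed between schemes. Below, `IsFastTrajectory.delayScheme_le` starts the
scheme at a random integer `K` beyond which no reflected car is still on the road; the second moment
of `G` provides `K`. Above, `IsFastTrajectory.le_delayScheme` uses a mesh so fine that relevant cars
lie in different cells, and a slightly larger `κ`, so that all arrivals are strictly earlier in the
sheared clock than in the scheme. Reflected cars can only raise this bound. Existence of a
trajectory is deterministic: local finiteness of the entrances allows every partial trajectory to be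
prolonged, and Zorn's lemma does the rest. -/

theorem lintegral_pow_poissonMeasure (r : ℝ≥0) {q : ℝ} (hq : 0 ≤ q) :
    ∫⁻ n, ENNReal.ofReal q ^ n ∂(poissonMeasure r)
      = ENNReal.ofReal (Real.exp (-((r : ℝ) * (1 - q)))) := by
  rw [poissonMeasure, lintegral_sum_measure]
  simp only [lintegral_smul_measure, lintegral_dirac, smul_eq_mul]
  have h1 : ∀ n : ℕ, ENNReal.ofReal (Real.exp (-(r : ℝ)) * (r : ℝ) ^ n / (n.factorial : ℝ)) *
      ENNReal.ofReal q ^ n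
      = ENNReal.ofReal (Real.exp (-(r : ℝ)) * (((r : ℝ) * q) ^ n / (n.factorial : ℝ))) := by
    intro n
    rw [← ENNReal.ofReal_pow hq, ← ENNReal.ofReal_mul (by positivity), mul_pow]
    congr 1
    ring
  simp_rw [h1]
  have hs : HasSum (fun n : ℕ => Real.exp (-(r : ℝ)) * (((r : ℝ) * q) ^ n / (n.factorial : ℝ)))
      (Real.exp (-(r : ℝ)) * Real.exp ((r : ℝ) * q)) := by
    have := NormedSpace.expSeries_div_hasSum_exp (𝔸 := ℝ) ((r : ℝ) * q)
    rw [← Real.exp_eq_exp_ℝ] at this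
    exact this.mul_left _
  rw [← ENNReal.ofReal_tsum_of_nonneg (fun n => by positivity) hs.summable, hs.tsum_eq,
    ← Real.exp_add]
  congr 2
  ring

theorem lintegral_natCast_poissonMeasure (r : ℝ≥0) :
    ∫⁻ n, (n : ℝ≥0∞) ∂(poissonMeasure r) = r := by
  rw [poissonMeasure, lintegral_sum_measure]
  simp only [lintegral_smul_measure, lintegral_dirac, smul_eq_mul]
  have h1 : ∀ n : ℕ, ENNReal.ofReal (Real.exp (-(r : ℝ)) * (r : ℝ) ^ n / (n.factorial : ℝ)) *
      (n : ℝ≥0∞)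
      = ENNReal.ofReal (Real.exp (-(r : ℝ)) * (r : ℝ) ^ n / (n.factorial : ℝ) * n) := by
    intro n
    rw [ENNReal.ofReal_mul (by positivity), ENNReal.ofReal_natCast]
  simp_rw [h1]
  have hs : HasSum (fun n : ℕ => Real.exp (-(r : ℝ)) * (r : ℝ) ^ n / (n.factorial : ℝ) * n) r := by
    rw [← hasSum_nat_add_iff' 1]
    have := NormedSpace.expSeries_div_hasSum_exp (𝔸 := ℝ) (r : ℝ)
    rw [← Real.exp_eq_exp_ℝ] at this
    have h2 := this.mul_left (Real.exp (-(r : ℝ)) * r)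
    have h3 : Real.exp (-(r : ℝ)) * r * Real.exp r = r := by
      rw [mul_comm (Real.exp _) _, mul_assoc, ← Real.exp_add]; simp
    rw [h3] at h2
    simp only [Finset.sum_range_one, Nat.cast_zero, mul_zero, sub_zero]
    have h4 : ∀ n : ℕ, Real.exp (-(r : ℝ)) * (r : ℝ) ^ (n + 1) / ((n + 1).factorial : ℝ) *
        ((n + 1 : ℕ) : ℝ) = Real.exp (-(r : ℝ)) * r * ((r : ℝ) ^ n / (n.factorial : ℝ)) := by
      intro n
      rw [Nat.factorial_succ]
      push_cast
      have : (n.factorial : ℝ) ≠ 0 := by positivity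
      have : (n : ℝ) + 1 ≠ 0 := by positivity
      field_simp
      ring
    simp_rw [h4]
    exact h2
  rw [← ENNReal.ofReal_tsum_of_nonneg (fun n => by positivity) hs.summable, hs.tsum_eq,
    ENNReal.ofReal_coe_nnreal]

section PoissonField

variable {Ω E : Type*} [MeasurableSpace Ω] [MeasurableSpace E] {p : ℕ → Ω → E} {ν : Measure E}
  {P : Measure Ω}

theorem measurable_pointCount (hp : ∀ j, Measurable (p j)) {B : Set E} (hB : MeasurableSet B) :
    Measurable (fun ω => pointCount (fun j => p j ω) B) := by
  unfold pointCount
  exact Measurable.tsum fun j => (measurable_const.indicator hB).comp (hp j)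

theorem finite_of_pointCount_ne_top {q : ℕ → E} {B : Set E} (h : pointCount q B ≠ ∞) :
    {j | q j ∈ B}.Finite := by
  refine (ENNReal.finite_const_le_of_tsum_ne_top h one_ne_zero).subset fun j hj => ?_
  rw [mem_ofPred_eq] at hj ⊢
  rw [indicator_of_mem hj]

theorem pointCount_eq_card {q : ℕ → E} {B : Set E} {J : ℕ} [DecidablePred (· ∈ B)]
    (hJ : ∀ j, q j ∈ B → j < J) :
    pointCount q B = (((Finset.range J).filter fun j => q j ∈ B).card : ℝ≥0∞) := by
  unfold pointCount
  rw [tsum_eq_sum (s := Finset.range J)]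
  · rw [Finset.card_filter]
    push_cast
    refine Finset.sum_congr rfl fun j _ => ?_
    by_cases h : q j ∈ B <;> simp [h]
  · intro j hj
    rw [indicator_of_notMem]
    exact fun h => hj (Finset.mem_range.2 (hJ j h))

namespace IsPoissonField

theorem lintegral_comp_count (h : IsPoissonField p ν P) {B : Set E} (hB : MeasurableSet B)
    (hν : ν B ≠ ∞) {f : ℝ≥0∞ → ℝ≥0∞} (hf : Measurable f) :
    ∫⁻ ω, f (pointCount (fun j => p j ω) B) ∂P
      = ∫⁻ n : ℕ, f n ∂(poissonMeasure (ν B).toNNReal) := by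
  rw [← lintegral_map hf (measurable_pointCount h.measurable hB), h.law_count B hB hν,
    lintegral_map hf (measurable_of_countable _)]

theorem lintegral_count (h : IsPoissonField p ν P) {B : Set E} (hB : MeasurableSet B)
    (hν : ν B ≠ ∞) : ∫⁻ ω, pointCount (fun j => p j ω) B ∂P = ν B := by
  have := h.lintegral_comp_count hB hν measurable_id
  simp only [id, lintegral_natCast_poissonMeasure] at this
  rw [this]
  exact ENNReal.coe_toNNReal hν

theorem ae_finite (h : IsPoissonField p ν P) {B : Set E} (hB : MeasurableSet B)
    (hν : ν B ≠ ∞) : ∀ᵐ ω ∂P, {j | p j ω ∈ B}.Finite := by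
  have := ae_lt_top (measurable_pointCount h.measurable hB)
    (by rw [h.lintegral_count hB hν]; exact hν)
  filter_upwards [this] with ω hω using finite_of_pointCount_ne_top hω.ne

theorem ae_notMem (h : IsPoissonField p ν P) {B : Set E} (hB : MeasurableSet B)
    (hν : ν B = 0) : ∀ᵐ ω ∂P, ∀ j, p j ω ∉ B := by
  have h0 := h.lintegral_count hB (by simp [hν])
  rw [hν, lintegral_eq_zero_iff (measurable_pointCount h.measurable hB)] at h0
  filter_upwards [h0] with ω hω j hj
  have := ENNReal.tsum_eq_zero.1 hω j
  rw [indicator_of_mem hj] at this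
  exact one_ne_zero this

/-- The mean measure of a Poisson field is its intensity. -/
theorem sum_map_eq [SigmaFinite ν] (h : IsPoissonField p ν P) :
    Measure.sum (fun j => P.map (p j)) = ν := by
  have key : ∀ B, MeasurableSet B → ν B ≠ ∞ → Measure.sum (fun j => P.map (p j)) B = ν B := by
    intro B hB hν
    rw [Measure.sum_apply _ hB, ← h.lintegral_count hB hν]
    unfold pointCount
    rw [lintegral_tsum (f := fun j ω => B.indicator (fun _ => (1 : ℝ≥0∞)) (p j ω)) fun j =>
      ((measurable_const.indicator hB).comp (h.measurable j)).aemeasurable]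
    refine tsum_congr fun j => ?_
    rw [Measure.map_apply (h.measurable j) hB,
      ← lintegral_indicator_one (h.measurable j hB)]
    rfl
  ext B hB
  have hU : B = ⋃ n, B ∩ spanningSets ν n := by
    rw [← inter_iUnion, iUnion_spanningSets, inter_univ]
  have hm : Monotone fun n => B ∩ spanningSets ν n := fun m n hmn =>
    inter_subset_inter_right _ (monotone_spanningSets ν hmn)
  rw [hU, hm.measure_iUnion, hm.measure_iUnion]
  refine iSup_congr fun n => key _ (hB.inter (measurableSet_spanningSets ν n)) ?_
  exact ((measure_mono inter_subset_right).trans_lt (measure_spanningSets_lt_top ν n)).ne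

theorem tsum_lintegral_comp [SigmaFinite ν] (h : IsPoissonField p ν P) {f : E → ℝ≥0∞}
    (hf : Measurable f) : ∑' j, ∫⁻ ω, f (p j ω) ∂P = ∫⁻ x, f x ∂ν := by
  conv_rhs => rw [← h.sum_map_eq, lintegral_sum_measure]
  exact tsum_congr fun j => (lintegral_map hf (h.measurable j)).symm

theorem antitone_prod_one_sub {g : E → ℝ≥0∞} (q : ℕ → E) :
    Antitone fun J => ∏ j ∈ Finset.range J, (1 - g (q j)) := by
  refine antitone_nat_of_succ_le fun J => ?_
  rw [Finset.prod_range_succ]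
  exact mul_le_of_le_one_right' tsub_le_self

/-- Only finitely many points have `g ≠ 0`, so the partial products are eventually constant and the
infimum is their last value. Collecting equal factors gives one power for each nonzero value of `g`.
-/
theorem iInf_prod_simpleFunc {g : SimpleFunc E ℝ≥0∞} {q : ℕ → E}
    (hq : ∀ x ∈ g.range.filter (· ≠ 0), pointCount q (g ⁻¹' {x}) ≠ ∞) :
    ⨅ J, ∏ j ∈ Finset.range J, (1 - g (q j))
      = ∏ x ∈ g.range.filter (· ≠ 0), (1 - x) ^ (pointCount q (g ⁻¹' {x})).toReal := by
  classical
  have hfin : {j | g (q j) ≠ 0}.Finite := by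
    have : {j | g (q j) ≠ 0} ⊆ ⋃ x ∈ g.range.filter (· ≠ 0), {j | q j ∈ g ⁻¹' {x}} := by
      intro j hj
      simp only [mem_iUnion]
      exact ⟨g (q j), Finset.mem_filter.2 ⟨g.mem_range_self _, hj⟩, rfl⟩
    exact ((g.range.filter (· ≠ 0)).finite_toSet.biUnion
      fun x hx => finite_of_pointCount_ne_top (hq x hx)).subset this
  obtain ⟨J₀, hJ₀⟩ := hfin.bddAbove
  have hlt : ∀ j, g (q j) ≠ 0 → j < J₀ + 1 := fun j hj => Nat.lt_succ_of_le (hJ₀ hj)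
  have hconst : ∀ J, J₀ + 1 ≤ J → ∏ j ∈ Finset.range J, (1 - g (q j))
      = ∏ j ∈ Finset.range (J₀ + 1), (1 - g (q j)) := by
    intro J hJ
    symm
    refine Finset.prod_subset (Finset.range_mono hJ) fun j _ hj => ?_
    have : g (q j) = 0 := by
      by_contra h
      exact hj (Finset.mem_range.2 (hlt j h))
    simp [this]
  have hinf : ⨅ J, ∏ j ∈ Finset.range J, (1 - g (q j))
      = ∏ j ∈ Finset.range (J₀ + 1), (1 - g (q j)) := by
    refine le_antisymm (iInf_le _ _) (le_iInf fun J => ?_)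
    rcases le_total (J₀ + 1) J with h | h
    · rw [hconst J h]
    · exact antitone_prod_one_sub q h
  rw [hinf]
  have hsplit : ∏ j ∈ Finset.range (J₀ + 1), (1 - g (q j))
      = ∏ j ∈ (Finset.range (J₀ + 1)).filter (fun j => g (q j) ≠ 0), (1 - g (q j)) := by
    rw [Finset.prod_filter]
    refine Finset.prod_congr rfl fun j _ => ?_
    by_cases h : g (q j) = 0 <;> simp [h]
  rw [hsplit, ← Finset.prod_fiberwise_of_maps_to (t := g.range.filter (· ≠ 0)) (g := fun j => g (q j))
    (fun j hj => Finset.mem_filter.2 ⟨g.mem_range_self _, (Finset.mem_filter.1 hj).2⟩)]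
  refine Finset.prod_congr rfl fun x hx => ?_
  have hx0 := (Finset.mem_filter.1 hx).2
  rw [pointCount_eq_card (J := J₀ + 1) (B := g ⁻¹' {x})
    (fun j hj => hlt j (by rw [show g (q j) = x from hj]; exact hx0)), ENNReal.toReal_natCast,
    ENNReal.rpow_natCast]
  have : ((Finset.range (J₀ + 1)).filter (fun j => g (q j) ≠ 0)).filter (fun j => g (q j) = x)
      = (Finset.range (J₀ + 1)).filter fun j => q j ∈ g ⁻¹' {x} := by
    ext j
    simp only [Finset.mem_filter, mem_preimage, mem_singleton_iff]
    constructor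
    · rintro ⟨⟨h1, -⟩, h3⟩; exact ⟨h1, h3⟩
    · rintro ⟨h1, h3⟩; exact ⟨⟨h1, by rw [h3]; exact hx0⟩, h3⟩
  rw [this]
  rw [Finset.prod_congr rfl (g := fun _ => 1 - x)
    (fun j hj => by rw [show g (q j) = x from (Finset.mem_filter.1 hj).2]), Finset.prod_const]

/-- The level sets of `g` are disjoint, so the counts in them are independent, and each factor is
the Poisson generating function evaluated at `1 - x`. -/
theorem lintegral_iInf_prod_simpleFunc (h : IsPoissonField p ν P) {g : SimpleFunc E ℝ≥0∞}
    (hg : ∀ x, g x ≤ 1) (hfin : ∫⁻ x, g x ∂ν ≠ ∞) :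
    ∫⁻ ω, ⨅ J, ∏ j ∈ Finset.range J, (1 - g (p j ω)) ∂P
      = ENNReal.ofReal (Real.exp (-(∫⁻ x, g x ∂ν).toReal)) := by
  set S := g.range.filter (· ≠ 0) with hS
  have hνfin : ∀ x ∈ S, ν (g ⁻¹' {x}) ≠ ∞ := by
    intro x hx htop
    have hx0 := (Finset.mem_filter.1 hx).2
    apply hfin
    rw [g.lintegral_eq_lintegral]
    refine top_unique ?_
    calc (∞ : ℝ≥0∞) = x * ν (g ⁻¹' {x}) := by rw [htop, ENNReal.mul_top hx0]
      _ ≤ g.lintegral ν := by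
          unfold SimpleFunc.lintegral
          exact Finset.single_le_sum (f := fun x => x * ν (g ⁻¹' {x})) (fun _ _ => zero_le)
            (Finset.mem_filter.1 hx).1
  have hB : ∀ x, MeasurableSet (g ⁻¹' {x}) := fun x => g.measurableSet_preimage {x}
  have hcount : ∀ᵐ ω ∂P, ∀ x ∈ S, pointCount (fun j => p j ω) (g ⁻¹' {x}) ≠ ∞ := by
    rw [Filter.eventually_all_finset]
    intro x hx
    have := ae_lt_top (measurable_pointCount h.measurable (hB x))
      (by rw [h.lintegral_count (hB x) (hνfin x hx)]; exact hνfin x hx)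
    filter_upwards [this] with ω hω using hω.ne
  have hprod : ∀ ω, ∏ x ∈ S, (1 - x) ^ (pointCount (fun j => p j ω) (g ⁻¹' {x})).toReal
      = ∏ k : Fin S.card, (1 - (S.equivFin.symm k : ℝ≥0∞)) ^
        (pointCount (fun j => p j ω) (g ⁻¹' {(S.equivFin.symm k : ℝ≥0∞)})).toReal := by
    intro ω
    rw [← Finset.prod_coe_sort S, ← Equiv.prod_comp S.equivFin.symm]
  rw [(lintegral_congr_ae (hcount.mono fun ω hω => iInf_prod_simpleFunc hω)).trans
    (lintegral_congr hprod)]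
  have hind := h.indep_count S.card (fun k => g ⁻¹' {(S.equivFin.symm k : ℝ≥0∞)})
    (fun k => hB _) (fun k => hνfin _ (S.equivFin.symm k).2) (by
      intro k l hkl
      refine Disjoint.preimage _ ?_
      rw [disjoint_singleton]
      exact fun e => hkl (S.equivFin.symm.injective (Subtype.ext e)))
  have hmeas : ∀ y : ℝ≥0∞, Measurable fun t : ℝ≥0∞ => (1 - y) ^ t.toReal := fun y =>
    measurable_const.pow ENNReal.measurable_toReal
  have hind2 := hind.comp (fun k t => (1 - (S.equivFin.symm k : ℝ≥0∞)) ^ t.toReal)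
    (fun k => hmeas _)
  have := lintegral_prod_eq_prod_lintegral_of_indepFun (Finset.univ : Finset (Fin S.card))
    (fun k ω => (1 - (S.equivFin.symm k : ℝ≥0∞)) ^
        (pointCount (fun j => p j ω) (g ⁻¹' {(S.equivFin.symm k : ℝ≥0∞)})).toReal)
    hind2 (fun k => (hmeas _).comp (measurable_pointCount h.measurable (hB _)))
  rw [this]
  have hle : ∀ x ∈ S, x ≤ 1 := by
    intro x hx
    obtain ⟨e, rfl⟩ := SimpleFunc.mem_range.1 (Finset.mem_filter.1 hx).1
    exact hg e
  have hterm : ∀ x ∈ S, ∫⁻ ω, (1 - x) ^ (pointCount (fun j => p j ω) (g ⁻¹' {x})).toReal ∂P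
      = ENNReal.ofReal (Real.exp (-(x * ν (g ⁻¹' {x})).toReal)) := by
    intro x hx
    have h1 : 1 - x = ENNReal.ofReal (1 - x.toReal) := by
      rw [ENNReal.ofReal_sub _ ENNReal.toReal_nonneg, ENNReal.ofReal_one,
        ENNReal.ofReal_toReal (ne_top_of_le_ne_top ENNReal.one_ne_top (hle x hx))]
    have h2 : 0 ≤ 1 - x.toReal := by
      have := ENNReal.toReal_mono ENNReal.one_ne_top (hle x hx)
      simp at this; linarith
    rw [h.lintegral_comp_count (hB x) (hνfin x hx) (hmeas x)]
    simp only [ENNReal.toReal_natCast, ENNReal.rpow_natCast]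
    rw [h1, lintegral_pow_poissonMeasure _ h2, ENNReal.toReal_mul]
    congr 3
    rw [show ((ν (g ⁻¹' {x})).toNNReal : ℝ) = (ν (g ⁻¹' {x})).toReal from rfl]
    ring
  rw [Finset.prod_congr rfl fun k _ => hterm _ (S.equivFin.symm k).2,
    Equiv.prod_comp S.equivFin.symm (fun x : S => ENNReal.ofReal (Real.exp
      (-((x : ℝ≥0∞) * ν (g ⁻¹' {(x : ℝ≥0∞)})).toReal))),
    Finset.prod_coe_sort S (fun x => ENNReal.ofReal (Real.exp (-(x * ν (g ⁻¹' {x})).toReal))),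
    ← ENNReal.ofReal_prod_of_nonneg fun _ _ => Real.exp_nonneg _, ← Real.exp_sum]
  congr 2
  rw [Finset.sum_neg_distrib, g.lintegral_eq_lintegral, ← ENNReal.toReal_sum, hS]
  · congr 2
    unfold SimpleFunc.lintegral
    rw [Finset.sum_filter]
    refine Finset.sum_congr rfl fun x _ => ?_
    by_cases hx : x = 0 <;> simp [hx]
  · intro x hx
    exact ENNReal.mul_ne_top (ne_top_of_le_ne_top ENNReal.one_ne_top (hle x hx)) (hνfin x hx)

/-- The generating functional of a Poisson field. -/
theorem iInf_lintegral_prod [IsProbabilityMeasure P] (h : IsPoissonField p ν P)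
    {g : E → ℝ≥0∞} (hgm : Measurable g) (hg : ∀ x, g x ≤ 1) (hfin : ∫⁻ x, g x ∂ν ≠ ∞) :
    ⨅ J, ∫⁻ ω, ∏ j ∈ Finset.range J, (1 - g (p j ω)) ∂P
      = ENNReal.ofReal (Real.exp (-(∫⁻ x, g x ∂ν).toReal)) := by
  have hgn_le : ∀ n x, SimpleFunc.eapprox g n x ≤ g x := fun n x => by
    rw [← SimpleFunc.iSup_eapprox_apply hgm x]
    exact le_iSup (fun n => SimpleFunc.eapprox g n x) n
  have hlim : ∀ (J : ℕ) (ω : Ω), ∏ j ∈ Finset.range J, (1 - g (p j ω))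
      = ⨅ n, ∏ j ∈ Finset.range J, (1 - SimpleFunc.eapprox g n (p j ω)) := by
    intro J ω
    have hanti : Antitone fun n =>
        ∏ j ∈ Finset.range J, (1 - SimpleFunc.eapprox g n (p j ω)) := fun m n hmn =>
      Finset.prod_le_prod' fun j _ =>
        tsub_le_tsub_left (SimpleFunc.monotone_eapprox g hmn (p j ω)) 1
    refine tendsto_nhds_unique ?_ (tendsto_atTop_iInf hanti)
    refine ENNReal.tendsto_finsetProd_of_ne_top _ (fun j _ => ?_) (fun j _ => ?_)
    · refine ENNReal.Tendsto.sub tendsto_const_nhds ?_ (Or.inl ENNReal.one_ne_top)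
      rw [← SimpleFunc.iSup_eapprox_apply hgm (p j ω)]
      exact tendsto_atTop_iSup fun m n hmn => SimpleFunc.monotone_eapprox g hmn (p j ω)
    · exact ne_top_of_le_ne_top ENNReal.one_ne_top tsub_le_self
  have hmeas : ∀ (f : E → ℝ≥0∞), Measurable f → ∀ J,
      Measurable fun ω => ∏ j ∈ Finset.range J, (1 - f (p j ω)) := fun f hf J =>
    Finset.measurable_prod _ fun j _ => measurable_const.sub (hf.comp (h.measurable j))
  have hone : ∀ (f : E → ℝ≥0∞) (J : ℕ),
      ∫⁻ ω, ∏ j ∈ Finset.range J, (1 - f (p j ω)) ∂P ≠ ∞ := by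
    intro f J
    refine ne_top_of_le_ne_top ENNReal.one_ne_top ?_
    calc _ ≤ ∫⁻ _, 1 ∂P := lintegral_mono fun ω => Finset.prod_le_one' fun j _ => tsub_le_self
      _ = 1 := by simp
  have h1 : ∀ J, ∫⁻ ω, ∏ j ∈ Finset.range J, (1 - g (p j ω)) ∂P
      = ⨅ n, ∫⁻ ω, ∏ j ∈ Finset.range J, (1 - SimpleFunc.eapprox g n (p j ω)) ∂P := by
    intro J
    simp_rw [hlim J]
    refine lintegral_iInf (fun n => hmeas _ (SimpleFunc.eapprox g n).measurable J) ?_ (hone _ J)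
    exact fun m n hmn ω => Finset.prod_le_prod' fun j _ =>
        tsub_le_tsub_left (SimpleFunc.monotone_eapprox g hmn (p j ω)) 1
  simp_rw [h1]
  -- Refining the simple approximation and adding points both decrease the product, so both limits
  -- are infima and commute.
  rw [iInf_comm]
  have hfin' : ∀ n, ∫⁻ x, SimpleFunc.eapprox g n x ∂ν ≠ ∞ := fun n =>
    ne_top_of_le_ne_top hfin (lintegral_mono (hgn_le n))
  have h2 : ∀ n, ⨅ J, ∫⁻ ω, ∏ j ∈ Finset.range J, (1 - SimpleFunc.eapprox g n (p j ω)) ∂P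
      = ENNReal.ofReal (Real.exp (-(∫⁻ x, SimpleFunc.eapprox g n x ∂ν).toReal)) := by
    intro n
    rw [← h.lintegral_iInf_prod_simpleFunc (fun x => (hgn_le n x).trans (hg x)) (hfin' n),
      lintegral_iInf (fun J => hmeas _ (SimpleFunc.eapprox g n).measurable J) _ (hone _ 0)]
    exact fun J K hJK ω => antitone_prod_one_sub _ hJK
  simp_rw [h2]
  have hlimI : Tendsto (fun n => ∫⁻ x, SimpleFunc.eapprox g n x ∂ν) atTop (𝓝 (∫⁻ x, g x ∂ν)) := by
    have : ∫⁻ x, g x ∂ν = ⨆ n, ∫⁻ x, SimpleFunc.eapprox g n x ∂ν := by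
      rw [← lintegral_iSup (fun n => (SimpleFunc.eapprox g n).measurable)
        (fun m n hmn x => SimpleFunc.monotone_eapprox g hmn x)]
      exact lintegral_congr fun x => (SimpleFunc.iSup_eapprox_apply hgm x).symm
    rw [this]
    exact tendsto_atTop_iSup fun m n hmn =>
      lintegral_mono fun x => SimpleFunc.monotone_eapprox g hmn x
  refine tendsto_nhds_unique (tendsto_atTop_iInf ?_) ?_
  · intro m n hmn
    refine ENNReal.ofReal_le_ofReal (Real.exp_le_exp.2 (neg_le_neg ?_))
    exact ENNReal.toReal_mono (hfin' n)
      (lintegral_mono fun x => SimpleFunc.monotone_eapprox g hmn x)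
  · refine ENNReal.tendsto_ofReal ((Real.continuous_exp.tendsto _).comp ?_)
    exact ((ENNReal.tendsto_toReal hfin).comp hlimI).neg

end IsPoissonField

end PoissonField

/-! ### Independent marks -/

section Marks

variable {Ω S E M M' : Type*} [MeasurableSpace Ω] [MeasurableSpace S] [MeasurableSpace E]
  [MeasurableSpace M] [MeasurableSpace M'] {P : Measure Ω} [IsProbabilityMeasure P]

/-- Integrating out i.i.d. marks that are independent of `X`. -/
theorem lintegral_prod_iid_marks {X : Ω → S} (hX : Measurable X) {m : ℕ → Ω → M}
    (hm : ∀ j, Measurable (m j)) {μ : Measure M} (hlaw : ∀ j, P.map (m j) = μ)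
    (hiid : iIndepFun m P) (hind : IndepFun X (fun ω j => m j ω) P)
    {h : ℕ → S × M → ℝ≥0∞} (hh : ∀ j, Measurable (h j)) (J : ℕ) :
    ∫⁻ ω, ∏ j ∈ Finset.range J, h j (X ω, m j ω) ∂P
      = ∫⁻ ω, ∏ j ∈ Finset.range J, ∫⁻ r, h j (X ω, r) ∂μ ∂P := by
  have hμ : IsProbabilityMeasure μ := hlaw 0 ▸ Measure.isProbabilityMeasure_map (hm 0).aemeasurable
  have hm' : Measurable fun ω j => m j ω := measurable_pi_lambda _ hm
  have hmap := (indepFun_iff_map_prod_eq_prod_map_map hX.aemeasurable hm'.aemeasurable).1 hind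
  have hpm : IsProbabilityMeasure (P.map fun ω j => m j ω) :=
    Measure.isProbabilityMeasure_map hm'.aemeasurable
  have hH : Measurable fun q : S × (ℕ → M) => ∏ j ∈ Finset.range J, h j (q.1, q.2 j) :=
    Finset.measurable_prod _ fun j _ =>
      (hh j).comp (measurable_fst.prodMk ((measurable_pi_apply j).comp measurable_snd))
  have hG : Measurable fun x : S => ∏ j ∈ Finset.range J, ∫⁻ r, h j (x, r) ∂μ :=
    Finset.measurable_prod _ fun j _ => (hh j).lintegral_prod_right'
  calc ∫⁻ ω, ∏ j ∈ Finset.range J, h j (X ω, m j ω) ∂P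
      = ∫⁻ q, ∏ j ∈ Finset.range J, h j (q.1, q.2 j) ∂(P.map fun ω => (X ω, fun j => m j ω)) :=
        (lintegral_map hH (hX.prodMk hm')).symm
    _ = ∫⁻ x, ∫⁻ y, ∏ j ∈ Finset.range J, h j (x, y j) ∂(P.map fun ω j => m j ω) ∂(P.map X) := by
        rw [hmap, lintegral_prod _ hH.aemeasurable]
    _ = ∫⁻ x, ∏ j ∈ Finset.range J, ∫⁻ r, h j (x, r) ∂μ ∂(P.map X) := by
        refine lintegral_congr fun x => ?_
        have hx : ∀ j, Measurable fun r => h j (x, r) := fun j =>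
          (hh j).comp measurable_prodMk_left
        rw [lintegral_map (f := fun y : ℕ → M => ∏ j ∈ Finset.range J, h j (x, y j))
          (Finset.measurable_prod _ fun j _ => (hx j).comp (measurable_pi_apply j)) hm']
        have := lintegral_prod_eq_prod_lintegral_of_indepFun (Finset.range J)
          (fun j ω => h j (x, m j ω)) (hiid.comp (fun j r => h j (x, r)) hx)
          (fun j => (hx j).comp (hm j))
        rw [this]
        refine Finset.prod_congr rfl fun j _ => ?_
        rw [← hlaw j, lintegral_map (hx j) (hm j)]
    _ = _ := lintegral_map hG hX

theorem lintegral_iid_mark {X : Ω → S} (hX : Measurable X) {m : Ω → M}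
    (hm : Measurable m) {μ : Measure M} (hlaw : P.map m = μ)
    (hind : IndepFun X m P) {h : S × M → ℝ≥0∞} (hh : Measurable h) :
    ∫⁻ ω, h (X ω, m ω) ∂P = ∫⁻ ω, ∫⁻ r, h (X ω, r) ∂μ ∂P := by
  have hμ : IsProbabilityMeasure μ := hlaw ▸ Measure.isProbabilityMeasure_map hm.aemeasurable
  have hmap := (indepFun_iff_map_prod_eq_prod_map_map hX.aemeasurable hm.aemeasurable).1 hind
  rw [← lintegral_map hh (hX.prodMk hm), hmap, hlaw, lintegral_prod _ hh.aemeasurable,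
    lintegral_map hh.lintegral_prod_right' hX]

namespace IsPoissonField

variable {a : ℕ → Ω → E} {ν : Measure E} {ρ : ℕ → Ω → M} {τ : ℕ → Ω → M'}
  {G : Measure M} {F : Measure M'}

/-- The avoidance function of an independently marked Poisson field. -/
theorem measure_forall_marked_notMem [SigmaFinite ν] (ha : IsPoissonField a ν P)
    (hρ : ∀ j, Measurable (ρ j)) (hρl : ∀ j, P.map (ρ j) = G) (hρi : iIndepFun ρ P)
    (hτ : ∀ j, Measurable (τ j)) (hτl : ∀ j, P.map (τ j) = F) (hτi : iIndepFun τ P)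
    (h₁ : IndepFun (fun ω j => a j ω) (fun ω j => ρ j ω) P)
    (h₂ : IndepFun (fun ω => ((fun j => a j ω), (fun j => ρ j ω))) (fun ω j => τ j ω) P)
    {A : Set (E × M × M')} (hA : MeasurableSet A)
    (hfin : ∫⁻ x, ∫⁻ r, F {t | (x, r, t) ∈ A} ∂G ∂ν ≠ ∞) :
    P {ω | ∀ j, (a j ω, ρ j ω, τ j ω) ∉ A}
      = ENNReal.ofReal (Real.exp (-(∫⁻ x, ∫⁻ r, F {t | (x, r, t) ∈ A} ∂G ∂ν).toReal)) := by
  have hGp : IsProbabilityMeasure G :=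
    hρl 0 ▸ Measure.isProbabilityMeasure_map (hρ 0).aemeasurable
  have hFp : IsProbabilityMeasure F :=
    hτl 0 ▸ Measure.isProbabilityMeasure_map (hτ 0).aemeasurable
  have hA' : MeasurableSet {q : (E × M) × M' | (q.1.1, q.1.2, q.2) ∈ A} :=
    (measurable_fst.fst.prodMk (measurable_fst.snd.prodMk measurable_snd)) hA
  have hg₁ : Measurable fun q : E × M => F {t | (q.1, q.2, t) ∈ A} :=
    measurable_measure_prodMk_left hA'
  set g : E → ℝ≥0∞ := fun x => ∫⁻ r, F {t | (x, r, t) ∈ A} ∂G with hg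
  have hgm : Measurable g := hg₁.lintegral_prod_right'
  have hg1 : ∀ x, g x ≤ 1 := fun x => by
    calc g x ≤ ∫⁻ _, 1 ∂G := lintegral_mono fun r => prob_le_one
      _ = 1 := by simp
  rw [← ha.iInf_lintegral_prod hgm hg1 hfin]
  have hz : ∀ j, Measurable fun ω => (a j ω, ρ j ω, τ j ω) := fun j =>
    (ha.measurable j).prodMk ((hρ j).prodMk (hτ j))
  have hset : {ω | ∀ j, (a j ω, ρ j ω, τ j ω) ∉ A}
      = ⋂ J, {ω | ∀ j ∈ Finset.range J, (a j ω, ρ j ω, τ j ω) ∉ A} := by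
    ext ω
    simp only [mem_ofPred_eq, mem_iInter, Finset.mem_range]
    exact ⟨fun h J j _ => h j, fun h j => h (j + 1) j (Nat.lt_succ_self j)⟩
  have hmsJ : ∀ J, MeasurableSet {ω | ∀ j ∈ Finset.range J, (a j ω, ρ j ω, τ j ω) ∉ A} := by
    intro J
    have : {ω | ∀ j ∈ Finset.range J, (a j ω, ρ j ω, τ j ω) ∉ A}
        = ⋂ j ∈ Finset.range J, (fun ω => (a j ω, ρ j ω, τ j ω)) ⁻¹' Aᶜ := by
      ext ω; simp
    rw [this]
    exact Finset.measurableSet_biInter _ fun j _ => hz j hA.compl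
  rw [hset, Antitone.measure_iInter]
  · refine iInf_congr fun J => ?_
    have e1 : P {ω | ∀ j ∈ Finset.range J, (a j ω, ρ j ω, τ j ω) ∉ A}
        = ∫⁻ ω, ∏ j ∈ Finset.range J,
          Aᶜ.indicator (fun _ => (1 : ℝ≥0∞)) (a j ω, ρ j ω, τ j ω) ∂P := by
      rw [← lintegral_indicator_one (hmsJ J)]
      refine lintegral_congr fun ω => ?_
      by_cases h : ∀ j ∈ Finset.range J, (a j ω, ρ j ω, τ j ω) ∉ A
      · rw [indicator_of_mem (by exact h)]
        symm
        exact Finset.prod_eq_one fun j hj => indicator_of_mem (h j hj) _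
      · rw [indicator_of_notMem (by exact h)]
        push Not at h
        obtain ⟨j, hj, hjA⟩ := h
        symm
        refine Finset.prod_eq_zero hj ?_
        exact indicator_of_notMem (notMem_compl_iff.2 hjA) _
    rw [e1]
    have ha' : Measurable fun ω j => a j ω := measurable_pi_lambda _ ha.measurable
    have hρ' : Measurable fun ω j => ρ j ω := measurable_pi_lambda _ hρ
    -- The `τ`-marks are integrated out given `(a, ρ)`, then the `ρ`-marks given `a`. What remains
    -- is the product of the factors `1 - g (a j)`.
    have e2 := lintegral_prod_iid_marks (P := P) (ha'.prodMk hρ') hτ hτl hτi h₂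
      (h := fun j q => Aᶜ.indicator (fun _ => (1 : ℝ≥0∞)) (q.1.1 j, q.1.2 j, q.2))
      (fun j => (measurable_const.indicator hA.compl).comp
        (((measurable_pi_apply j).comp measurable_fst.fst).prodMk
          (((measurable_pi_apply j).comp measurable_fst.snd).prodMk measurable_snd))) J
    have e3 := lintegral_prod_iid_marks (P := P) ha' hρ hρl hρi h₁
      (h := fun j q => 1 - F {t | (q.1 j, q.2, t) ∈ A})
      (fun j => measurable_const.sub (hg₁.comp (f := fun q : (ℕ → E) × M => (q.1 j, q.2))
        (((measurable_pi_apply j).comp measurable_fst).prodMk measurable_snd))) J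
    refine e2.trans (Eq.trans ?_ (e3.trans ?_))
    · refine lintegral_congr fun ω => Finset.prod_congr rfl fun j _ => ?_
      have hs : MeasurableSet {t | (a j ω, ρ j ω, t) ∈ A} :=
        (measurable_const.prodMk (measurable_const.prodMk measurable_id)) hA
      rw [← prob_compl_eq_one_sub hs, ← lintegral_indicator_one hs.compl]
      rfl
    · refine lintegral_congr fun ω => Finset.prod_congr rfl fun j _ => ?_
      have hs : Measurable fun r => F {t | (a j ω, r, t) ∈ A} :=
        hg₁.comp (measurable_const.prodMk measurable_id)
      rw [lintegral_sub hs (ne_top_of_le_ne_top ENNReal.one_ne_top (hg1 _))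
        (ae_of_all _ fun r => prob_le_one)]
      simp [hg]
  · intro J K hJK ω h j hj
    exact h j (Finset.range_mono hJK hj)
  · exact fun J => (hmsJ J).nullMeasurableSet
  · exact ⟨0, measure_ne_top _ _⟩

/-- Only finitely many points of a marked Poisson field lie in a set of finite intensity. -/
theorem ae_finite_marked [SigmaFinite ν] (ha : IsPoissonField a ν P)
    (hρ : ∀ j, Measurable (ρ j)) (hρl : ∀ j, P.map (ρ j) = G)
    (h₁ : IndepFun (fun ω j => a j ω) (fun ω j => ρ j ω) P)
    {A : Set (E × M)} (hA : MeasurableSet A)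
    (hfin : ∫⁻ x, G {r | (x, r) ∈ A} ∂ν ≠ ∞) :
    ∀ᵐ ω ∂P, {j | (a j ω, ρ j ω) ∈ A}.Finite := by
  have hGp : IsProbabilityMeasure G :=
    hρl 0 ▸ Measure.isProbabilityMeasure_map (hρ 0).aemeasurable
  have hz : ∀ j, Measurable fun ω => (a j ω, ρ j ω) := fun j => (ha.measurable j).prodMk (hρ j)
  have hgm : Measurable fun x => G {r | (x, r) ∈ A} := measurable_measure_prodMk_left hA
  have hE : ∫⁻ ω, pointCount (fun j => (a j ω, ρ j ω)) A ∂P ≠ ∞ := by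
    unfold pointCount
    rw [lintegral_tsum (f := fun j ω => A.indicator (fun _ => (1 : ℝ≥0∞)) (a j ω, ρ j ω))
      fun j => ((measurable_const.indicator hA).comp (hz j)).aemeasurable]
    rw [← ha.tsum_lintegral_comp hgm] at hfin
    convert hfin using 3 with j
    have hj : IndepFun (a j) (ρ j) P :=
      h₁.comp (measurable_pi_apply j) (measurable_pi_apply j)
    rw [lintegral_iid_mark (h := fun q => A.indicator (fun _ => (1 : ℝ≥0∞)) q)
      (ha.measurable j) (hρ j) (hρl j) hj (measurable_const.indicator hA)]
    refine lintegral_congr fun ω => ?_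
    have hs : MeasurableSet {r | (a j ω, r) ∈ A} :=
      (measurable_const.prodMk measurable_id) hA
    rw [← lintegral_indicator_one hs]
    rfl
  filter_upwards [ae_lt_top (measurable_pointCount hz hA) hE] with ω hω
    using finite_of_pointCount_ne_top hω.ne

end IsPoissonField

end Marks

/-! ### The folded space-time intensity and the mean delay -/

/-- The distance in space, at equal times, from the fast car's comoving line. -/
def comovingCoord (v₂ y₀ : ℝ) (a : ℝ × ℝ) : ℝ := a.1 - v₂ * a.2 - y₀

/-- Comoving coordinate and sheared (rescaled) time of a slow car; slow cars behind the fast car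
are reflected so as to fill the half plane of negative times. -/
noncomputable def foldedPoint (v₂ κ y₀ : ℝ) (a : ℝ × ℝ) : ℝ × ℝ :=
  if 0 < comovingCoord v₂ y₀ a then
    (comovingCoord v₂ y₀ a, v₂ * a.2 - κ * comovingCoord v₂ y₀ a)
  else (-comovingCoord v₂ y₀ a, -(v₂ * a.2) - κ * -comovingCoord v₂ y₀ a)

theorem measurable_comovingCoord (v₂ y₀ : ℝ) : Measurable (comovingCoord v₂ y₀) := by
  unfold comovingCoord; fun_prop

theorem measurable_foldedPoint (v₂ κ y₀ : ℝ) : Measurable (foldedPoint v₂ κ y₀) := by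
  have h := measurable_comovingCoord v₂ y₀
  unfold foldedPoint
  refine Measurable.ite (measurableSet_lt measurable_const h) ?_ ?_ <;> fun_prop

theorem lintegral_comp_const_mul {c : ℝ} (hc : 0 < c) {f : ℝ → ℝ≥0∞} (hf : Measurable f) :
    ∫⁻ t, f (c * t) = ENNReal.ofReal c⁻¹ * ∫⁻ t, f t := by
  rw [← lintegral_map hf (measurable_const_mul c), Real.map_volume_mul_left hc.ne',
    lintegral_smul_measure, abs_of_pos (inv_pos.2 hc), smul_eq_mul]

theorem setLIntegral_Iic_eq_neg {f : ℝ → ℝ≥0∞} (hf : Measurable f) :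
    ∫⁻ t in Iic 0, f t = ∫⁻ t in Ioi 0, f (-t) := by
  have := (Measure.measurePreserving_neg (volume : Measure ℝ)).setLIntegral_comp_preimage
    (measurableSet_Iic (a := (0 : ℝ))) hf
  rw [← this]
  rw [Measure.restrict_congr_set (Ioi_ae_eq_Ici (μ := volume) (a := (0 : ℝ)))]
  congr 2
  ext x; simp

theorem lintegral_eq_Ioi_add_neg {f : ℝ → ℝ≥0∞} (hf : Measurable f) :
    ∫⁻ t, f t = (∫⁻ t in Ioi 0, f t) + ∫⁻ t in Ioi 0, f (-t) := by
  rw [← setLIntegral_Iic_eq_neg hf, ← lintegral_add_compl f (measurableSet_Ioi (a := (0 : ℝ))),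
    compl_Ioi]

theorem lintegral_spaceTimeIntensity (lam : ℝ) {f : ℝ × ℝ → ℝ≥0∞} (hf : Measurable f) :
    ∫⁻ a, f a ∂(spaceTimeIntensity lam)
      = ENNReal.ofReal lam * ∫⁻ t in Ioi 0, ∫⁻ x, f (x, t) := by
  unfold spaceTimeIntensity
  rw [lintegral_smul_measure, Measure.volume_eq_prod, ← Measure.prod_restrict,
    Measure.restrict_univ, lintegral_prod_symm _ hf.aemeasurable,
    Measure.restrict_congr_set (Ioi_ae_eq_Ici (μ := volume) (a := (0 : ℝ)))]
  rfl

theorem lintegral_comovingCoord (lam v₂ y₀ : ℝ) {f : ℝ × ℝ → ℝ≥0∞} (hf : Measurable f) :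
    ∫⁻ a, f (comovingCoord v₂ y₀ a, a.2) ∂(spaceTimeIntensity lam)
      = ENNReal.ofReal lam * ∫⁻ t in Ioi 0, ∫⁻ y, f (y, t) := by
  rw [lintegral_spaceTimeIntensity lam
    (f := fun a => f (comovingCoord v₂ y₀ a, a.2)) (hf.comp
    ((measurable_comovingCoord v₂ y₀).prodMk measurable_snd))]
  congr 1
  refine lintegral_congr fun t => ?_
  rw [← lintegral_sub_right_eq_self (fun y => f (y, t)) (v₂ * t + y₀)]
  refine lintegral_congr fun x => ?_
  simp only [comovingCoord]
  congr 2
  ring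

instance sigmaFinite_spaceTimeIntensity (lam : ℝ) : SigmaFinite (spaceTimeIntensity lam) := by
  unfold spaceTimeIntensity
  exact inferInstanceAs (SigmaFinite (Real.toNNReal lam • _))

/-- For fixed distance `y > 0` the cars ahead have sheared times `v₂ t - κ y` and the reflected ones
`-v₂ t - κ y`, with `t > 0`. Together these cover the line once, so the image is invariant under
shifts of the sheared time. The factor `1 / v₂` comes from rescaling `t`. -/
theorem map_foldedPoint {lam v₂ κ y₀ : ℝ} (hlam : 0 < lam) (hv₂ : 0 < v₂) :
    (spaceTimeIntensity lam).map (foldedPoint v₂ κ y₀)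
      = ENNReal.ofReal (lam / v₂) •
        ((volume.restrict (Ioi (0 : ℝ))).prod (volume : Measure ℝ)) := by
  refine Measure.ext_of_lintegral _ fun f hf => ?_
  rw [lintegral_map hf (measurable_foldedPoint v₂ κ y₀), lintegral_smul_measure,
    lintegral_prod _ hf.aemeasurable]
  set g : ℝ × ℝ → ℝ≥0∞ := fun q => if 0 < q.1 then f (q.1, v₂ * q.2 - κ * q.1)
    else f (-q.1, -(v₂ * q.2) - κ * -q.1) with hg
  have hgm : Measurable g := by
    refine Measurable.ite (measurableSet_lt measurable_const measurable_fst) ?_ ?_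
    · exact hf.comp (by fun_prop)
    · exact hf.comp (by fun_prop)
  have h1 : ∀ a, f (foldedPoint v₂ κ y₀ a) = g (comovingCoord v₂ y₀ a, a.2) := by
    intro a
    simp only [foldedPoint, hg]
    split_ifs <;> rfl
  simp_rw [h1]
  rw [lintegral_comovingCoord lam v₂ y₀ hgm]
  have h2 : ∀ t, ∫⁻ y, g (y, t) = ∫⁻ y in Ioi 0, (f (y, v₂ * t - κ * y) +
      f (y, v₂ * -t - κ * y)) := by
    intro t
    have hgt : Measurable fun y => g (y, t) := hgm.comp (by fun_prop)
    rw [lintegral_eq_Ioi_add_neg (f := fun y => g (y, t)) hgt, ← lintegral_add_left hgt]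
    refine setLIntegral_congr_fun measurableSet_Ioi fun y hy => ?_
    have hy : 0 < y := hy
    simp only [hg]
    rw [if_pos hy, if_neg (by linarith)]
    simp
  simp_rw [h2]
  rw [lintegral_lintegral_swap]
  · have h3 : ∀ y, ∫⁻ t in Ioi 0, (f (y, v₂ * t - κ * y) + f (y, v₂ * -t - κ * y))
        = ENNReal.ofReal v₂⁻¹ * ∫⁻ b, f (y, b) := by
      intro y
      have hfy : Measurable fun t => f (y, v₂ * t - κ * y) := hf.comp (by fun_prop)
      rw [lintegral_add_left hfy,
        ← lintegral_eq_Ioi_add_neg (f := fun t => f (y, v₂ * t - κ * y)) hfy,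
        lintegral_comp_const_mul hv₂ (f := fun t => f (y, t - κ * y)) (hf.comp (by fun_prop)),
        lintegral_sub_right_eq_self (fun b => f (y, b))]
    simp_rw [h3]
    rw [lintegral_const_mul _ hf.lintegral_prod_right', ← mul_assoc,
      ← ENNReal.ofReal_mul hlam.le, ← div_eq_mul_inv, smul_eq_mul]
  · apply Measurable.aemeasurable
    apply Measurable.add <;> exact hf.comp (by fun_prop)

/-- For `x > 0` the positive `(r, v)` with `α r + β v < x` lie in a rectangle of area `x² / (α β)`.
Tonelli reduces the claim to the second moment of `G`. -/
theorem lintegral_tail_prod_ne_top {G : Measure ℝ} [IsProbabilityMeasure G] {α β : ℝ}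
    (hα : 0 < α) (hβ : 0 < β) (hG : Integrable (fun r : ℝ => r ^ 2) G) :
    ∫⁻ r in Ioi 0, ∫⁻ v in Ioi 0, G (Ioi (α * r + β * v)) ≠ ∞ := by
  have hS : MeasurableSet {q : (ℝ × ℝ) × ℝ | α * q.1.1 < q.2 ∧ β * q.1.2 < q.2} := by
    rw [ofPred_and]
    exact (measurableSet_lt (by fun_prop) (by fun_prop)).inter
      (measurableSet_lt (by fun_prop) (by fun_prop))
  have hm1 : Measurable fun q : (ℝ × ℝ) × ℝ =>
      {q : (ℝ × ℝ) × ℝ | α * q.1.1 < q.2 ∧ β * q.1.2 < q.2}.indicator (fun _ => (1 : ℝ≥0∞)) q :=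
    measurable_const.indicator hS
  have hle : ∫⁻ r in Ioi 0, ∫⁻ v in Ioi 0, G (Ioi (α * r + β * v))
      ≤ ∫⁻ r in Ioi 0, ∫⁻ v in Ioi 0, ∫⁻ x, {q : (ℝ × ℝ) × ℝ | α * q.1.1 < q.2 ∧
        β * q.1.2 < q.2}.indicator (fun _ => (1 : ℝ≥0∞)) ((r, v), x) ∂G := by
    refine setLIntegral_mono' measurableSet_Ioi fun r hr => ?_
    refine setLIntegral_mono' measurableSet_Ioi fun v hv => ?_
    have hr' : 0 < α * r := mul_pos hα hr
    have hv' : 0 < β * v := mul_pos hβ hv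
    rw [← lintegral_indicator_one measurableSet_Ioi]
    refine lintegral_mono fun x => ?_
    by_cases hx : α * r + β * v < x
    · rw [indicator_of_mem (by exact hx), indicator_of_mem]
      · rfl
      · exact ⟨by show α * r < x; linarith, by show β * v < x; linarith⟩
    · rw [indicator_of_notMem (by exact hx)]; exact zero_le
  refine ne_top_of_le_ne_top ?_ hle
  have hswap : ∫⁻ r in Ioi 0, ∫⁻ v in Ioi 0, ∫⁻ x, {q : (ℝ × ℝ) × ℝ | α * q.1.1 < q.2 ∧
        β * q.1.2 < q.2}.indicator (fun _ => (1 : ℝ≥0∞)) ((r, v), x) ∂G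
      = ∫⁻ x, (∫⁻ r in Ioi 0, ∫⁻ v in Ioi 0, {q : (ℝ × ℝ) × ℝ | α * q.1.1 < q.2 ∧
        β * q.1.2 < q.2}.indicator (fun _ => (1 : ℝ≥0∞)) ((r, v), x)) ∂G := by
    rw [← lintegral_lintegral_swap (ν := G)]
    · refine lintegral_congr fun r => ?_
      refine lintegral_lintegral_swap ?_
      exact (hm1.comp (by fun_prop : Measurable fun q : ℝ × ℝ => ((r, q.1), q.2))).aemeasurable
    · apply Measurable.aemeasurable
      exact Measurable.lintegral_prod_right' (ν := volume.restrict (Ioi (0 : ℝ)))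
        (f := fun q : (ℝ × ℝ) × ℝ => {q : (ℝ × ℝ) × ℝ | α * q.1.1 < q.2 ∧
        β * q.1.2 < q.2}.indicator (fun _ => (1 : ℝ≥0∞)) ((q.1.1, q.2), q.1.2))
        (hm1.comp (by fun_prop))
  rw [hswap]
  have hx : ∀ x, ∫⁻ r in Ioi 0, ∫⁻ v in Ioi 0, {q : (ℝ × ℝ) × ℝ | α * q.1.1 < q.2 ∧
        β * q.1.2 < q.2}.indicator (fun _ => (1 : ℝ≥0∞)) ((r, v), x)
      ≤ ENNReal.ofReal (α⁻¹ * β⁻¹ * x ^ 2) := by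
    intro x
    have h1 : ∀ γ : ℝ, 0 < γ → ∫⁻ v in Ioi 0, (Ioo 0 (x / γ)).indicator (fun _ => (1 : ℝ≥0∞)) v
        ≤ ENNReal.ofReal (x / γ) := by
      intro γ hγ
      rw [lintegral_indicator measurableSet_Ioo, setLIntegral_const, one_mul]
      refine (Measure.restrict_apply_le _ _).trans ?_
      simp
    by_cases hx0 : 0 < x
    swap
    · have : ∀ r ∈ Ioi (0 : ℝ), ∫⁻ v in Ioi 0, {q : (ℝ × ℝ) × ℝ | α * q.1.1 < q.2 ∧
        β * q.1.2 < q.2}.indicator (fun _ => (1 : ℝ≥0∞)) ((r, v), x) = 0 := by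
        intro r hr
        rw [← lintegral_zero (μ := volume.restrict (Ioi (0 : ℝ)))]
        refine lintegral_congr fun v => indicator_of_notMem ?_ _
        rintro ⟨h, -⟩
        have : 0 < α * r := mul_pos hα hr
        have h : α * r < x := h
        linarith
      rw [setLIntegral_congr_fun measurableSet_Ioi this]
      simp
    calc _ ≤ ∫⁻ r in Ioi 0, (Ioo 0 (x / α)).indicator (fun _ => (1 : ℝ≥0∞)) r *
            ∫⁻ v in Ioi 0, (Ioo 0 (x / β)).indicator (fun _ => (1 : ℝ≥0∞)) v := by
          refine setLIntegral_mono' measurableSet_Ioi fun r hr => ?_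
          by_cases hrx : α * r < x
          · rw [indicator_of_mem (by exact ⟨hr, by rw [lt_div_iff₀ hα]; linarith⟩), one_mul]
            refine setLIntegral_mono' measurableSet_Ioi fun v hv => ?_
            by_cases hvx : β * v < x
            · rw [indicator_of_mem (a := v) (by exact ⟨hv, by rw [lt_div_iff₀ hβ]; linarith⟩)]
              exact indicator_le_self' (fun _ _ => zero_le) _
            · rw [indicator_of_notMem]
              · exact zero_le
              · exact fun h => hvx h.2
          · refine le_of_eq_of_le ?_ zero_le
            rw [← lintegral_zero (μ := volume.restrict (Ioi (0 : ℝ)))]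
            exact lintegral_congr fun v => indicator_of_notMem (fun h => hrx h.1) _
      _ = (∫⁻ r in Ioi 0, (Ioo 0 (x / α)).indicator (fun _ => (1 : ℝ≥0∞)) r) *
            ∫⁻ v in Ioi 0, (Ioo 0 (x / β)).indicator (fun _ => (1 : ℝ≥0∞)) v := by
          rw [lintegral_mul_const]
          exact measurable_const.indicator measurableSet_Ioo
      _ ≤ ENNReal.ofReal (x / α) * ENNReal.ofReal (x / β) := mul_le_mul' (h1 α hα) (h1 β hβ)
      _ = ENNReal.ofReal (α⁻¹ * β⁻¹ * x ^ 2) := by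
          rw [← ENNReal.ofReal_mul (by positivity)]
          congr 1
          field_simp
  refine ne_top_of_le_ne_top ?_ (lintegral_mono hx)
  exact (hG.const_mul (α⁻¹ * β⁻¹)).lintegral_lt_top.ne

theorem lintegral_eq_setLIntegral_meas_lt {α : Type*} [MeasurableSpace α] (μ : Measure α)
    [SFinite μ] {f : α → ℝ≥0∞} (hf : Measurable f) :
    ∫⁻ x, f x ∂μ = ∫⁻ r in Ioi (0 : ℝ), μ {x | ENNReal.ofReal r < f x} := by
  have hS : MeasurableSet {q : α × ℝ | ENNReal.ofReal q.2 < f q.1} :=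
    measurableSet_lt (by fun_prop) (hf.comp measurable_fst)
  have h1 : ∀ y : ℝ≥0∞, y = ∫⁻ r in Ioi (0 : ℝ),
      {r : ℝ | ENNReal.ofReal r < y}.indicator (fun _ => 1) r := by
    intro y
    have hy : MeasurableSet {r : ℝ | ENNReal.ofReal r < y} :=
      measurableSet_lt (by fun_prop) measurable_const
    rw [lintegral_indicator hy, setLIntegral_const, one_mul, Measure.restrict_apply hy]
    induction y using ENNReal.recTopCoe with
    | top =>
      have : {r : ℝ | ENNReal.ofReal r < ∞} ∩ Ioi 0 = Ioi 0 := by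
        ext r; simp
      rw [this, Real.volume_Ioi]
    | coe y =>
      have : {r : ℝ | ENNReal.ofReal r < y} ∩ Ioi 0 = Ioo 0 (y : ℝ) := by
        ext r
        simp only [mem_inter_iff, mem_ofPred_eq, mem_Ioi, mem_Ioo]
        rw [and_comm]
        refine and_congr_right fun hr => ?_
        rw [← ENNReal.ofReal_coe_nnreal, ENNReal.ofReal_lt_ofReal_iff_of_nonneg hr.le]
      rw [this, Real.volume_Ioo, sub_zero, ENNReal.ofReal_coe_nnreal]
  calc ∫⁻ x, f x ∂μ = ∫⁻ x, (∫⁻ r in Ioi (0 : ℝ),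
        {q : α × ℝ | ENNReal.ofReal q.2 < f q.1}.indicator (fun _ => 1) (x, r)) ∂μ :=
        lintegral_congr fun x => h1 (f x)
    _ = ∫⁻ r in Ioi (0 : ℝ), ∫⁻ x,
        {q : α × ℝ | ENNReal.ofReal q.2 < f q.1}.indicator (fun _ => 1) (x, r) ∂μ := by
        rw [lintegral_lintegral_swap]
        exact (measurable_const.indicator hS).aemeasurable
    _ = _ := by
        refine lintegral_congr fun r => ?_
        have hr : MeasurableSet {x | ENNReal.ofReal r < f x} := measurableSet_lt measurable_const hf
        rw [← lintegral_indicator_one hr]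
        rfl

/-- Up to the intensity, the rate at which delays longer than `r` occur. -/
noncomputable def delayTail (F : Measure ℝ≥0∞) (G : Measure ℝ) (r : ℝ) : ℝ≥0∞ :=
  F (Ioi (ENNReal.ofReal r)) * ∫⁻ v in Ioi 0, G (Ioi (r + v))

theorem residualLaw_Ioi {G : Measure ℝ} [IsProbabilityMeasure G] (hm : 0 < ∫ r, r ∂G) {r : ℝ}
    (hr : 0 < r) : residualLaw G (Ioi r)
      = ENNReal.ofReal (∫ r, r ∂G)⁻¹ * ∫⁻ v in Ioi 0, G (Ioi (r + v)) := by
  have h1 : ∀ x, ENNReal.ofReal ((∫ r, r ∂G)⁻¹ * (1 - cdf G x))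
      = ENNReal.ofReal (∫ r, r ∂G)⁻¹ * G (Ioi x) := by
    intro x
    rw [ENNReal.ofReal_mul (inv_nonneg.2 hm.le), ← compl_Iic, prob_compl_eq_one_sub measurableSet_Iic,
      ENNReal.ofReal_sub _ (cdf_nonneg G x), ENNReal.ofReal_one, ofReal_cdf]
  have hmeas : Measurable fun x => G (Ioi x) :=
    Antitone.measurable fun x y hxy => measure_mono (Ioi_subset_Ioi hxy)
  unfold residualLaw
  simp_rw [h1]
  rw [withDensity_apply _ measurableSet_Ioi, Measure.restrict_restrict measurableSet_Ioi,
    inter_eq_left.2 (Ioi_subset_Ioi hr.le), lintegral_const_mul _ hmeas]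
  congr 1
  rw [← lintegral_indicator measurableSet_Ioi, ← lintegral_indicator measurableSet_Ioi,
    ← lintegral_sub_right_eq_self ((Ioi (0 : ℝ)).indicator fun v => G (Ioi (r + v))) r]
  refine lintegral_congr fun x => ?_
  by_cases hx : r < x
  · rw [indicator_of_mem (by exact hx), indicator_of_mem (by simpa using hx)]
    simp
  · rw [indicator_of_notMem (by exact hx), indicator_of_notMem (by simpa using hx)]

theorem measurable_tail_add {G : Measure ℝ} [IsProbabilityMeasure G] :
    Measurable fun q : ℝ × ℝ => G (Ioi (q.1 + q.2)) := by
  have hmeas : Measurable fun x => G (Ioi x) :=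
    Antitone.measurable fun x y hxy => measure_mono (Ioi_subset_Ioi hxy)
  exact hmeas.comp (by fun_prop)

theorem measurable_delayTail {F : Measure ℝ≥0∞} {G : Measure ℝ} [IsProbabilityMeasure G] :
    Measurable (delayTail F G) := by
  unfold delayTail
  refine Measurable.mul ?_ (measurable_tail_add (G := G)).lintegral_prod_right'
  exact Antitone.measurable fun x y hxy =>
    measure_mono (Ioi_subset_Ioi (ENNReal.ofReal_le_ofReal hxy))

theorem lintegral_delayTail_ne_top {F : Measure ℝ≥0∞} [IsProbabilityMeasure F] {G : Measure ℝ}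
    [IsProbabilityMeasure G] (hG : Integrable (fun r : ℝ => r ^ 2) G) :
    ∫⁻ r in Ioi 0, delayTail F G r ≠ ∞ := by
  have h := lintegral_tail_prod_ne_top one_pos one_pos hG
  simp only [one_mul] at h
  refine ne_top_of_le_ne_top h (lintegral_mono fun r => ?_)
  exact mul_le_of_le_one_left' prob_le_one

instance (G : Measure ℝ) : SFinite (residualLaw G) := by
  unfold residualLaw; infer_instance

/-- The mean of the delay tail in terms of the mean following distance. -/
theorem toReal_lintegral_delayTail {v₂ : ℝ} {F : Measure ℝ≥0∞} [IsProbabilityMeasure F]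
    {G : Measure ℝ} [IsProbabilityMeasure G] (hm : 0 < ∫ r, r ∂G) :
    (∫⁻ r in Ioi 0, delayTail (F.map fun t => ENNReal.ofReal v₂ * t) G r).toReal
      = (∫ r, r ∂G) * meanFollowingConst v₂ F G := by
  have hmin : Measurable fun q : ℝ≥0∞ × ℝ => min (ENNReal.ofReal v₂ * q.1) (ENNReal.ofReal q.2) :=
    Measurable.min (by fun_prop) (by fun_prop)
  have h1 : meanFollowingConst v₂ F G
      = (∫⁻ q, min (ENNReal.ofReal v₂ * q.1) (ENNReal.ofReal q.2)
          ∂(F.prod (residualLaw G))).toReal := by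
    unfold meanFollowingConst
    rw [integral_toReal hmin.aemeasurable]
    exact ae_of_all _ fun q => (min_le_right _ _).trans_lt ENNReal.ofReal_lt_top
  have h2 : ∫⁻ q, min (ENNReal.ofReal v₂ * q.1) (ENNReal.ofReal q.2) ∂(F.prod (residualLaw G))
      = ENNReal.ofReal (∫ r, r ∂G)⁻¹ *
        ∫⁻ r in Ioi 0, delayTail (F.map fun t => ENNReal.ofReal v₂ * t) G r := by
    -- By the layer-cake formula the mean is an integral of tails. The tail of the minimum factors
    -- by independence, and its second factor is the tail of the residual law.
    rw [lintegral_eq_setLIntegral_meas_lt _ hmin, ← lintegral_const_mul _ measurable_delayTail]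
    refine setLIntegral_congr_fun measurableSet_Ioi fun r hr => ?_
    have hr : 0 < r := hr
    have hset : {q : ℝ≥0∞ × ℝ | ENNReal.ofReal r < min (ENNReal.ofReal v₂ * q.1) (ENNReal.ofReal q.2)}
        = ((fun t => ENNReal.ofReal v₂ * t) ⁻¹' Ioi (ENNReal.ofReal r)) ×ˢ Ioi r := by
      ext q
      simp only [mem_ofPred_eq, lt_min_iff, mem_prod, mem_preimage, mem_Ioi]
      rw [ENNReal.ofReal_lt_ofReal_iff_of_nonneg hr.le]
    simp only [delayTail]
    rw [hset, Measure.prod_prod, residualLaw_Ioi hm hr,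
      Measure.map_apply (measurable_const_mul _) measurableSet_Ioi]
    ring
  rw [h1, h2, ENNReal.toReal_mul, ENNReal.toReal_ofReal (inv_nonneg.2 hm.le), ← mul_assoc,
    mul_inv_cancel₀ hm.ne', one_mul]

/-! ### Delays caused by the slow cars of a cell -/

/-- A slow car in comoving coordinates: `((position, start), length, overtaking time)`. -/
abbrev MarkedCar := (ℝ × ℝ) × ℝ × ℝ≥0∞

/-- The delay that the slow car `e` causes to a fast car arriving at time `s`. -/
noncomputable def carDelay (e : MarkedCar) (s : ℝ) : ℝ≥0∞ :=
  if e.1.2 < s then min e.2.2 (ENNReal.ofReal (e.1.2 + e.2.1 - s)) else 0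

/-- The largest delay that a single slow car with position in `I` causes to a fast car arriving
at time `s`. -/
noncomputable def cellDelay (I : Set ℝ) (w : ℕ → MarkedCar) (s : ℝ) : ℝ≥0∞ :=
  ⨆ j, ⨆ (_ : (w j).1.1 ∈ I), carDelay (w j) s

/-- The slow cars with position in `I` that cause a delay of more than `r` to a fast car arriving
at time `s`. -/
def delaySet (I : Set ℝ) (s : ℝ) (r : ℝ≥0∞) : Set MarkedCar :=
  {e | e.1.1 ∈ I ∧ e.1.2 < s ∧ r < e.2.2 ∧ r < ENNReal.ofReal (e.1.2 + e.2.1 - s)}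

theorem measurableSet_delaySet {I : Set ℝ} (hI : MeasurableSet I) (s : ℝ) (r : ℝ≥0∞) :
    MeasurableSet (delaySet I s r) := by
  have h : Measurable fun e : MarkedCar => ENNReal.ofReal (e.1.2 + e.2.1 - s) := by fun_prop
  exact (measurable_fst.fst hI).inter ((measurableSet_lt measurable_fst.snd measurable_const).inter
    ((measurableSet_lt measurable_const measurable_snd.snd).inter
    (measurableSet_lt measurable_const h)))

theorem lt_carDelay_iff {e : MarkedCar} {s : ℝ} {r : ℝ≥0∞} :
    r < carDelay e s ↔ e.1.2 < s ∧ r < e.2.2 ∧ r < ENNReal.ofReal (e.1.2 + e.2.1 - s) := by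
  unfold carDelay
  split_ifs with h
  · simp [h]
  · simp [h]

theorem lt_cellDelay_iff {I : Set ℝ} {w : ℕ → MarkedCar} {s : ℝ} {r : ℝ≥0∞} :
    r < cellDelay I w s ↔ ∃ j, w j ∈ delaySet I s r := by
  simp only [cellDelay, lt_iSup_iff, lt_carDelay_iff, delaySet, mem_ofPred_eq, exists_prop]

theorem carDelay_le_cellDelay {I : Set ℝ} {w : ℕ → MarkedCar} {j : ℕ} (hj : (w j).1.1 ∈ I)
    (s : ℝ) : carDelay (w j) s ≤ cellDelay I w s :=
  le_iSup_of_le j (le_iSup_of_le hj le_rfl)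

theorem cellDelay_mono {I J : Set ℝ} (h : I ⊆ J) (w : ℕ → MarkedCar) (s : ℝ) :
    cellDelay I w s ≤ cellDelay J w s :=
  iSup_le fun _ => iSup_le fun hj => carDelay_le_cellDelay (h hj) s

theorem cellDelay_union (I J : Set ℝ) (w : ℕ → MarkedCar) (s : ℝ) :
    cellDelay (I ∪ J) w s = max (cellDelay I w s) (cellDelay J w s) := by
  refine le_antisymm (iSup_le fun j => iSup_le fun hj => ?_)
    (max_le (cellDelay_mono subset_union_left w s) (cellDelay_mono subset_union_right w s))
  rcases hj with hj | hj
  · exact (carDelay_le_cellDelay hj s).trans (le_max_left _ _)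
  · exact (carDelay_le_cellDelay hj s).trans (le_max_right _ _)

/-- Arriving earlier by `s' - s` lengthens the delay by at most that amount. Hence departure times
are monotone in arrival times, which drives all comparisons of schemes. -/
theorem carDelay_le_add {e : MarkedCar} {s s' : ℝ} (h : s ≤ s') :
    carDelay e s ≤ ENNReal.ofReal (s' - s) + carDelay e s' := by
  unfold carDelay
  split_ifs with h1 h2 h2
  · rw [← min_add_add_left]
    refine le_min ((min_le_left _ _).trans le_add_self) ((min_le_right _ _).trans ?_)
    refine (ENNReal.ofReal_le_ofReal ?_).trans ENNReal.ofReal_add_le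
    linarith
  · exact absurd (h1.trans_le h) h2
  · exact zero_le
  · exact zero_le

theorem cellDelay_le_add {I : Set ℝ} {w : ℕ → MarkedCar} {s s' : ℝ} (h : s ≤ s') :
    cellDelay I w s ≤ ENNReal.ofReal (s' - s) + cellDelay I w s' :=
  iSup_le fun _ => iSup_le fun hj =>
    (carDelay_le_add h).trans (add_le_add_right (carDelay_le_cellDelay hj s') _)

/-- The delay is determined by its values at rational arrival times. -/
theorem lt_cellDelay_iff_exists_rat {I : Set ℝ} {w : ℕ → MarkedCar} {s : ℝ} {r : ℝ≥0∞} :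
    r < cellDelay I w s ↔ ∃ q : ℚ, (q : ℝ) < s ∧ r + ENNReal.ofReal (s - q) < cellDelay I w q := by
  constructor
  · intro h
    have hr : r ≠ ∞ := h.ne_top
    obtain ⟨j, hjI, h1, h2, h3⟩ := lt_cellDelay_iff.1 h
    have hcont : Tendsto (fun x : ℝ => r + ENNReal.ofReal (s - x)) (𝓝 s) (𝓝 (r + 0)) := by
      refine tendsto_const_nhds.add ?_
      rw [← ENNReal.ofReal_zero, ← sub_self s]
      exact ENNReal.tendsto_ofReal (tendsto_const_nhds.sub tendsto_id)
    have hcont2 : Tendsto (fun x : ℝ => ENNReal.ofReal ((w j).1.2 + (w j).2.1 - x)) (𝓝 s)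
        (𝓝 (ENNReal.ofReal ((w j).1.2 + (w j).2.1 - s))) :=
      ENNReal.tendsto_ofReal (tendsto_const_nhds.sub tendsto_id)
    rw [add_zero] at hcont
    have hev : ∀ᶠ x in 𝓝 s, (w j).1.2 < x ∧ r + ENNReal.ofReal (s - x) < (w j).2.2 ∧
        r + ENNReal.ofReal (s - x) < ENNReal.ofReal ((w j).1.2 + (w j).2.1 - x) :=
      (lt_mem_nhds h1).and ((hcont.eventually (gt_mem_nhds h2)).and (hcont.eventually_lt hcont2 h3))
    obtain ⟨ε, hε, hball⟩ := Metric.eventually_nhds_iff.1 hev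
    obtain ⟨q, hq1, hq2⟩ := exists_rat_btwn (show s - ε < s by linarith)
    refine ⟨q, hq2, lt_cellDelay_iff.2 ⟨j, hjI, ?_⟩⟩
    exact hball (by rw [Real.dist_eq, abs_lt]; constructor <;> linarith)
  · rintro ⟨q, hq, h⟩
    have := h.trans_le (cellDelay_le_add (I := I) (w := w) hq.le)
    rw [add_comm] at this
    exact lt_of_add_lt_add_left this

/-! ### Avoidance functions and independence -/

section Avoidance

variable {Ω E : Type*} [mΩ : MeasurableSpace Ω] [MeasurableSpace E] {P : Measure Ω}

/-- The random points `z 0, z 1, …` have the avoidance function of a Poisson process with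
intensity measure `μ`. -/
structure HasPoissonAvoidance (z : ℕ → Ω → E) (μ : Measure E) (P : Measure Ω) : Prop where
  measurable : ∀ j, Measurable (z j)
  measure_void : ∀ A : Set E, MeasurableSet A → μ A ≠ ∞ →
    P {ω | ∀ j, z j ω ∉ A} = ENNReal.ofReal (Real.exp (-(μ A).toReal))

/-- The events that the points `z j` avoid a given part of `D`. -/
def voidEvents (z : ℕ → Ω → E) (μ : Measure E) (D : Set E) : Set (Set Ω) :=
  {S | ∃ A, MeasurableSet A ∧ A ⊆ D ∧ μ A ≠ ∞ ∧ S = {ω | ∀ j, z j ω ∉ A}}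

/-- The `σ`-algebra generated by the events that the points `z j` avoid a given part of `D`. -/
@[reducible]
def voidAlgebra (z : ℕ → Ω → E) (μ : Measure E) (D : Set E) : MeasurableSpace Ω :=
  MeasurableSpace.generateFrom (voidEvents z μ D)

variable {z : ℕ → Ω → E} {μ : Measure E}

theorem isPiSystem_voidEvents (z : ℕ → Ω → E) (μ : Measure E) (D : Set E) :
    IsPiSystem (voidEvents z μ D) := by
  rintro _ ⟨A, hA, hAD, hμA, rfl⟩ _ ⟨B, hB, hBD, hμB, rfl⟩ -
  refine ⟨A ∪ B, hA.union hB, union_subset hAD hBD,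
    (measure_union_lt_top hμA.lt_top hμB.lt_top).ne, ?_⟩
  ext ω
  simp only [mem_inter_iff, mem_ofPred_eq, mem_union, not_or]
  exact forall_and.symm

theorem measurableSet_void (hz : ∀ j, Measurable (z j)) {A : Set E} (hA : MeasurableSet A) :
    MeasurableSet {ω | ∀ j, z j ω ∉ A} := by
  have : {ω | ∀ j, z j ω ∉ A} = ⋂ j, z j ⁻¹' Aᶜ := by ext; simp
  rw [this]
  exact MeasurableSet.iInter fun j => hz j hA.compl

theorem voidAlgebra_le (hz : ∀ j, Measurable (z j)) (D : Set E) : voidAlgebra z μ D ≤ mΩ := by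
  refine MeasurableSpace.generateFrom_le ?_
  rintro _ ⟨A, hA, -, -, rfl⟩
  exact measurableSet_void hz hA

theorem voidAlgebra_mono {D D' : Set E} (h : D ⊆ D') : voidAlgebra z μ D ≤ voidAlgebra z μ D' :=
  MeasurableSpace.generateFrom_mono fun _ ⟨A, hA, hAD, hμ, e⟩ => ⟨A, hA, hAD.trans h, hμ, e⟩

/-- Avoiding both `A` and `B` means avoiding `A ∪ B`, so the exponential of the additive intensity
factors for disjoint sets. Void events form a `π`-system, so this extends to the generated
`σ`-algebras. -/
theorem HasPoissonAvoidance.indep_voidAlgebra [IsProbabilityMeasure P]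
    (h : HasPoissonAvoidance z μ P) {D D' : Set E} (hD : Disjoint D D') :
    Indep (voidAlgebra z μ D) (voidAlgebra z μ D') P := by
  refine IndepSets.indep (voidAlgebra_le h.measurable D) (voidAlgebra_le h.measurable D')
    (isPiSystem_voidEvents z μ D) (isPiSystem_voidEvents z μ D') rfl rfl ?_
  rw [IndepSets_iff]
  rintro _ _ ⟨A, hA, hAD, hμA, rfl⟩ ⟨B, hB, hBD, hμB, rfl⟩
  have hAB : Disjoint A B := hD.mono hAD hBD
  have hset : {ω | ∀ j, z j ω ∉ A} ∩ {ω | ∀ j, z j ω ∉ B} = {ω | ∀ j, z j ω ∉ A ∪ B} := by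
    ext ω
    simp only [mem_inter_iff, mem_ofPred_eq, mem_union, not_or]
    exact forall_and.symm
  rw [hset, h.measure_void _ (hA.union hB) (measure_union_lt_top hμA.lt_top hμB.lt_top).ne,
    h.measure_void _ hA hμA, h.measure_void _ hB hμB, measure_union hAB hB,
    ENNReal.toReal_add hμA hμB, ← ENNReal.ofReal_mul (Real.exp_nonneg _), ← Real.exp_add]
  congr 2
  ring

theorem measurableSet_voidAlgebra_exists {D A : Set E} (hA : MeasurableSet A) (hAD : A ⊆ D)
    (hμ : μ A ≠ ∞) : MeasurableSet[voidAlgebra z μ D] {ω | ∃ j, z j ω ∈ A} := by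
  have : {ω | ∃ j, z j ω ∈ A} = {ω | ∀ j, z j ω ∉ A}ᶜ := by ext; simp
  rw [this]
  exact MeasurableSet.compl (MeasurableSpace.measurableSet_generateFrom ⟨A, hA, hAD, hμ, rfl⟩)

/-- A function of fresh randomness whose law does not depend on its parameter stays independent
of the past, with the same law, when the parameter is chosen according to the past. -/
theorem measure_inter_comp_of_indepFun [IsProbabilityMeasure P] {Ω' : Type*} [MeasurableSpace Ω']
    {V : Ω → ℝ} (hV : Measurable V) {Y : Ω → Ω'} (hY : Measurable Y) {A : Set Ω}
    (hA : MeasurableSet A)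
    (hind : IndepFun (fun ω => (V ω, A.indicator (fun _ => (1 : ℝ≥0∞)) ω)) Y P)
    {D : ℝ → Ω' → ℝ≥0∞} (hD : Measurable fun q : ℝ × Ω' => D q.1 q.2)
    {L : Measure ℝ≥0∞} (hL : ∀ s, P.map (fun ω => D s (Y ω)) = L)
    {B : Set ℝ≥0∞} (hB : MeasurableSet B) :
    P (A ∩ {ω | D (V ω) (Y ω) ∈ B}) = P A * L B := by
  -- The indicator of `A` is carried along with the parameter `V`, so that the restriction to `A`
  -- becomes a factor that is constant in the fresh randomness.
  have hX : Measurable fun ω => (V ω, A.indicator (fun _ => (1 : ℝ≥0∞)) ω) :=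
    hV.prodMk (measurable_const.indicator hA)
  have hDB : MeasurableSet {q : ℝ × Ω' | D q.1 q.2 ∈ B} := hD hB
  have hhm : Measurable fun q : (ℝ × ℝ≥0∞) × Ω' =>
      q.1.2 * {q : ℝ × Ω' | D q.1 q.2 ∈ B}.indicator (fun _ => (1 : ℝ≥0∞)) (q.1.1, q.2) :=
    measurable_fst.snd.mul ((measurable_const.indicator hDB).comp
      (measurable_fst.fst.prodMk measurable_snd))
  have key := lintegral_iid_mark hX hY rfl hind hhm
  have hDs : ∀ s, Measurable (D s) := fun s => hD.comp measurable_prodMk_left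
  have hDV : Measurable fun ω => D (V ω) (Y ω) := hD.comp (hV.prodMk hY)
  have hl : P (A ∩ {ω | D (V ω) (Y ω) ∈ B}) = ∫⁻ ω, A.indicator (fun _ => (1 : ℝ≥0∞)) ω *
      {q : ℝ × Ω' | D q.1 q.2 ∈ B}.indicator (fun _ => 1) (V ω, Y ω) ∂P := by
    have hDVB : MeasurableSet {ω | D (V ω) (Y ω) ∈ B} := hDV hB
    rw [← lintegral_indicator_one (hA.inter hDVB)]
    refine lintegral_congr fun ω => ?_
    by_cases h1 : ω ∈ A <;> by_cases h2 : D (V ω) (Y ω) ∈ B <;> simp [h1, h2]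
  rw [hl]
  refine key.trans ?_
  have hr : ∀ ω, ∫⁻ r, A.indicator (fun _ => (1 : ℝ≥0∞)) ω *
      {q : ℝ × Ω' | D q.1 q.2 ∈ B}.indicator (fun _ => 1) (V ω, r) ∂(P.map Y)
      = A.indicator (fun _ => (1 : ℝ≥0∞)) ω * L B := by
    intro ω
    have hm : Measurable fun r =>
      {q : ℝ × Ω' | D q.1 q.2 ∈ B}.indicator (fun _ => (1 : ℝ≥0∞)) (V ω, r) :=
      (measurable_const.indicator hDB).comp measurable_prodMk_left
    rw [lintegral_const_mul _ hm, lintegral_map hm hY]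
    congr 1
    have hDVω : Measurable fun ω' => D (V ω) (Y ω') := (hDs (V ω)).comp hY
    rw [← hL (V ω), Measure.map_apply hDVω hB, ← lintegral_indicator_one (hDVω hB)]
    rfl
  rw [lintegral_congr hr, lintegral_mul_const _ ((measurable_const.indicator hA))]
  congr 1
  exact lintegral_indicator_one hA

end Avoidance

/-- The identity map from `Ω` to `Ω` equipped with `mG` serves as the random element carrying the
fresh randomness. -/
theorem measure_inter_comp_of_indep {Ω : Type*} {mF mG mΩ : MeasurableSpace Ω} {P : Measure Ω}
    [IsProbabilityMeasure P]
    (hF : mF ≤ mΩ) (hG : mG ≤ mΩ) (hind : Indep mF mG P) {V : Ω → ℝ} (hV : Measurable[mF] V)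
    {D : ℝ → Ω → ℝ≥0∞} (hD : @Measurable (ℝ × Ω) ℝ≥0∞ (@Prod.instMeasurableSpace ℝ Ω _ mG) _
      (fun q => D q.1 q.2))
    {L : Measure ℝ≥0∞} (hL : ∀ s, P.map (D s) = L) {A : Set Ω} (hA : MeasurableSet[mF] A)
    {B : Set ℝ≥0∞} (hB : MeasurableSet B) :
    P (A ∩ {ω | D (V ω) ω ∈ B}) = P A * L B := by
  have hc : Measurable[mF] fun _ : Ω => (1 : ℝ≥0∞) := @measurable_const _ _ _ mF _
  have hX : Measurable[mF] fun ω => (V ω, A.indicator (fun _ => (1 : ℝ≥0∞)) ω) :=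
    Measurable.prodMk hV (Measurable.indicator hc hA)
  refine @measure_inter_comp_of_indepFun Ω mΩ P _ Ω mG V (hV.mono hF le_rfl) id
    (fun S hS => hG S hS) A (hF A hA) ?_ D hD L hL B hB
  refine (@IndepFun_iff_Indep _ _ _ mΩ _ mG _ id P).2 ?_
  rw [MeasurableSpace.comap_id]
  exact indep_of_indep_of_le_left hind fun s ⟨t, ht, e⟩ => e ▸ hX ht

/-- The delay has to be evaluated at a random arrival time, which requires joint measurability. The
description by rational arrival times writes superlevel sets as countable unions of measurable sets.
-/
theorem measurable_cellDelay_uncurry {Ω : Type*} [MeasurableSpace Ω] {w : Ω → ℕ → MarkedCar}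
    {I : Set ℝ} (h : ∀ s : ℝ, Measurable fun ω => cellDelay I (w ω) s) :
    Measurable fun q : ℝ × Ω => cellDelay I (w q.2) q.1 := by
  refine measurable_of_Ioi fun r => ?_
  have : (fun q : ℝ × Ω => cellDelay I (w q.2) q.1) ⁻¹' Ioi r = ⋃ x : ℚ, {q : ℝ × Ω | (x : ℝ) < q.1} ∩
      {q : ℝ × Ω | r + ENNReal.ofReal (q.1 - x) < cellDelay I (w q.2) x} := by
    ext q
    simp only [mem_preimage, mem_Ioi, mem_iUnion, mem_inter_iff, mem_ofPred_eq]
    exact lt_cellDelay_iff_exists_rat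
  rw [this]
  refine MeasurableSet.iUnion fun x => MeasurableSet.inter ?_ ?_
  · exact measurableSet_lt measurable_const measurable_fst
  · exact measurableSet_lt (by fun_prop) ((h x).comp measurable_snd)

/-- The intensity of a marked field of slow cars in the half plane, homogeneous with
intensity `lam`, with lengths distributed as `G` and overtaking times as `F`. -/
noncomputable def carIntensity (lam : ℝ) (G : Measure ℝ) (F : Measure ℝ≥0∞) : Measure MarkedCar :=
  (ENNReal.ofReal lam • ((volume.restrict (Ioi (0 : ℝ))).prod (volume : Measure ℝ))).prod (G.prod F)

/-! ### Law of the delay in one cell -/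

section Law

variable {Ω : Type*} [mΩ : MeasurableSpace Ω] {P : Measure Ω} [IsProbabilityMeasure P]
  {lam : ℝ} {G : Measure ℝ} [IsProbabilityMeasure G] {F : Measure ℝ≥0∞} [IsProbabilityMeasure F]
  {z : ℕ → Ω → MarkedCar}

/-- With `v = s - b > 0` the elapsed sheared time since the start, the delay exceeds `r` exactly
when the route is longer than `r + v` and the overtaking distance exceeds `r`. As `b` ranges over
the whole line, translation invariance removes `s`. -/
theorem carIntensity_delaySet {α β : ℝ} (hα : 0 ≤ α) (s : ℝ) {r : ℝ} (hr : 0 ≤ r) :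
    carIntensity lam G F (delaySet (Ioc α β) s (ENNReal.ofReal r))
      = ENNReal.ofReal lam * (ENNReal.ofReal (β - α) * delayTail F G r) := by
  have hmeas : Measurable fun x => G (Ioi x) :=
    Antitone.measurable fun x y hxy => measure_mono (Ioi_subset_Ioi hxy)
  have hsf : SFinite (ENNReal.ofReal lam •
      ((volume.restrict (Ioi (0 : ℝ))).prod (volume : Measure ℝ))) := inferInstance
  unfold carIntensity
  rw [Measure.prod_apply (measurableSet_delaySet measurableSet_Ioc s _)]
  set f : ℝ → ℝ≥0∞ := (Iio s).indicator fun b => G (Ioi (r + (s - b))) with hf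
  have hfm : Measurable f := (hmeas.comp (by fun_prop)).indicator measurableSet_Iio
  have h1 : ∀ q : ℝ × ℝ, (G.prod F) (Prod.mk q ⁻¹' delaySet (Ioc α β) s (ENNReal.ofReal r))
      = (Ioc α β).indicator (fun _ => 1) q.1 * (f q.2 * F (Ioi (ENNReal.ofReal r))) := by
    intro q
    by_cases hq1 : q.1 ∈ Ioc α β
    · by_cases hq2 : q.2 < s
      · have : Prod.mk q ⁻¹' delaySet (Ioc α β) s (ENNReal.ofReal r)
            = Ioi (r + (s - q.2)) ×ˢ Ioi (ENNReal.ofReal r) := by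
          ext ⟨x, t⟩
          simp only [delaySet, mem_preimage, mem_ofPred_eq, mem_prod, mem_Ioi, hq1, hq2, true_and]
          rw [ENNReal.ofReal_lt_ofReal_iff_of_nonneg hr, and_comm]
          refine and_congr_left fun _ => ?_
          constructor <;> intro h <;> linarith
        rw [this, Measure.prod_prod, indicator_of_mem hq1, one_mul, hf,
          indicator_of_mem (by exact hq2)]
      · have : Prod.mk q ⁻¹' delaySet (Ioc α β) s (ENNReal.ofReal r) = ∅ := by
          ext ⟨x, t⟩
          simp [delaySet, hq2]
        rw [this, hf, indicator_of_notMem (a := q.2) (by exact hq2)]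
        simp
    · have : Prod.mk q ⁻¹' delaySet (Ioc α β) s (ENNReal.ofReal r) = ∅ := by
        exact eq_empty_of_forall_notMem fun p hp => hq1 hp.1
      rw [this, indicator_of_notMem hq1]
      simp
  simp_rw [h1]
  have hind : Measurable ((Ioc α β).indicator fun _ => (1 : ℝ≥0∞)) :=
    measurable_const.indicator measurableSet_Ioc
  rw [lintegral_smul_measure, smul_eq_mul]
  rw [lintegral_prod_mul (f := (Ioc α β).indicator fun _ => (1 : ℝ≥0∞))
    (g := fun b => f b * F (Ioi (ENNReal.ofReal r))) hind.aemeasurable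
    (hfm.mul_const _).aemeasurable]
  congr 2
  · have hsub : Ioc α β ⊆ Ioi 0 := fun x hx => lt_of_le_of_lt hα hx.1
    rw [lintegral_indicator measurableSet_Ioc, setLIntegral_one,
      Measure.restrict_apply measurableSet_Ioc, inter_eq_left.2 hsub, Real.volume_Ioc]
  · rw [lintegral_mul_const _ hfm, mul_comm, delayTail]
    congr 1
    rw [← lintegral_sub_left_eq_self f s, ← lintegral_indicator measurableSet_Ioi]
    refine lintegral_congr fun v => ?_
    by_cases hv : 0 < v
    · rw [hf, indicator_of_mem (by simpa using hv), indicator_of_mem (by exact hv)]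
      simp
    · rw [hf, indicator_of_notMem (by simpa using hv), indicator_of_notMem (by exact hv)]

theorem delayTail_ne_top (hG : Integrable (fun r : ℝ => r ^ 2) G) {r : ℝ} (hr : 0 ≤ r) :
    delayTail F G r ≠ ∞ := by
  refine ENNReal.mul_ne_top (measure_ne_top _ _) ?_
  have hG1 : Integrable (fun x : ℝ => x) G := by
    refine (hG.add (integrable_const (1 : ℝ))).mono' measurable_id.aestronglyMeasurable
      (ae_of_all _ fun x => ?_)
    simp only [Pi.add_apply, Real.norm_eq_abs]
    rw [abs_le]
    constructor <;> nlinarith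
  have h := lintegral_eq_setLIntegral_meas_lt G (f := fun x => ENNReal.ofReal x) (by fun_prop)
  have h2 : ∫⁻ x, ENNReal.ofReal x ∂G ≠ ∞ := hG1.lintegral_lt_top.ne
  rw [h] at h2
  refine ne_top_of_le_ne_top h2 (setLIntegral_mono' measurableSet_Ioi fun v hv => ?_)
  refine measure_mono fun x hx => ?_
  have hv : 0 < v := hv
  have hx : r + v < x := hx
  rw [mem_ofPred_eq, ENNReal.ofReal_lt_ofReal_iff_of_nonneg hv.le]
  linarith

theorem carIntensity_delaySet_ne_top (hG : Integrable (fun r : ℝ => r ^ 2) G) {α β : ℝ}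
    (hα : 0 ≤ α) (s : ℝ) (r : ℝ≥0∞) :
    carIntensity lam G F (delaySet (Ioc α β) s r) ≠ ∞ := by
  have h0 : carIntensity lam G F (delaySet (Ioc α β) s (ENNReal.ofReal 0)) ≠ ∞ := by
    rw [carIntensity_delaySet hα s le_rfl]
    exact ENNReal.mul_ne_top ENNReal.ofReal_ne_top
      (ENNReal.mul_ne_top ENNReal.ofReal_ne_top (delayTail_ne_top hG le_rfl))
  refine ne_top_of_le_ne_top h0 (measure_mono ?_)
  rintro e ⟨h1, h2, h3, h4⟩
  rw [ENNReal.ofReal_zero]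
  exact ⟨h1, h2, zero_le.trans_lt h3, zero_le.trans_lt h4⟩

/-- The information carried by the slow cars with position in `I`. -/
noncomputable abbrev cellAlgebra (z : ℕ → Ω → MarkedCar) (lam : ℝ) (G : Measure ℝ) (F : Measure ℝ≥0∞)
    (I : Set ℝ) : MeasurableSpace Ω :=
  voidAlgebra z (carIntensity lam G F) {e | e.1.1 ∈ I}

theorem measurable_cellDelay_cellAlgebra (hG : Integrable (fun r : ℝ => r ^ 2) G) {α β : ℝ}
    (hα : 0 ≤ α) (s : ℝ) : Measurable[cellAlgebra z lam G F (Ioc α β)]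
      fun ω => cellDelay (Ioc α β) (fun j => z j ω) s := by
  refine @measurable_of_Ioi _ _ _ _ _ (cellAlgebra z lam G F (Ioc α β)) _ _ _ _ fun r => ?_
  have : (fun ω => cellDelay (Ioc α β) (fun j => z j ω) s) ⁻¹' Ioi r
      = {ω | ∃ j, z j ω ∈ delaySet (Ioc α β) s r} := by
    ext ω
    exact lt_cellDelay_iff
  rw [this]
  exact measurableSet_voidAlgebra_exists (measurableSet_delaySet measurableSet_Ioc s r)
    (fun e he => he.1) (carIntensity_delaySet_ne_top hG hα s r)

theorem measurable_cellDelay (hz : ∀ j, Measurable (z j)) {I : Set ℝ} (hI : MeasurableSet I)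
    (s : ℝ) : Measurable fun ω => cellDelay I (fun j => z j ω) s := by
  refine measurable_of_Ioi fun r => ?_
  have : (fun ω => cellDelay I (fun j => z j ω) s) ⁻¹' Ioi r
      = ⋃ j, z j ⁻¹' delaySet I s r := by
    ext ω
    simp only [mem_iUnion]
    exact lt_cellDelay_iff
  rw [this]
  exact MeasurableSet.iUnion fun j => hz j (measurableSet_delaySet hI s r)

theorem measure_lt_cellDelay (h : HasPoissonAvoidance z (carIntensity lam G F) P)
    (hG : Integrable (fun r : ℝ => r ^ 2) G) {α β : ℝ} (hα : 0 ≤ α) (s : ℝ) (r : ℝ≥0∞) :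
    P {ω | r < cellDelay (Ioc α β) (fun j => z j ω) s}
      = 1 - ENNReal.ofReal (Real.exp
        (-(carIntensity lam G F (delaySet (Ioc α β) s r)).toReal)) := by
  have hA := measurableSet_delaySet (measurableSet_Ioc (a := α) (b := β)) s r
  rw [← h.measure_void _ hA (carIntensity_delaySet_ne_top hG hα s r),
    ← prob_compl_eq_one_sub (measurableSet_void h.measurable hA)]
  congr 1
  ext ω
  simp only [mem_ofPred_eq, mem_compl_iff, not_forall, not_not]
  exact lt_cellDelay_iff

/-- The tail of the largest delay is determined by the intensity of the set of cars causing more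
than that delay. This intensity involves the length of the cell but neither its position nor the
arrival time. -/
theorem map_cellDelay_congr (h : HasPoissonAvoidance z (carIntensity lam G F) P)
    (hG : Integrable (fun r : ℝ => r ^ 2) G) {α β α' β' : ℝ} (hα : 0 ≤ α) (hα' : 0 ≤ α')
    (hlen : β - α = β' - α') (s s' : ℝ) :
    P.map (fun ω => cellDelay (Ioc α β) (fun j => z j ω) s)
      = P.map (fun ω => cellDelay (Ioc α' β') (fun j => z j ω) s') := by
  have hm := measurable_cellDelay h.measurable (measurableSet_Ioc (a := α) (b := β)) s
  have hm' := measurable_cellDelay h.measurable (measurableSet_Ioc (a := α') (b := β')) s'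
  have hp := Measure.isProbabilityMeasure_map (μ := P) hm.aemeasurable
  have hp' := Measure.isProbabilityMeasure_map (μ := P) hm'.aemeasurable
  refine Measure.ext_of_Iic _ _ fun r => ?_
  rw [← compl_Ioi, prob_compl_eq_one_sub measurableSet_Ioi,
    prob_compl_eq_one_sub measurableSet_Ioi, Measure.map_apply hm measurableSet_Ioi,
    Measure.map_apply hm' measurableSet_Ioi]
  have e1 := measure_lt_cellDelay h hG hα (β := β) s r
  have e2 := measure_lt_cellDelay h hG hα' (β := β') s' r
  have e3 : carIntensity lam G F (delaySet (Ioc α β) s r)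
      = carIntensity lam G F (delaySet (Ioc α' β') s' r) := by
    by_cases hr : r = ∞
    · have : ∀ (I : Set ℝ) s, delaySet I s ∞ = ∅ := fun I s => by
        ext e; simp [delaySet]
      rw [hr, this, this]
    · rw [← ENNReal.ofReal_toReal hr, carIntensity_delaySet hα s ENNReal.toReal_nonneg,
        carIntensity_delaySet hα' s' ENNReal.toReal_nonneg, hlen]
  rw [e3, ← e2] at e1
  congr 1

theorem lintegral_cellDelay (h : HasPoissonAvoidance z (carIntensity lam G F) P)
    (hlam : 0 ≤ lam) (hG : Integrable (fun r : ℝ => r ^ 2) G) {α β : ℝ} (hα : 0 ≤ α) (hβ : α ≤ β)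
    (s : ℝ) :
    ∫⁻ ω, cellDelay (Ioc α β) (fun j => z j ω) s ∂P
      = ∫⁻ r in Ioi 0, ENNReal.ofReal
        (1 - Real.exp (-(lam * (β - α) * (delayTail F G r).toReal))) := by
  rw [lintegral_eq_setLIntegral_meas_lt P (measurable_cellDelay h.measurable measurableSet_Ioc s)]
  refine setLIntegral_congr_fun measurableSet_Ioi fun r hr => ?_
  have hr : 0 < r := hr
  rw [measure_lt_cellDelay h hG hα s, carIntensity_delaySet hα s hr.le,
    ENNReal.ofReal_sub _ (Real.exp_nonneg _), ENNReal.ofReal_one, ENNReal.toReal_mul,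
    ENNReal.toReal_mul, ENNReal.toReal_ofReal hlam, ENNReal.toReal_ofReal (sub_nonneg.2 hβ),
    mul_assoc]

theorem lintegral_cellDelay_le (h : HasPoissonAvoidance z (carIntensity lam G F) P)
    (hlam : 0 ≤ lam) (hG : Integrable (fun r : ℝ => r ^ 2) G) {α β : ℝ} (hα : 0 ≤ α) (hβ : α ≤ β)
    (s : ℝ) :
    ∫⁻ ω, cellDelay (Ioc α β) (fun j => z j ω) s ∂P
      ≤ ENNReal.ofReal (lam * (β - α)) * ∫⁻ r in Ioi 0, delayTail F G r := by
  rw [lintegral_cellDelay h hlam hG hα hβ s, ← lintegral_const_mul _ measurable_delayTail]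
  refine setLIntegral_mono' measurableSet_Ioi fun r hr => ?_
  have hr : 0 < r := hr
  rw [← ENNReal.ofReal_toReal (delayTail_ne_top (F := F) hG hr.le),
    ← ENNReal.ofReal_mul (mul_nonneg hlam (sub_nonneg.2 hβ))]
  refine ENNReal.ofReal_le_ofReal ?_
  rw [ENNReal.toReal_ofReal ENNReal.toReal_nonneg]
  have := Real.add_one_le_exp (-(lam * (β - α) * (delayTail F G r).toReal))
  linarith

theorem tendsto_pow_mul_one_sub_exp (x : ℝ) :
    Tendsto (fun m : ℕ => (2 : ℝ) ^ m * (1 - Real.exp (-(x * (1 / 2 ^ m))))) atTop (𝓝 x) := by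
  have hd : HasDerivAt (fun y : ℝ => 1 - Real.exp (-(x * y))) x 0 := by
    have h1 : HasDerivAt (fun y : ℝ => -(x * y)) (-x) 0 := by
      simpa using ((hasDerivAt_id (0 : ℝ)).const_mul x).fun_neg
    have := (h1.exp).const_sub 1
    simpa using this
  have ht := hd.tendsto_slope_zero_right
  have hlim : Tendsto (fun m : ℕ => (1 : ℝ) / 2 ^ m) atTop (𝓝[>] 0) := by
    refine tendsto_nhdsWithin_iff.2 ⟨?_, Eventually.of_forall fun m => ?_⟩
    · simp_rw [← one_div_pow]
      exact tendsto_pow_atTop_nhds_zero_of_lt_one (by norm_num) (by norm_num)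
    · show (0 : ℝ) < 1 / 2 ^ m
      positivity
  refine (ht.comp hlim).congr fun m => ?_
  simp

/-- Since `2ᵐ (1 - exp (-x / 2ᵐ))` tends to `x` and is bounded by `x`, counting only the largest
delay per cell loses nothing in the mean as the mesh vanishes. -/
theorem tendsto_pow_mul_lintegral_cellDelay
    (h : HasPoissonAvoidance z (carIntensity lam G F) P) (hlam : 0 ≤ lam)
    (hG : Integrable (fun r : ℝ => r ^ 2) G) (s : ℝ) :
    Tendsto (fun m : ℕ => (2 : ℝ≥0∞) ^ m *
        ∫⁻ ω, cellDelay (Ioc 0 (1 / 2 ^ m)) (fun j => z j ω) s ∂P) atTop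
      (𝓝 (ENNReal.ofReal lam * ∫⁻ r in Ioi 0, delayTail F G r)) := by
  have hpos : ∀ m : ℕ, (0 : ℝ) ≤ 1 / 2 ^ m := fun m => by positivity
  have h2 : ∀ m : ℕ, (2 : ℝ≥0∞) ^ m = ENNReal.ofReal (2 ^ m) := fun m => by
    rw [ENNReal.ofReal_pow (by norm_num)]; norm_num
  have hmt : Measurable fun r => (delayTail F G r).toReal :=
    measurable_delayTail.ennreal_toReal
  have heq : ∀ m : ℕ, (2 : ℝ≥0∞) ^ m *
        ∫⁻ ω, cellDelay (Ioc 0 (1 / 2 ^ m)) (fun j => z j ω) s ∂P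
      = ∫⁻ r in Ioi 0, ENNReal.ofReal
        (2 ^ m * (1 - Real.exp (-(lam * (delayTail F G r).toReal * (1 / 2 ^ m))))) := by
    intro m
    rw [lintegral_cellDelay h hlam hG le_rfl (hpos m) s, h2, ← lintegral_const_mul _ (by fun_prop)]
    refine lintegral_congr fun r => ?_
    rw [← ENNReal.ofReal_mul (by positivity)]
    congr 5
    ring
  simp_rw [heq]
  rw [← lintegral_const_mul _ measurable_delayTail]
  refine tendsto_lintegral_of_dominated_convergence
    (bound := fun r => ENNReal.ofReal (lam * (delayTail F G r).toReal)) (fun m => by fun_prop)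
    (fun m => ?_) ?_ ?_
  · refine ae_of_all _ fun r => ENNReal.ofReal_le_ofReal ?_
    have h1 := Real.add_one_le_exp (-(lam * (delayTail F G r).toReal * (1 / 2 ^ m)))
    have h3 : (2 : ℝ) ^ m * (lam * (delayTail F G r).toReal * (1 / 2 ^ m))
        = lam * (delayTail F G r).toReal := by field_simp
    calc _ ≤ (2 : ℝ) ^ m * (lam * (delayTail F G r).toReal * (1 / 2 ^ m)) :=
          mul_le_mul_of_nonneg_left (by linarith) (by positivity)
      _ = _ := h3
  · refine ne_top_of_le_ne_top (ENNReal.mul_ne_top (ENNReal.ofReal_ne_top (r := lam))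
      (lintegral_delayTail_ne_top (F := F) hG)) ?_
    rw [← lintegral_const_mul _ measurable_delayTail]
    refine lintegral_mono fun r => ?_
    rw [ENNReal.ofReal_mul hlam]
    exact mul_le_mul_right ENNReal.ofReal_toReal_le _
  · filter_upwards [ae_restrict_mem measurableSet_Ioi] with r hr
    have hr : 0 < r := hr
    rw [← ENNReal.ofReal_toReal (delayTail_ne_top (F := F) hG hr.le), ← ENNReal.ofReal_mul hlam,
      ENNReal.toReal_ofReal ENNReal.toReal_nonneg]
    exact ENNReal.tendsto_ofReal (tendsto_pow_mul_one_sub_exp _)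

end Law

/-! ### Discretised arrival times -/

/-- The `i`-th cell of mesh `2⁻ᵐ` to the right of `K`. -/
def dyadicCell (K m i : ℕ) : Set ℝ := Ioc ((K : ℝ) + i / 2 ^ m) (K + (i + 1) / 2 ^ m)

/-- Arrival times of a fast car that starts at `K` at time `s₀` and that, in each cell of mesh
`2⁻ᵐ`, is delayed only by one slow car, the one causing the largest delay. -/
noncomputable def delayScheme (w : ℕ → MarkedCar) (K m : ℕ) (s₀ : ℝ) : ℕ → ℝ
  | 0 => s₀
  | i + 1 => delayScheme w K m s₀ i +
      (cellDelay (dyadicCell K m i) w (delayScheme w K m s₀ i)).toReal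

theorem dyadicCell_split (K m i : ℕ) :
    dyadicCell K m i = dyadicCell K (m + 1) (2 * i) ∪ dyadicCell K (m + 1) (2 * i + 1) := by
  have h : (0 : ℝ) < 2 ^ m := by positivity
  unfold dyadicCell
  have e1 : (K : ℝ) + ((2 * i : ℕ) : ℝ) / 2 ^ (m + 1) = K + i / 2 ^ m := by
    push_cast; field_simp; try ring
  have e2 : (K : ℝ) + (((2 * i + 1 : ℕ) : ℝ) + 1) / 2 ^ (m + 1) = K + (i + 1) / 2 ^ m := by
    push_cast; field_simp; try ring
  have e3 : (K : ℝ) + ((2 * i + 1 : ℕ) : ℝ) / 2 ^ (m + 1)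
      = K + (((2 * i : ℕ) : ℝ) + 1) / 2 ^ (m + 1) := by
    push_cast; ring
  rw [e3, Ioc_union_Ioc_eq_Ioc, e1, e2]
  · push_cast
    gcongr
    linarith
  · push_cast
    gcongr
    linarith

theorem dyadicCell_subset (K m i : ℕ) : ∃ R : ℝ, dyadicCell K m i ⊆ Ioc 0 R :=
  ⟨K + (i + 1) / 2 ^ m, Ioc_subset_Ioc_left (by positivity)⟩

theorem delayScheme_le_succ (w : ℕ → MarkedCar) (K m : ℕ) (s₀ : ℝ) (i : ℕ) :
    delayScheme w K m s₀ i ≤ delayScheme w K m s₀ (i + 1) := by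
  rw [delayScheme]
  exact le_add_of_nonneg_right ENNReal.toReal_nonneg

theorem delayScheme_monotone (w : ℕ → MarkedCar) (K m : ℕ) (s₀ : ℝ) :
    Monotone (delayScheme w K m s₀) :=
  monotone_nat_of_le_succ (delayScheme_le_succ w K m s₀)

theorem le_delayScheme (w : ℕ → MarkedCar) (K m : ℕ) (s₀ : ℝ) (i : ℕ) :
    s₀ ≤ delayScheme w K m s₀ i :=
  delayScheme_monotone w K m s₀ (Nat.zero_le i)

/-- All delays caused by the cars of a bounded region are finite. -/
def FiniteDelays (w : ℕ → MarkedCar) : Prop := ∀ R s : ℝ, cellDelay (Ioc 0 R) w s ≠ ∞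

theorem FiniteDelays.ne_top {w : ℕ → MarkedCar} (hw : FiniteDelays w) (K m i : ℕ) (s : ℝ) :
    cellDelay (dyadicCell K m i) w s ≠ ∞ := by
  obtain ⟨R, hR⟩ := dyadicCell_subset K m i
  exact ne_top_of_le_ne_top (hw R s) (cellDelay_mono hR w s)

/-- Finiteness at `s'` is essential here, because `toReal` sends an infinite delay to `0`. -/
theorem add_cellDelay_mono {I : Set ℝ} {w : ℕ → MarkedCar} {s s' : ℝ}
    (hI : cellDelay I w s' ≠ ∞) (h : s ≤ s') :
    s + (cellDelay I w s).toReal ≤ s' + (cellDelay I w s').toReal := by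
  have h1 := ENNReal.toReal_mono (ENNReal.add_ne_top.2 ⟨ENNReal.ofReal_ne_top, hI⟩)
    (cellDelay_le_add (I := I) (w := w) h)
  rw [ENNReal.toReal_add ENNReal.ofReal_ne_top hI, ENNReal.toReal_ofReal (sub_nonneg.2 h)] at h1
  linarith

/-- The largest delay of a coarse cell is attained in one of its halves. The fine scheme reaches
either half no earlier than the coarse scheme reaches the cell, so by monotone departure times it
leaves no earlier either. -/
theorem delayScheme_le_refine {w : ℕ → MarkedCar} (hw : FiniteDelays w) (K m : ℕ) (s₀ : ℝ) (i : ℕ) :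
    delayScheme w K m s₀ i ≤ delayScheme w K (m + 1) s₀ (2 * i) := by
  induction i with
  | zero => exact le_rfl
  | succ i ih =>
    set a := delayScheme w K m s₀ i
    set b := delayScheme w K (m + 1) s₀ (2 * i) with hb
    rw [show 2 * (i + 1) = 2 * i + 1 + 1 by ring]
    have h1 : delayScheme w K (m + 1) s₀ (2 * i + 1)
        = b + (cellDelay (dyadicCell K (m + 1) (2 * i)) w b).toReal := rfl
    rw [delayScheme, delayScheme, dyadicCell_split, cellDelay_union]
    have hm0 := add_cellDelay_mono (hw.ne_top K (m + 1) (2 * i) b) ih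
    have hle : a ≤ delayScheme w K (m + 1) s₀ (2 * i + 1) :=
      ih.trans (delayScheme_le_succ w K (m + 1) s₀ (2 * i))
    have hm1 := add_cellDelay_mono (hw.ne_top K (m + 1) (2 * i + 1) _) hle
    rw [ENNReal.toReal_max (hw.ne_top _ _ _ _) (hw.ne_top _ _ _ _), ← max_add_add_left]
    refine max_le ?_ hm1
    refine hm0.trans (h1 ▸ ?_)
    exact le_add_of_nonneg_right ENNReal.toReal_nonneg

theorem monotone_delayScheme_level {w : ℕ → MarkedCar} (hw : FiniteDelays w) (K : ℕ) (s₀ : ℝ)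
    (n : ℕ) : Monotone fun m => delayScheme w K m s₀ (n * 2 ^ m) := by
  refine monotone_nat_of_le_succ fun m => ?_
  have := delayScheme_le_refine hw K m s₀ (n * 2 ^ m)
  rwa [show 2 * (n * 2 ^ m) = n * 2 ^ (m + 1) by ring] at this

/-! ### Independence of the delays along the scheme -/

section SchemeLaw

variable {Ω : Type*} [mΩ : MeasurableSpace Ω] {P : Measure Ω} [IsProbabilityMeasure P]
  {lam : ℝ} {G : Measure ℝ} [IsProbabilityMeasure G] {F : Measure ℝ≥0∞} [IsProbabilityMeasure F]
  {z : ℕ → Ω → MarkedCar}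

theorem HasPoissonAvoidance.ae_finiteDelays
    (h : HasPoissonAvoidance z (carIntensity lam G F) P) (hlam : 0 ≤ lam)
    (hG : Integrable (fun r : ℝ => r ^ 2) G) : ∀ᵐ ω ∂P, FiniteDelays fun j => z j ω := by
  have h1 : ∀ᵐ ω ∂P, ∀ n : ℕ, cellDelay (Ioc 0 (n : ℝ)) (fun j => z j ω) n ≠ ∞ := by
    rw [ae_all_iff]
    intro n
    have h2 := lintegral_cellDelay_le h hlam hG (F := F) le_rfl (Nat.cast_nonneg n) (n : ℝ)
    have h3 : ∫⁻ ω, cellDelay (Ioc 0 (n : ℝ)) (fun j => z j ω) n ∂P ≠ ∞ :=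
      ne_top_of_le_ne_top (ENNReal.mul_ne_top ENNReal.ofReal_ne_top
        (lintegral_delayTail_ne_top hG)) h2
    filter_upwards [ae_lt_top (measurable_cellDelay h.measurable measurableSet_Ioc _) h3]
      with ω hω using hω.ne
  filter_upwards [h1] with ω hω R s
  -- Integers suffice: the delay at `s` is at most `n - s` plus the delay at a later time `n`, on
  -- the larger strip up to `n`.
  obtain ⟨n, hn⟩ := exists_nat_ge (max R s)
  refine ne_top_of_le_ne_top (ENNReal.add_ne_top.2 ⟨ENNReal.ofReal_ne_top, hω n⟩)
    ((cellDelay_mono (Ioc_subset_Ioc_right ((le_max_left _ _).trans hn)) _ s).trans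
      (cellDelay_le_add ((le_max_right _ _).trans hn)))

/-- The delay in the `i`-th cell along the scheme. -/
noncomputable def schemeDelay (z : ℕ → Ω → MarkedCar) (K m : ℕ) (s₀ : ℝ) (i : ℕ) (ω : Ω) : ℝ≥0∞ :=
  cellDelay (dyadicCell K m i) (fun j => z j ω) (delayScheme (fun j => z j ω) K m s₀ i)

/-- The law of the delay in a cell of mesh `2⁻ᵐ`. -/
noncomputable def delayLaw (P : Measure Ω) (z : ℕ → Ω → MarkedCar) (m : ℕ) : Measure ℝ≥0∞ :=
  P.map fun ω => cellDelay (Ioc 0 (1 / 2 ^ m)) (fun j => z j ω) 0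

theorem measurable_cellDelay_uncurry_cellAlgebra (hG : Integrable (fun r : ℝ => r ^ 2) G)
    (K m i : ℕ) :
    @Measurable (ℝ × Ω) ℝ≥0∞ (@Prod.instMeasurableSpace ℝ Ω _
      (cellAlgebra z lam G F (dyadicCell K m i))) _
      fun q => cellDelay (dyadicCell K m i) (fun j => z j q.2) q.1 :=
  @measurable_cellDelay_uncurry Ω (cellAlgebra z lam G F (dyadicCell K m i))
    (fun ω j => z j ω) (dyadicCell K m i)
    fun s => measurable_cellDelay_cellAlgebra hG (by positivity) s

theorem measurable_comp_prodMk_of_le {m₁ m₂ : MeasurableSpace Ω} (hm : m₁ ≤ m₂)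
    {D : ℝ × Ω → ℝ≥0∞} (hD : @Measurable (ℝ × Ω) ℝ≥0∞ (@Prod.instMeasurableSpace ℝ Ω _ m₁) _ D)
    {V : Ω → ℝ} (hV : Measurable[m₂] V) : Measurable[m₂] fun ω => D (V ω, ω) := by
  have hid : @Measurable Ω Ω m₂ m₁ id := fun S hS => hm S hS
  exact hD.comp (Measurable.prodMk hV hid)

/-- The arrival time at a cell is determined by the cars of the cells already crossed. This
adaptedness makes the next cell fresh randomness. -/
theorem measurable_delayScheme (hG : Integrable (fun r : ℝ => r ^ 2) G) (K m : ℕ) (s₀ : ℝ)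
    (i : ℕ) : Measurable[cellAlgebra z lam G F (Ioc (K : ℝ) (K + i / 2 ^ m))]
      fun ω => delayScheme (fun j => z j ω) K m s₀ i := by
  induction i with
  | zero => exact @measurable_const _ _ _ (_) _
  | succ i ih =>
    have hsub1 : Ioc (K : ℝ) (K + i / 2 ^ m) ⊆ Ioc (K : ℝ) (K + (i + 1 : ℕ) / 2 ^ m) := by
      refine Ioc_subset_Ioc_right ?_
      push_cast
      gcongr
      linarith
    have hsub2 : dyadicCell K m i ⊆ Ioc (K : ℝ) (K + (i + 1 : ℕ) / 2 ^ m) := by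
      unfold dyadicCell
      push_cast
      exact Ioc_subset_Ioc_left (le_add_of_nonneg_right (by positivity))
    have hV := ih.mono (voidAlgebra_mono (z := z) (μ := carIntensity lam G F)
      fun (e : MarkedCar) he => hsub1 he) le_rfl
    have hD := measurable_comp_prodMk_of_le (voidAlgebra_mono (z := z)
      (μ := carIntensity lam G F) fun (e : MarkedCar) he => hsub2 he)
      (measurable_cellDelay_uncurry_cellAlgebra (z := z) (lam := lam) (F := F) hG K m i) hV
    exact Measurable.add hV hD.ennreal_toReal

theorem measurable_schemeDelay (hG : Integrable (fun r : ℝ => r ^ 2) G) (K m : ℕ) (s₀ : ℝ)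
    {i n : ℕ} (hi : i < n) : Measurable[cellAlgebra z lam G F (Ioc (K : ℝ) (K + n / 2 ^ m))]
      (schemeDelay z K m s₀ i) := by
  have hin : (i : ℝ) + 1 ≤ n := by exact_mod_cast hi
  have hsub1 : Ioc (K : ℝ) (K + i / 2 ^ m) ⊆ Ioc (K : ℝ) (K + n / 2 ^ m) := by
    refine Ioc_subset_Ioc_right ?_
    gcongr
  have hsub2 : dyadicCell K m i ⊆ Ioc (K : ℝ) (K + n / 2 ^ m) := by
    unfold dyadicCell
    refine Ioc_subset_Ioc (le_add_of_nonneg_right (by positivity)) ?_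
    gcongr
  exact measurable_comp_prodMk_of_le (voidAlgebra_mono (z := z)
      (μ := carIntensity lam G F) fun (e : MarkedCar) he => hsub2 he)
      (measurable_cellDelay_uncurry_cellAlgebra (z := z) (lam := lam) (F := F) hG K m i)
      ((measurable_delayScheme (z := z) (lam := lam) (F := F) hG K m s₀ i).mono
        (voidAlgebra_mono fun (e : MarkedCar) he => hsub1 he) le_rfl)

/-- The cell is disjoint from the region that determines the past, and its delay has the same law
for every deterministic arrival time. Inserting the random arrival time therefore preserves both
this law and independence from the past. -/
theorem measure_inter_schemeDelay (h : HasPoissonAvoidance z (carIntensity lam G F) P)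
    (hG : Integrable (fun r : ℝ => r ^ 2) G) (K m : ℕ) (s₀ : ℝ) (i : ℕ) {A : Set Ω}
    (hA : MeasurableSet[cellAlgebra z lam G F (Ioc (K : ℝ) (K + i / 2 ^ m))] A) {B : Set ℝ≥0∞}
    (hB : MeasurableSet B) :
    P (A ∩ schemeDelay z K m s₀ i ⁻¹' B) = P A * delayLaw P z m B := by
  have hdisj : Disjoint {e : MarkedCar | e.1.1 ∈ Ioc (K : ℝ) (K + i / 2 ^ m)}
      {e : MarkedCar | e.1.1 ∈ dyadicCell K m i} := by
    rw [Set.disjoint_left]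
    rintro e ⟨-, h1⟩ ⟨h2, -⟩
    exact absurd h2 (not_lt.2 h1)
  refine measure_inter_comp_of_indep (voidAlgebra_le h.measurable _)
    (voidAlgebra_le h.measurable _) (h.indep_voidAlgebra hdisj)
    (measurable_delayScheme hG K m s₀ i)
    (D := fun s ω => cellDelay (dyadicCell K m i) (fun j => z j ω) s)
    (measurable_cellDelay_uncurry_cellAlgebra hG K m i) (fun s => ?_) hA hB
  refine map_cellDelay_congr h hG (by positivity) le_rfl ?_ s 0
  field_simp
  ring

theorem map_schemeDelay (h : HasPoissonAvoidance z (carIntensity lam G F) P)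
    (hG : Integrable (fun r : ℝ => r ^ 2) G) (K m : ℕ) (s₀ : ℝ) (i : ℕ) :
    P.map (schemeDelay z K m s₀ i) = delayLaw P z m := by
  ext B hB
  have hm := (measurable_schemeDelay (z := z) (lam := lam) (F := F) hG K m s₀ i.lt_succ_self).mono
    (voidAlgebra_le h.measurable _) le_rfl
  rw [Measure.map_apply hm hB]
  have := measure_inter_schemeDelay h hG K m s₀ i (A := univ) (@MeasurableSet.univ _ (_)) hB
  simpa using this

/-- The characteristic function of a linear combination of the delays along the scheme. -/
theorem integral_cexp_sum_schemeDelay (h : HasPoissonAvoidance z (carIntensity lam G F) P)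
    (hG : Integrable (fun r : ℝ => r ^ 2) G) (K m : ℕ) (s₀ : ℝ) (c : ℕ → ℝ) (n : ℕ) :
    ∫ ω, Complex.exp ((∑ i ∈ Finset.range n, c i * (schemeDelay z K m s₀ i ω).toReal : ℝ) *
        Complex.I) ∂P
      = ∏ i ∈ Finset.range n, ∫ x, Complex.exp ((c i * x.toReal : ℝ) * Complex.I)
        ∂(delayLaw P z m) := by
  induction n with
  | zero => simp
  | succ n ih =>
    have hmn := (measurable_schemeDelay (z := z) (lam := lam) (F := F) hG K m s₀
      n.lt_succ_self).mono (voidAlgebra_le h.measurable _) le_rfl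
    set T : Ω → ℝ := fun ω => ∑ i ∈ Finset.range n, c i * (schemeDelay z K m s₀ i ω).toReal
      with hT
    have hTm : Measurable[cellAlgebra z lam G F (Ioc (K : ℝ) (K + n / 2 ^ m))] T := by
      refine Finset.measurable_sum _ fun i hi => ?_
      exact Measurable.const_mul (Measurable.ennreal_toReal
        (measurable_schemeDelay hG K m s₀ (Finset.mem_range.1 hi))) (c i)
    have hTm' : Measurable T := hTm.mono (voidAlgebra_le h.measurable _) le_rfl
    have hind : IndepFun T (schemeDelay z K m s₀ n) P := by
      rw [indepFun_iff_measure_inter_preimage_eq_mul]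
      intro A B hA hB
      rw [measure_inter_schemeDelay h hG K m s₀ n (hTm hA) hB, ← map_schemeDelay h hG K m s₀ n,
        Measure.map_apply hmn hB]
    rw [Finset.prod_range_succ, ← ih, ← map_schemeDelay h hG K m s₀ n,
      integral_map hmn.aemeasurable
        (Measurable.aestronglyMeasurable (by fun_prop)),
      ← hind.integral_fun_comp_mul_comp (f := fun x : ℝ => Complex.exp (x * Complex.I))
        (g := fun x : ℝ≥0∞ => Complex.exp ((c n * x.toReal : ℝ) * Complex.I))
        hTm'.aemeasurable hmn.aemeasurable
        (Measurable.aestronglyMeasurable (by fun_prop))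
        (Measurable.aestronglyMeasurable (by fun_prop))]
    congr 1
    ext ω
    rw [Finset.sum_range_succ, ← Complex.exp_add, ← add_mul, ← Complex.ofReal_add]

end SchemeLaw

theorem sum_range_mul_block {M : Type*} [AddCommMonoid M] (f : ℕ → M) (n b : ℕ) :
    ∑ i ∈ Finset.range (n * b), f i
      = ∑ k ∈ Finset.range n, ∑ i ∈ Finset.range b, f (k * b + i) := by
  induction n with
  | zero => simp
  | succ n ih => rw [Nat.succ_mul, Finset.sum_range_add, ih, Finset.sum_range_succ]

theorem prod_range_mul_block {M : Type*} [CommMonoid M] (f : ℕ → M) (n b : ℕ) :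
    ∏ i ∈ Finset.range (n * b), f i
      = ∏ k ∈ Finset.range n, ∏ i ∈ Finset.range b, f (k * b + i) := by
  induction n with
  | zero => simp
  | succ n ih => rw [Nat.succ_mul, Finset.prod_range_add, ih, Finset.prod_range_succ]

/-! ### Vanishing mesh and the law of large numbers -/

section SchemeLimit

variable {Ω : Type*} [mΩ : MeasurableSpace Ω] {P : Measure Ω} [IsProbabilityMeasure P]
  {lam : ℝ} {G : Measure ℝ} [IsProbabilityMeasure G] {F : Measure ℝ≥0∞} [IsProbabilityMeasure F]
  {z : ℕ → Ω → MarkedCar}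

theorem delayScheme_sub_eq_sum (z : ℕ → Ω → MarkedCar) (K m : ℕ) (s₀ : ℝ) (a n : ℕ) (ω : Ω) :
    delayScheme (fun j => z j ω) K m s₀ (a + n) - delayScheme (fun j => z j ω) K m s₀ a
      = ∑ i ∈ Finset.range n, (schemeDelay z K m s₀ (a + i) ω).toReal := by
  induction n with
  | zero => simp
  | succ n ih =>
    rw [Finset.sum_range_succ, ← ih, ← add_assoc, delayScheme]
    unfold schemeDelay
    ring

/-- The increment of the scheme over the `k`-th unit interval. -/
noncomputable def blockDelay (z : ℕ → Ω → MarkedCar) (K m : ℕ) (s₀ : ℝ) (k : ℕ) (ω : Ω) : ℝ :=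
  delayScheme (fun j => z j ω) K m s₀ ((k + 1) * 2 ^ m)
    - delayScheme (fun j => z j ω) K m s₀ (k * 2 ^ m)

theorem integral_cexp_sum_blockDelay (h : HasPoissonAvoidance z (carIntensity lam G F) P)
    (hG : Integrable (fun r : ℝ => r ^ 2) G) (K m : ℕ) (s₀ : ℝ) (c : ℕ → ℝ) (n : ℕ) :
    ∫ ω, Complex.exp ((∑ k ∈ Finset.range n, c k * blockDelay z K m s₀ k ω : ℝ) *
        Complex.I) ∂P
      = ∏ k ∈ Finset.range n, (∫ x, Complex.exp ((c k * x.toReal : ℝ) * Complex.I)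
        ∂(delayLaw P z m)) ^ (2 ^ m) := by
  have hpos : 0 < 2 ^ m := by positivity
  have hdiv : ∀ k i, i < 2 ^ m → (k * 2 ^ m + i) / 2 ^ m = k := by
    intro k i hi
    rw [mul_comm, Nat.mul_add_div hpos, Nat.div_eq_of_lt hi, add_zero]
  -- The weight `c (i / 2 ^ m)`, with natural division, is constant on each block of `2 ^ m` cells,
  -- that is, on each unit interval.
  have key := integral_cexp_sum_schemeDelay h hG K m s₀ (fun i => c (i / 2 ^ m)) (n * 2 ^ m)
  rw [prod_range_mul_block] at key
  have e1 : ∀ ω, ∑ i ∈ Finset.range (n * 2 ^ m),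
      c (i / 2 ^ m) * (schemeDelay z K m s₀ i ω).toReal
      = ∑ k ∈ Finset.range n, c k * blockDelay z K m s₀ k ω := by
    intro ω
    rw [sum_range_mul_block]
    refine Finset.sum_congr rfl fun k _ => ?_
    rw [blockDelay, Nat.succ_mul, delayScheme_sub_eq_sum, Finset.mul_sum]
    refine Finset.sum_congr rfl fun i hi => ?_
    rw [hdiv k i (Finset.mem_range.1 hi)]
  simp_rw [e1] at key
  rw [key]
  refine Finset.prod_congr rfl fun k _ => ?_
  rw [Finset.prod_congr rfl fun i hi => by rw [hdiv k i (Finset.mem_range.1 hi)],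
    Finset.prod_const, Finset.card_range]

theorem measurable_delayScheme' (h : HasPoissonAvoidance z (carIntensity lam G F) P)
    (hG : Integrable (fun r : ℝ => r ^ 2) G) (K m : ℕ) (s₀ : ℝ) (i : ℕ) :
    Measurable fun ω => delayScheme (fun j => z j ω) K m s₀ i :=
  (measurable_delayScheme (z := z) (lam := lam) (G := G) (F := F) hG K m s₀ i).mono
    (voidAlgebra_le h.measurable _) le_rfl

theorem lintegral_delayScheme (h : HasPoissonAvoidance z (carIntensity lam G F) P)
    (hlam : 0 ≤ lam) (hG : Integrable (fun r : ℝ => r ^ 2) G) (K m : ℕ) (s₀ : ℝ) (n : ℕ) :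
    ∫⁻ ω, ENNReal.ofReal (delayScheme (fun j => z j ω) K m s₀ (n * 2 ^ m) - s₀) ∂P
      = n * (2 ^ m * ∫⁻ ω, cellDelay (Ioc 0 (1 / 2 ^ m)) (fun j => z j ω) 0 ∂P) := by
  have hms : ∀ i, Measurable (schemeDelay z K m s₀ i) := fun i =>
    (measurable_schemeDelay (z := z) (lam := lam) (F := F) hG K m s₀
      i.lt_succ_self).mono (voidAlgebra_le h.measurable _) le_rfl
  have hmc := measurable_cellDelay h.measurable (measurableSet_Ioc (a := (0:ℝ)) (b := 1 / 2 ^ m)) 0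
  have h1 : ∀ i, ∫⁻ ω, ENNReal.ofReal (schemeDelay z K m s₀ i ω).toReal ∂P
      = ∫⁻ ω, cellDelay (Ioc 0 (1 / 2 ^ m)) (fun j => z j ω) 0 ∂P := by
    intro i
    have hm : Measurable fun x : ℝ≥0∞ => ENNReal.ofReal x.toReal := by fun_prop
    rw [← lintegral_map hm (hms i), map_schemeDelay h hG, delayLaw, lintegral_map hm hmc]
    have hfin : ∫⁻ ω, cellDelay (Ioc 0 (1 / 2 ^ m)) (fun j => z j ω) 0 ∂P ≠ ∞ :=
      ne_top_of_le_ne_top (ENNReal.mul_ne_top ENNReal.ofReal_ne_top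
        (lintegral_delayTail_ne_top hG))
        (lintegral_cellDelay_le h hlam hG (F := F) le_rfl (by positivity) 0)
    refine lintegral_congr_ae ?_
    filter_upwards [ae_lt_top hmc hfin] with ω hω using ENNReal.ofReal_toReal hω.ne
  have h2 : ∀ ω, ENNReal.ofReal (delayScheme (fun j => z j ω) K m s₀ (n * 2 ^ m) - s₀)
      = ∑ i ∈ Finset.range (n * 2 ^ m), ENNReal.ofReal (schemeDelay z K m s₀ i ω).toReal := by
    intro ω
    rw [← ENNReal.ofReal_sum_of_nonneg fun i _ => ENNReal.toReal_nonneg]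
    congr 1
    have := delayScheme_sub_eq_sum z K m s₀ 0 (n * 2 ^ m) ω
    simpa [delayScheme] using this
  simp_rw [h2]
  rw [lintegral_finsetSum _ fun i _ => (hms i).ennreal_toReal.ennreal_ofReal,
    Finset.sum_congr rfl fun i _ => h1 i, Finset.sum_const, Finset.card_range, nsmul_eq_mul]
  push_cast
  ring

/-- The total delay on the first `n` unit intervals, in the limit of vanishing mesh. -/
noncomputable def limitDelay (z : ℕ → Ω → MarkedCar) (K : ℕ) (s₀ : ℝ) (n : ℕ) (ω : Ω) : ℝ≥0∞ :=
  ⨆ m, ENNReal.ofReal (delayScheme (fun j => z j ω) K m s₀ (n * 2 ^ m) - s₀)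

theorem measurable_limitDelay (h : HasPoissonAvoidance z (carIntensity lam G F) P)
    (hG : Integrable (fun r : ℝ => r ^ 2) G) (K : ℕ) (s₀ : ℝ) (n : ℕ) :
    Measurable (limitDelay z K s₀ n) :=
  Measurable.iSup fun m => ((measurable_delayScheme' h hG K m s₀ _).sub_const s₀).ennreal_ofReal

/-- Monotone convergence in the mesh: the scheme has a mean proportional to the number of cells, and
the mean per unit length converges. -/
theorem lintegral_limitDelay (h : HasPoissonAvoidance z (carIntensity lam G F) P)
    (hlam : 0 ≤ lam) (hG : Integrable (fun r : ℝ => r ^ 2) G) (K : ℕ) (s₀ : ℝ) (n : ℕ) :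
    ∫⁻ ω, limitDelay z K s₀ n ω ∂P
      = n * (ENNReal.ofReal lam * ∫⁻ r in Ioi 0, delayTail F G r) := by
  have hmono : ∀ᵐ ω ∂P, Monotone fun m =>
      ENNReal.ofReal (delayScheme (fun j => z j ω) K m s₀ (n * 2 ^ m) - s₀) := by
    filter_upwards [h.ae_finiteDelays hlam hG] with ω hω m m' hmm
    exact ENNReal.ofReal_le_ofReal
      (sub_le_sub_right (monotone_delayScheme_level hω K s₀ n hmm) _)
  have hmeas : ∀ m, Measurable fun ω =>
      ENNReal.ofReal (delayScheme (fun j => z j ω) K m s₀ (n * 2 ^ m) - s₀) := fun m =>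
    ((measurable_delayScheme' h hG K m s₀ _).sub_const s₀).ennreal_ofReal
  have h1 := lintegral_tendsto_of_tendsto_of_monotone (fun m => (hmeas m).aemeasurable) hmono
    (F := limitDelay z K s₀ n) (hmono.mono fun ω hω => tendsto_atTop_iSup hω)
  simp_rw [lintegral_delayScheme h hlam hG] at h1
  refine tendsto_nhds_unique h1 ?_
  exact ENNReal.Tendsto.const_mul (tendsto_pow_mul_lintegral_cellDelay h hlam hG 0)
    (Or.inr (ENNReal.natCast_ne_top n))

theorem ae_tendsto_delayScheme (h : HasPoissonAvoidance z (carIntensity lam G F) P)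
    (hlam : 0 ≤ lam) (hG : Integrable (fun r : ℝ => r ^ 2) G) (K : ℕ) (s₀ : ℝ) :
    ∀ᵐ ω ∂P, ∀ n, (∀ m, delayScheme (fun j => z j ω) K m s₀ (n * 2 ^ m)
        ≤ s₀ + (limitDelay z K s₀ n ω).toReal) ∧
      Tendsto (fun m => delayScheme (fun j => z j ω) K m s₀ (n * 2 ^ m)) atTop
        (𝓝 (s₀ + (limitDelay z K s₀ n ω).toReal)) := by
  rw [ae_all_iff]
  intro n
  have hfin : ∀ᵐ ω ∂P, limitDelay z K s₀ n ω < ∞ := by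
    refine ae_lt_top (measurable_limitDelay h hG K s₀ n) ?_
    rw [lintegral_limitDelay h hlam hG]
    exact ENNReal.mul_ne_top (ENNReal.natCast_ne_top n)
      (ENNReal.mul_ne_top ENNReal.ofReal_ne_top (lintegral_delayTail_ne_top hG))
  filter_upwards [h.ae_finiteDelays hlam hG, hfin] with ω hω hfω
  have hmono : Monotone fun m =>
      ENNReal.ofReal (delayScheme (fun j => z j ω) K m s₀ (n * 2 ^ m) - s₀) := fun m m' hmm =>
    ENNReal.ofReal_le_ofReal (sub_le_sub_right (monotone_delayScheme_level hω K s₀ n hmm) _)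
  have hto : ∀ m, (ENNReal.ofReal (delayScheme (fun j => z j ω) K m s₀ (n * 2 ^ m) - s₀)).toReal
      = delayScheme (fun j => z j ω) K m s₀ (n * 2 ^ m) - s₀ := fun m =>
    ENNReal.toReal_ofReal (sub_nonneg.2 (le_delayScheme _ _ _ _ _))
  constructor
  · intro m
    have := ENNReal.toReal_mono hfω.ne (le_iSup (fun m =>
      ENNReal.ofReal (delayScheme (fun j => z j ω) K m s₀ (n * 2 ^ m) - s₀)) m)
    rw [hto] at this
    linarith
  · have h1 := (ENNReal.tendsto_toReal hfω.ne).comp (tendsto_atTop_iSup hmono)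
    have h2 := h1.const_add s₀
    refine h2.congr fun m => ?_
    simp only [Function.comp, hto]
    ring

theorem limitDelay_zero (z : ℕ → Ω → MarkedCar) (K : ℕ) (s₀ : ℝ) (ω : Ω) :
    limitDelay z K s₀ 0 ω = 0 := by
  simp [limitDelay, delayScheme]

/-- The delay on the `k`-th unit interval, in the limit of vanishing mesh. -/
noncomputable def unitDelay (z : ℕ → Ω → MarkedCar) (K : ℕ) (s₀ : ℝ) (k : ℕ) (ω : Ω) : ℝ :=
  (limitDelay z K s₀ (k + 1) ω).toReal - (limitDelay z K s₀ k ω).toReal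

theorem measurable_unitDelay (h : HasPoissonAvoidance z (carIntensity lam G F) P)
    (hG : Integrable (fun r : ℝ => r ^ 2) G) (K : ℕ) (s₀ : ℝ) (k : ℕ) :
    Measurable (unitDelay z K s₀ k) :=
  (measurable_limitDelay h hG K s₀ _).ennreal_toReal.sub
    (measurable_limitDelay h hG K s₀ _).ennreal_toReal

/-- The joint characteristic function factors exactly at each mesh. Dominated convergence passes
this to the limit without any direct measurability analysis of the limiting process with respect to
the cells. -/
theorem tendsto_integral_cexp_blockDelay (h : HasPoissonAvoidance z (carIntensity lam G F) P)
    (hlam : 0 ≤ lam) (hG : Integrable (fun r : ℝ => r ^ 2) G) (K : ℕ) (s₀ : ℝ) (c : ℕ → ℝ)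
    (n : ℕ) :
    Tendsto (fun m => ∏ k ∈ Finset.range n, (∫ x, Complex.exp ((c k * x.toReal : ℝ) * Complex.I)
        ∂(delayLaw P z m)) ^ (2 ^ m)) atTop
      (𝓝 (∫ ω, Complex.exp ((∑ k ∈ Finset.range n, c k * unitDelay z K s₀ k ω : ℝ) *
        Complex.I) ∂P)) := by
  simp_rw [← integral_cexp_sum_blockDelay h hG K _ s₀ c n]
  refine tendsto_integral_of_dominated_convergence (fun _ => 1) (fun m => ?_)
    (integrable_const 1) (fun m => ae_of_all _ fun ω => ?_) ?_
  · have : ∀ k, Measurable (blockDelay z K m s₀ k) := fun k =>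
      (measurable_delayScheme' h hG K m s₀ _).sub (measurable_delayScheme' h hG K m s₀ _)
    have hs : Measurable fun ω => ∑ k ∈ Finset.range n, c k * blockDelay z K m s₀ k ω :=
      Finset.measurable_sum _ fun k _ => (this k).const_mul _
    exact (by fun_prop : Measurable fun x : ℝ => Complex.exp (x * Complex.I)).comp hs
      |>.aestronglyMeasurable
  · rw [Complex.norm_exp_ofReal_mul_I]
  · filter_upwards [ae_tendsto_delayScheme h hlam hG K s₀] with ω hω
    have hc : Continuous fun x : ℝ => Complex.exp (x * Complex.I) := by fun_prop
    refine (hc.tendsto _).comp (tendsto_finsetSum _ fun k _ => ?_)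
    refine Tendsto.const_mul _ ?_
    have := (hω (k + 1)).2.sub (hω k).2
    have e : unitDelay z K s₀ k ω = s₀ + (limitDelay z K s₀ (k + 1) ω).toReal -
        (s₀ + (limitDelay z K s₀ k ω).toReal) := by
      unfold unitDelay
      ring
    rw [e]
    exact this

theorem isProbabilityMeasure_delayLaw (h : HasPoissonAvoidance z (carIntensity lam G F) P) (m : ℕ) :
    IsProbabilityMeasure (delayLaw P z m) :=
  Measure.isProbabilityMeasure_map
    (measurable_cellDelay h.measurable measurableSet_Ioc 0).aemeasurable

/-- The approximating sequence does not involve `k`, so this limit also shows that the unit delays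
are identically distributed. -/
theorem tendsto_integral_cexp_single (h : HasPoissonAvoidance z (carIntensity lam G F) P)
    (hlam : 0 ≤ lam) (hG : Integrable (fun r : ℝ => r ^ 2) G) (K : ℕ) (s₀ : ℝ) (t : ℝ) (k : ℕ) :
    Tendsto (fun m => (∫ x, Complex.exp ((t * x.toReal : ℝ) * Complex.I)
        ∂(delayLaw P z m)) ^ (2 ^ m)) atTop
      (𝓝 (∫ ω, Complex.exp ((t * unitDelay z K s₀ k ω : ℝ) * Complex.I) ∂P)) := by
  have := tendsto_integral_cexp_blockDelay h hlam hG K s₀ (fun j => if j = k then t else 0) (k + 1)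
  convert this using 2 with m
  · have hp := isProbabilityMeasure_delayLaw h m
    rw [Finset.prod_range_succ, Finset.prod_eq_one, one_mul, if_pos rfl]
    intro j hj
    rw [if_neg (Finset.mem_range.1 hj).ne]
    simp
  · refine integral_congr_ae (ae_of_all _ fun ω => ?_)
    simp

theorem integral_cexp_sum_unitDelay (h : HasPoissonAvoidance z (carIntensity lam G F) P)
    (hlam : 0 ≤ lam) (hG : Integrable (fun r : ℝ => r ^ 2) G) (K : ℕ) (s₀ : ℝ) (c : ℕ → ℝ)
    (n : ℕ) :
    ∫ ω, Complex.exp ((∑ k ∈ Finset.range n, c k * unitDelay z K s₀ k ω : ℝ) * Complex.I) ∂P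
      = ∏ k ∈ Finset.range n,
        ∫ ω, Complex.exp ((c k * unitDelay z K s₀ k ω : ℝ) * Complex.I) ∂P :=
  tendsto_nhds_unique (tendsto_integral_cexp_blockDelay h hlam hG K s₀ c n)
    (tendsto_finsetProd _ fun k _ => tendsto_integral_cexp_single h hlam hG K s₀ (c k) k)

theorem integral_cexp_add_unitDelay (h : HasPoissonAvoidance z (carIntensity lam G F) P)
    (hlam : 0 ≤ lam) (hG : Integrable (fun r : ℝ => r ^ 2) G) (K : ℕ) (s₀ : ℝ) (t u : ℝ)
    {k l : ℕ} (hkl : k ≠ l) :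
    ∫ ω, Complex.exp ((t * unitDelay z K s₀ k ω + u * unitDelay z K s₀ l ω : ℝ) * Complex.I) ∂P
      = (∫ ω, Complex.exp ((t * unitDelay z K s₀ k ω : ℝ) * Complex.I) ∂P) *
        ∫ ω, Complex.exp ((u * unitDelay z K s₀ l ω : ℝ) * Complex.I) ∂P := by
  have key := integral_cexp_sum_unitDelay h hlam hG K s₀
    (fun j => (if j = k then t else 0) + if j = l then u else 0) (max k l + 1)
  have hk : k ∈ Finset.range (max k l + 1) := by simp
  have hl : l ∈ Finset.range (max k l + 1) := by simp
  have e1 : ∀ ω, ∑ j ∈ Finset.range (max k l + 1),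
      ((if j = k then t else 0) + if j = l then u else 0) * unitDelay z K s₀ j ω
      = t * unitDelay z K s₀ k ω + u * unitDelay z K s₀ l ω := by
    intro ω
    simp_rw [add_mul, ite_mul, zero_mul, Finset.sum_add_distrib]
    rw [Finset.sum_ite_eq' , Finset.sum_ite_eq', if_pos hk, if_pos hl]
  simp_rw [e1] at key
  rw [key, Finset.prod_eq_mul k l hkl]
  · simp [hkl, hkl.symm]
  · rintro j - ⟨h1, h2⟩
    simp [h1, h2]
  · exact fun h => absurd hk h
  · exact fun h => absurd hl h

theorem charFun_map_unitDelay (h : HasPoissonAvoidance z (carIntensity lam G F) P)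
    (hG : Integrable (fun r : ℝ => r ^ 2) G) (K : ℕ) (s₀ : ℝ) (k : ℕ) (t : ℝ) :
    charFun (P.map (unitDelay z K s₀ k)) t
      = ∫ ω, Complex.exp ((t * unitDelay z K s₀ k ω : ℝ) * Complex.I) ∂P := by
  rw [charFun_apply_real, integral_map (measurable_unitDelay h hG K s₀ k).aemeasurable
    (Measurable.aestronglyMeasurable (by fun_prop))]
  push_cast
  rfl

theorem identDistrib_unitDelay (h : HasPoissonAvoidance z (carIntensity lam G F) P)
    (hlam : 0 ≤ lam) (hG : Integrable (fun r : ℝ => r ^ 2) G) (K : ℕ) (s₀ : ℝ) (k : ℕ) :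
    IdentDistrib (unitDelay z K s₀ k) (unitDelay z K s₀ 0) P P where
  aemeasurable_fst := (measurable_unitDelay h hG K s₀ k).aemeasurable
  aemeasurable_snd := (measurable_unitDelay h hG K s₀ 0).aemeasurable
  map_eq := by
    have h1 := Measure.isProbabilityMeasure_map (μ := P)
      (measurable_unitDelay h hG K s₀ k).aemeasurable
    have h2 := Measure.isProbabilityMeasure_map (μ := P)
      (measurable_unitDelay h hG K s₀ 0).aemeasurable
    refine Measure.ext_of_charFun (funext fun t => ?_)
    rw [charFun_map_unitDelay h hG, charFun_map_unitDelay h hG]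
    exact tendsto_nhds_unique (tendsto_integral_cexp_single h hlam hG K s₀ t k)
      (tendsto_integral_cexp_single h hlam hG K s₀ t 0)

theorem indepFun_unitDelay (h : HasPoissonAvoidance z (carIntensity lam G F) P)
    (hlam : 0 ≤ lam) (hG : Integrable (fun r : ℝ => r ^ 2) G) (K : ℕ) (s₀ : ℝ) {k l : ℕ}
    (hkl : k ≠ l) : IndepFun (unitDelay z K s₀ k) (unitDelay z K s₀ l) P := by
  have hmk := measurable_unitDelay h hG K s₀ k
  have hml := measurable_unitDelay h hG K s₀ l
  rw [indepFun_iff_charFun_prod hmk.aemeasurable hml.aemeasurable]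
  intro t
  rw [charFun_map_unitDelay h hG, charFun_map_unitDelay h hG,
    ← integral_cexp_add_unitDelay h hlam hG K s₀ _ _ hkl, charFun_apply, integral_map
      (Measurable.aemeasurable (by fun_prop)) (Measurable.aestronglyMeasurable (by fun_prop))]
  refine integral_congr_ae (ae_of_all _ fun ω => ?_)
  simp only [WithLp.prod_inner_apply, RCLike.inner_apply, conj_trivial]

/-- The law of large numbers for the delays. -/
theorem ae_tendsto_limitDelay_div (h : HasPoissonAvoidance z (carIntensity lam G F) P)
    (hlam : 0 ≤ lam) (hG : Integrable (fun r : ℝ => r ^ 2) G) (K : ℕ) (s₀ : ℝ) :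
    ∀ᵐ ω ∂P, Tendsto (fun n : ℕ => (limitDelay z K s₀ n ω).toReal / n) atTop
      (𝓝 (lam * (∫⁻ r in Ioi 0, delayTail F G r).toReal)) := by
  have h0 : unitDelay z K s₀ 0 = fun ω => (limitDelay z K s₀ 1 ω).toReal := by
    ext ω
    simp [unitDelay, limitDelay_zero]
  have hlint := lintegral_limitDelay h hlam hG K s₀ 1
  rw [Nat.cast_one, one_mul] at hlint
  have hne : ∫⁻ ω, limitDelay z K s₀ 1 ω ∂P ≠ ∞ := by
    rw [hlint]
    exact ENNReal.mul_ne_top ENNReal.ofReal_ne_top (lintegral_delayTail_ne_top hG)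
  have hint : Integrable (unitDelay z K s₀ 0) P := by
    rw [h0]
    exact integrable_toReal_of_lintegral_ne_top (measurable_limitDelay h hG K s₀ 1).aemeasurable hne
  have hmean : ∫ ω, unitDelay z K s₀ 0 ω ∂P = lam * (∫⁻ r in Ioi 0, delayTail F G r).toReal := by
    rw [h0, integral_toReal (measurable_limitDelay h hG K s₀ 1).aemeasurable
      (ae_lt_top (measurable_limitDelay h hG K s₀ 1) hne), hlint, ENNReal.toReal_mul,
      ENNReal.toReal_ofReal hlam]
  -- Pairwise independence suffices for this form of the strong law, so characteristic functions of
  -- two unit delays are enough.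
  have := strong_law_ae_real (unitDelay z K s₀) hint
    (fun k l hkl => indepFun_unitDelay h hlam hG K s₀ hkl)
    (fun k => identDistrib_unitDelay h hlam hG K s₀ k)
  rw [hmean] at this
  filter_upwards [this] with ω hω
  refine hω.congr fun n => ?_
  congr 1
  unfold unitDelay
  rw [Finset.sum_range_sub (fun k => (limitDelay z K s₀ k ω).toReal), limitDelay_zero]
  simp

end SchemeLimit

/-! ### Trajectories in the frame moving with the slow cars -/

section Trajectory

variable {v₁ v₂ : ℝ} {a : ℕ → ℝ × ℝ} {ρ : ℕ → ℝ} {τ : ℕ → ℝ≥0∞} {x₀ t₀ : ℝ} {X : ℝ → ℝ}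

/-- The distance by which a fast car with trajectory `X` has advanced relative to the slow cars. -/
def relativeAdvance (v₂ x₀ t₀ : ℝ) (X : ℝ → ℝ) (t : ℝ) : ℝ := X t - v₂ * t - (x₀ - v₂ * t₀)

theorem eq_slowCarPosition_iff {b : ℝ × ℝ} {s : ℝ} :
    X s = slowCarPosition v₂ b s ↔
      relativeAdvance v₂ x₀ t₀ X s = comovingCoord v₂ (x₀ - v₂ * t₀) b := by
  unfold slowCarPosition relativeAdvance comovingCoord
  constructor <;> intro h <;> linarith

/-- The rules prescribe only right derivatives, since the speed jumps; continuity makes a one-sided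
mean value inequality sufficient. -/
theorem sub_le_of_right_deriv_le {f f' : ℝ → ℝ} {C s t : ℝ} (hst : s ≤ t)
    (hf : ContinuousOn f (Icc s t)) (hf' : ∀ x ∈ Ico s t, HasDerivWithinAt f (f' x) (Ici x) x)
    (hC : ∀ x ∈ Ico s t, f' x ≤ C) : f t - f s ≤ C * (t - s) := by
  have := image_le_of_deriv_right_le_deriv_boundary (B := fun x => f s + C * (x - s))
    (B' := fun _ => C) hf hf' (by simp) (by fun_prop)
    (fun x _ => by
      have := (((hasDerivAt_id x).sub_const s).const_mul C).const_add (f s)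
      simpa using this.hasDerivWithinAt) hC (right_mem_Icc.2 hst)
  linarith

theorem le_sub_of_le_right_deriv {f f' : ℝ → ℝ} {C s t : ℝ} (hst : s ≤ t)
    (hf : ContinuousOn f (Icc s t)) (hf' : ∀ x ∈ Ico s t, HasDerivWithinAt f (f' x) (Ici x) x)
    (hC : ∀ x ∈ Ico s t, C ≤ f' x) : C * (t - s) ≤ f t - f s := by
  have := sub_le_of_right_deriv_le (f := fun x => -f x) (f' := fun x => -f' x) (C := -C) hst
    hf.neg (fun x hx => (hf' x hx).neg) (fun x hx => neg_le_neg (hC x hx))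
  linarith

namespace IsFastTrajectory

open Classical in
theorem hasDerivWithinAt (h : IsFastTrajectory v₁ v₂ a ρ τ x₀ t₀ X) {s : ℝ} (hs : t₀ ≤ s) :
    HasDerivWithinAt X (if FollowsSlowCar v₂ a ρ τ t₀ X s then v₂ else v₁) (Ici s) s := by
  split_ifs with hf
  · exact h.speed_following s hs hf
  · exact h.speed_free s hs hf

theorem sub_le (h : IsFastTrajectory v₁ v₂ a ρ τ x₀ t₀ X) (hv : v₂ ≤ v₁) {s t : ℝ} (hs : t₀ ≤ s)
    (hst : s ≤ t) : X t - X s ≤ v₁ * (t - s) := by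
  refine sub_le_of_right_deriv_le hst (h.continuousOn.mono fun x hx => hs.trans hx.1)
    (fun x hx => h.hasDerivWithinAt (hs.trans hx.1)) fun x hx => ?_
  split_ifs <;> linarith

theorem le_sub (h : IsFastTrajectory v₁ v₂ a ρ τ x₀ t₀ X) (hv : v₂ ≤ v₁) {s t : ℝ} (hs : t₀ ≤ s)
    (hst : s ≤ t) : v₂ * (t - s) ≤ X t - X s := by
  refine le_sub_of_le_right_deriv hst (h.continuousOn.mono fun x hx => hs.trans hx.1)
    (fun x hx => h.hasDerivWithinAt (hs.trans hx.1)) fun x hx => ?_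
  split_ifs <;> linarith

theorem sub_eq_of_follows (h : IsFastTrajectory v₁ v₂ a ρ τ x₀ t₀ X) {s t : ℝ} (hs : t₀ ≤ s)
    (hst : s ≤ t) (hf : ∀ r ∈ Ico s t, FollowsSlowCar v₂ a ρ τ t₀ X r) :
    X t - X s = v₂ * (t - s) :=
  le_antisymm
    (sub_le_of_right_deriv_le hst (h.continuousOn.mono fun _ hx => hs.trans hx.1)
      (fun x hx => h.speed_following x (hs.trans hx.1) (hf x hx)) fun _ _ => le_rfl)
    (le_sub_of_le_right_deriv hst (h.continuousOn.mono fun _ hx => hs.trans hx.1)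
      (fun x hx => h.speed_following x (hs.trans hx.1) (hf x hx)) fun _ _ => le_rfl)

theorem sub_eq_of_free (h : IsFastTrajectory v₁ v₂ a ρ τ x₀ t₀ X) {s t : ℝ} (hs : t₀ ≤ s)
    (hst : s ≤ t) (hf : ∀ r ∈ Ico s t, ¬ FollowsSlowCar v₂ a ρ τ t₀ X r) :
    X t - X s = v₁ * (t - s) :=
  le_antisymm
    (sub_le_of_right_deriv_le hst (h.continuousOn.mono fun _ hx => hs.trans hx.1)
      (fun x hx => h.speed_free x (hs.trans hx.1) (hf x hx)) fun _ _ => le_rfl)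
    (le_sub_of_le_right_deriv hst (h.continuousOn.mono fun _ hx => hs.trans hx.1)
      (fun x hx => h.speed_free x (hs.trans hx.1) (hf x hx)) fun _ _ => le_rfl)

theorem relativeAdvance_initial (h : IsFastTrajectory v₁ v₂ a ρ τ x₀ t₀ X) :
    relativeAdvance v₂ x₀ t₀ X t₀ = 0 := by
  rw [relativeAdvance, h.initial]
  ring

theorem continuousOn_relativeAdvance (h : IsFastTrajectory v₁ v₂ a ρ τ x₀ t₀ X) :
    ContinuousOn (relativeAdvance v₂ x₀ t₀ X) (Ici t₀) := by
  have := h.continuousOn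
  unfold relativeAdvance
  fun_prop

theorem relativeAdvance_mono (h : IsFastTrajectory v₁ v₂ a ρ τ x₀ t₀ X) (hv : v₂ ≤ v₁) {s t : ℝ}
    (hs : t₀ ≤ s) (hst : s ≤ t) :
    relativeAdvance v₂ x₀ t₀ X s ≤ relativeAdvance v₂ x₀ t₀ X t := by
  have := h.le_sub hv hs hst
  unfold relativeAdvance
  linarith

/-- Throughout `[u, s)` neither exit condition has occurred, so the car has speed `v₂` and stays at
the place of car `j`. The bounds at `s` may be weak because the derivative is needed only before
`s`. -/
theorem relativeAdvance_eq_of_isLeast (h : IsFastTrajectory v₁ v₂ a ρ τ x₀ t₀ X) {j : ℕ}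
    {u s : ℝ} (hu : IsLeast (meetingTimes v₂ (a j) (ρ j) t₀ X) u) (hus : u ≤ s)
    (hτ : ENNReal.ofReal (s - u) ≤ τ j) (hs : s ≤ (a j).2 + ρ j / v₂) :
    relativeAdvance v₂ x₀ t₀ X s = comovingCoord v₂ (x₀ - v₂ * t₀) (a j) := by
  have hY := (eq_slowCarPosition_iff (x₀ := x₀) (t₀ := t₀)).1 hu.1.2.2
  rw [← hY]
  have := h.sub_eq_of_follows hu.1.1 hus fun r hr =>
    ⟨j, u, hu, hr.1, lt_of_lt_of_le
      ((ENNReal.ofReal_lt_ofReal_iff_of_nonneg (sub_nonneg.2 hr.1)).2 (by linarith [hr.2])) hτ,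
      hu.1.2.1.1.trans hr.1, hr.2.trans_le hs⟩
  unfold relativeAdvance
  linarith

/-- While following a slow car, a fast car is at the place of that slow car. -/
theorem exists_of_follows (h : IsFastTrajectory v₁ v₂ a ρ τ x₀ t₀ X) {s : ℝ}
    (hf : FollowsSlowCar v₂ a ρ τ t₀ X s) :
    ∃ j u, IsLeast (meetingTimes v₂ (a j) (ρ j) t₀ X) u ∧ u ≤ s ∧
      ENNReal.ofReal (s - u) < τ j ∧ SlowCarPresent v₂ (a j) (ρ j) s ∧
      relativeAdvance v₂ x₀ t₀ X s = comovingCoord v₂ (x₀ - v₂ * t₀) (a j) := by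
  obtain ⟨j, u, hu, hus, hτ, hp⟩ := hf
  exact ⟨j, u, hu, hus, hτ, hp, h.relativeAdvance_eq_of_isLeast hu hus hτ.le hp.2.le⟩

/-- The first time at which a given relative advance is reached. -/
theorem exists_first_time (h : IsFastTrajectory v₁ v₂ a ρ τ x₀ t₀ X) {y t : ℝ} (ht : t₀ ≤ t)
    (hy : 0 ≤ y) (hyt : y ≤ relativeAdvance v₂ x₀ t₀ X t) :
    ∃ u ∈ Icc t₀ t, relativeAdvance v₂ x₀ t₀ X u = y ∧
      ∀ s, t₀ ≤ s → relativeAdvance v₂ x₀ t₀ X s = y → u ≤ s := by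
  have hc : ContinuousOn (relativeAdvance v₂ x₀ t₀ X) (Icc t₀ t) :=
    h.continuousOn_relativeAdvance.mono fun x hx => hx.1
  have hcomp : IsCompact (Icc t₀ t ∩ relativeAdvance v₂ x₀ t₀ X ⁻¹' {y}) :=
    isCompact_Icc.of_isClosed_subset
      (hc.preimage_isClosed_of_isClosed isClosed_Icc isClosed_singleton) inter_subset_left
  have hne : (Icc t₀ t ∩ relativeAdvance v₂ x₀ t₀ X ⁻¹' {y}).Nonempty := by
    obtain ⟨u, hu, e⟩ := intermediate_value_Icc ht hc
      (show y ∈ Icc _ _ from ⟨h.relativeAdvance_initial.trans_le hy, hyt⟩)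
    exact ⟨u, hu, e⟩
  obtain ⟨u, hu, hl⟩ := hcomp.exists_isLeast hne
  refine ⟨u, hu.1, hu.2, fun s hs e => ?_⟩
  by_contra! hlt
  exact hlt.not_ge (hl ⟨⟨hs, hlt.le.trans hu.1.2⟩, e⟩)

/-- The last time up to which a given relative advance is not exceeded. -/
theorem exists_last_time (h : IsFastTrajectory v₁ v₂ a ρ τ x₀ t₀ X) {y t : ℝ} (ht : t₀ ≤ t)
    (hy : 0 ≤ y) (hyt : y ≤ relativeAdvance v₂ x₀ t₀ X t) :
    ∃ u ∈ Icc t₀ t, relativeAdvance v₂ x₀ t₀ X u = y ∧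
      ∀ s ∈ Icc t₀ t, relativeAdvance v₂ x₀ t₀ X s = y → s ≤ u := by
  have hc : ContinuousOn (relativeAdvance v₂ x₀ t₀ X) (Icc t₀ t) :=
    h.continuousOn_relativeAdvance.mono fun x hx => hx.1
  have hcomp : IsCompact (Icc t₀ t ∩ relativeAdvance v₂ x₀ t₀ X ⁻¹' {y}) :=
    isCompact_Icc.of_isClosed_subset
      (hc.preimage_isClosed_of_isClosed isClosed_Icc isClosed_singleton) inter_subset_left
  have hne : (Icc t₀ t ∩ relativeAdvance v₂ x₀ t₀ X ⁻¹' {y}).Nonempty := by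
    obtain ⟨u, hu, e⟩ := intermediate_value_Icc ht hc
      (show y ∈ Icc _ _ from ⟨h.relativeAdvance_initial.trans_le hy, hyt⟩)
    exact ⟨u, hu, e⟩
  obtain ⟨u, hu, hl⟩ := hcomp.exists_isGreatest hne
  exact ⟨u, hu.1, hu.2, fun s hs e => hl ⟨hs, e⟩⟩

end IsFastTrajectory

/-! ### Comparison with the discretised arrival times -/

/-- A slow car with its folded entrance point, its route length and the distance for which it is
followed if it stays on the road. -/
noncomputable def foldedCar (v₂ κ y₀ : ℝ) (b : ℝ × ℝ) (r : ℝ) (s : ℝ≥0∞) : MarkedCar :=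
  (foldedPoint v₂ κ y₀ b, r, ENNReal.ofReal v₂ * s)

theorem foldedCar_of_pos {κ y₀ : ℝ} {b : ℝ × ℝ} (hb : 0 < comovingCoord v₂ y₀ b) (r : ℝ)
    (s : ℝ≥0∞) : foldedCar v₂ κ y₀ b r s
      = ((comovingCoord v₂ y₀ b, v₂ * b.2 - κ * comovingCoord v₂ y₀ b), r,
        ENNReal.ofReal v₂ * s) := by
  rw [foldedCar, foldedPoint, if_pos hb]

namespace IsFastTrajectory

/-- Induction over the cells. If the scheme were delayed in a cell beyond the clock reading of the
true car, the slow car `j` responsible would not be a reflected one, by the choice of `K`. The true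
car meets it no earlier on the sheared clock and follows it until the reading `V + r`, yet it has
passed the cell before that reading. -/
theorem delayScheme_le (h : IsFastTrajectory v₁ v₂ a ρ τ x₀ t₀ X) (hv₂ : 0 < v₂) (hv : v₂ < v₁)
    {κ : ℝ} (hκ : κ = v₂ / (v₁ - v₂)) {w : ℕ → MarkedCar}
    (hw : ∀ j, w j = foldedCar v₂ κ (x₀ - v₂ * t₀) (a j) (ρ j) (τ j)) {K : ℕ}
    (hK : ∀ j, comovingCoord v₂ (x₀ - v₂ * t₀) (a j) ≤ 0 → (K : ℝ) < (w j).1.1 →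
      (w j).1.2 + ρ j ≤ v₂ * t₀) (m : ℕ) :
    ∀ (i : ℕ) (t : ℝ), t₀ ≤ t → (K : ℝ) + i / 2 ^ m < relativeAdvance v₂ x₀ t₀ X t →
      delayScheme w K m (v₂ * t₀) i ≤ v₂ * t - κ * relativeAdvance v₂ x₀ t₀ X t := by
  -- For this `κ` the sheared clock stands still in free motion and runs at rate `v₂` in following,
  -- hence never decreases.
  have hmono : ∀ s t, t₀ ≤ s → s ≤ t → v₂ * s - κ * relativeAdvance v₂ x₀ t₀ X s
      ≤ v₂ * t - κ * relativeAdvance v₂ x₀ t₀ X t := by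
    intro s t hs hst
    have h1 := h.sub_le hv.le hs hst
    have hw' : 0 < v₁ - v₂ := sub_pos.2 hv
    have hκ' : κ * (v₁ - v₂) = v₂ := by rw [hκ]; field_simp
    have hκ0 : 0 < κ := by rw [hκ]; positivity
    have h2 : relativeAdvance v₂ x₀ t₀ X t - relativeAdvance v₂ x₀ t₀ X s
        ≤ (v₁ - v₂) * (t - s) := by
      unfold relativeAdvance
      linarith
    have h3 := mul_le_mul_of_nonneg_left h2 hκ0.le
    have h4 : κ * ((v₁ - v₂) * (t - s)) = v₂ * (t - s) := by rw [← mul_assoc, hκ']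
    linarith
  set Y := relativeAdvance v₂ x₀ t₀ X with hYdef
  intro i
  induction i with
  | zero =>
    intro t ht _
    have := hmono t₀ t le_rfl ht
    rw [hYdef, h.relativeAdvance_initial] at this
    simpa [delayScheme] using this
  | succ i ih =>
    intro t ht hYt
    have hpow : (0 : ℝ) < 2 ^ m := by positivity
    have hcell : (K : ℝ) + i / 2 ^ m < K + (i + 1 : ℕ) / 2 ^ m := by
      push_cast
      gcongr
      linarith
    have hV := ih t ht (hcell.trans hYt)
    have hV0 := le_delayScheme w K m (v₂ * t₀) i
    rw [delayScheme]
    set V := delayScheme w K m (v₂ * t₀) i with hVdef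
    suffices hs : cellDelay (dyadicCell K m i) w V ≤ ENNReal.ofReal (v₂ * t - κ * Y t - V) by
      have := ENNReal.toReal_mono ENNReal.ofReal_ne_top hs
      rw [ENNReal.toReal_ofReal (sub_nonneg.2 hV)] at this
      linarith
    refine iSup_le fun j => iSup_le fun hj => ?_
    by_contra! hlt
    obtain ⟨hb, hτ', hρ'⟩ := lt_carDelay_iff.1 hlt
    have hj1 : (K : ℝ) < (w j).1.1 := lt_of_le_of_lt (by simp; positivity) hj.1
    -- A car behind the fast car enters only through its reflection. Beyond `K` this reflection has
    -- left the road by the initial clock reading, so it cannot cause a delay.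
    rcases le_or_gt (comovingCoord v₂ (x₀ - v₂ * t₀) (a j)) 0 with hneg | hpos
    · have h1 := hK j hneg hj1
      have h2 : (w j).2.1 = ρ j := by rw [hw]; rfl
      rw [h2, ENNReal.ofReal_of_nonpos (p := (w j).1.2 + ρ j - V) (by linarith)] at hρ'
      exact not_lt_zero hρ'
    have hwj := hw j
    rw [foldedCar_of_pos hpos] at hwj
    rw [hwj] at hb hτ' hρ' hj
    set y := comovingCoord v₂ (x₀ - v₂ * t₀) (a j) with hydef
    dsimp only at hb hτ' hρ' hj
    -- A finite delay strictly between the true one and the one claimed for car `j`; this also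
    -- covers `τ j = ∞`.
    obtain ⟨c, hc1, hc2⟩ := exists_between (lt_min hτ' hρ')
    rw [lt_min_iff] at hc2
    obtain ⟨r, rfl⟩ : ∃ r : ℝ, c = ENNReal.ofReal r :=
      ⟨c.toReal, (ENNReal.ofReal_toReal hc2.1.ne_top).symm⟩
    have hr1 : v₂ * t - κ * Y t - V < r := (ENNReal.ofReal_lt_ofReal_iff_of_nonneg
      (sub_nonneg.2 hV)).1 hc1
    have hr0 : 0 < r := lt_of_le_of_lt (sub_nonneg.2 hV) hr1
    have hr2 : r < v₂ * (a j).2 - κ * y + ρ j - V := (ENNReal.ofReal_lt_ofReal_iff_of_nonneg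
      hr0.le).1 hc2.2
    have hyt : y < Y t := hj.2.trans_lt (by push_cast at hYt; exact hYt)
    obtain ⟨u, hu, huy, hmin⟩ := h.exists_first_time ht hpos.le hyt.le
    replace huy : Y u = y := huy
    have hVu : V ≤ v₂ * u - κ * y := by
      have := ih u hu.1 (huy.symm ▸ hj.1)
      rwa [huy] at this
    have hle := hmono u t hu.1 hu.2
    rw [huy] at hle
    have hpres : SlowCarPresent v₂ (a j) (ρ j) u := by
      constructor
      · exact (lt_of_mul_lt_mul_left (a := v₂) (by linarith) hv₂.le).le
      · refine lt_of_mul_lt_mul_left (a := v₂) ?_ hv₂.le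
        rw [mul_add, mul_div_cancel₀ (ρ j) hv₂.ne']
        linarith
    have hleast : IsLeast (meetingTimes v₂ (a j) (ρ j) t₀ X) u :=
      ⟨⟨hu.1, hpres, eq_slowCarPosition_iff.2 huy⟩,
        fun s hs => hmin s hs.1 (eq_slowCarPosition_iff.1 hs.2.2)⟩
    -- The time at which the sheared clock reads `V + r` for a car whose advance is still `y`.
    have hs1 : v₂ * ((V + r + κ * y) / v₂) = V + r + κ * y := mul_div_cancel₀ _ hv₂.ne'
    set s := (V + r + κ * y) / v₂
    have hus : u ≤ s := le_of_mul_le_mul_left (by linarith) hv₂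
    have hYs := h.relativeAdvance_eq_of_isLeast hleast hus (by
        have e : ENNReal.ofReal v₂ * ENNReal.ofReal (s - u) < ENNReal.ofReal v₂ * τ j := by
          rw [← ENNReal.ofReal_mul hv₂.le]
          refine lt_of_le_of_lt (ENNReal.ofReal_le_ofReal ?_) hc2.1
          linarith
        exact (lt_of_mul_lt_mul_left' e).le) (by
        refine le_of_mul_le_mul_left ?_ hv₂
        rw [mul_add, mul_div_cancel₀ (ρ j) hv₂.ne']
        linarith)
    rcases le_total s t with hst | hst
    · have := hmono s t (hu.1.trans hus) hst
      rw [hYdef, hYs] at this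
      linarith
    · have := h.relativeAdvance_mono hv.le ht hst
      rw [hYs] at this
      linarith

end IsFastTrajectory

end Trajectory

/-! ### Upper comparison with the scheme -/

section Trajectory

variable {v₁ v₂ : ℝ} {a : ℕ → ℝ × ℝ} {ρ : ℕ → ℝ} {τ : ℕ → ℝ≥0∞} {x₀ t₀ : ℝ} {X : ℝ → ℝ}

namespace IsFastTrajectory

theorem relativeAdvance_sub_eq_of_free (h : IsFastTrajectory v₁ v₂ a ρ τ x₀ t₀ X) {s t : ℝ}
    (hs : t₀ ≤ s) (hst : s ≤ t) (hf : ∀ r ∈ Ico s t, ¬ FollowsSlowCar v₂ a ρ τ t₀ X r) :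
    relativeAdvance v₂ x₀ t₀ X t - relativeAdvance v₂ x₀ t₀ X s = (v₁ - v₂) * (t - s) := by
  have := h.sub_eq_of_free hs hst hf
  unfold relativeAdvance
  linarith

/-- Since `κ` exceeds the critical value, the sheared clock strictly decreases in free motion. Each
car is thus met at a reading below the scheme's reading `V`, which yields the strict inequality
between start and arrival required by `carDelay`. With at most one relevant car in a cell, the
single delay counted by the scheme is all that the trajectory suffers there. -/
theorem le_delayScheme (h : IsFastTrajectory v₁ v₂ a ρ τ x₀ t₀ X) (hv₂ : 0 < v₂) (hv : v₂ < v₁)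
    {κ : ℝ} (hκ : v₂ / (v₁ - v₂) < κ) {w : ℕ → MarkedCar}
    (hw : ∀ j, w j = foldedCar v₂ κ (x₀ - v₂ * t₀) (a j) (ρ j) (τ j)) (hfin : FiniteDelays w)
    (h0 : ∀ j, comovingCoord v₂ (x₀ - v₂ * t₀) (a j) ≠ 0) {m N : ℕ} {t : ℝ}
    (hcell : ∀ i < N, ∀ j k, (a j).2 ≤ t → (a k).2 ≤ t →
      comovingCoord v₂ (x₀ - v₂ * t₀) (a j) ∈ dyadicCell 0 m i →
      comovingCoord v₂ (x₀ - v₂ * t₀) (a k) ∈ dyadicCell 0 m i → j = k) :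
    ∀ i ≤ N, ∀ t', t₀ ≤ t' → t' ≤ t → relativeAdvance v₂ x₀ t₀ X t' ≤ i / 2 ^ m →
      v₂ * t' - κ * relativeAdvance v₂ x₀ t₀ X t' ≤ delayScheme w 0 m (v₂ * t₀) i := by
  have hw' : 0 < v₁ - v₂ := sub_pos.2 hv
  have hκ0 : 0 < κ := lt_trans (by positivity) hκ
  have hκ' : v₂ < κ * (v₁ - v₂) := (div_lt_iff₀ hw').1 hκ
  set Y := relativeAdvance v₂ x₀ t₀ X with hYdef
  have hfree : ∀ s t, t₀ ≤ s → s ≤ t → (∀ r ∈ Ico s t, ¬ FollowsSlowCar v₂ a ρ τ t₀ X r) →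
      v₂ * t - κ * Y t + (κ * (v₁ - v₂) - v₂) * (t - s) = v₂ * s - κ * Y s := by
    intro s t hs hst hf
    have := h.relativeAdvance_sub_eq_of_free hs hst hf
    have : Y t = Y s + (v₁ - v₂) * (t - s) := by linarith
    rw [this]
    ring
  have hfree' : ∀ s t, t₀ ≤ s → s ≤ t → (∀ r ∈ Ico s t, ¬ FollowsSlowCar v₂ a ρ τ t₀ X r) →
      v₂ * t - κ * Y t ≤ v₂ * s - κ * Y s := by
    intro s t hs hst hf
    have := hfree s t hs hst hf
    have h2 : 0 ≤ (κ * (v₁ - v₂) - v₂) * (t - s) :=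
      mul_nonneg (by linarith) (sub_nonneg.2 hst)
    linarith
  intro i
  induction i with
  -- While the advance is still `0` nothing is followed, since no slow car has comoving coordinate
  -- `0`.
  | zero =>
    intro _ t' ht' _ hY
    have hY0 : Y t₀ = 0 := h.relativeAdvance_initial
    have := hfree' t₀ t' le_rfl ht' fun r hr hf => by
      obtain ⟨j, u, -, -, -, -, e⟩ := h.exists_of_follows hf
      refine h0 j (e ▸ le_antisymm ?_ ?_)
      · refine (h.relativeAdvance_mono hv.le hr.1 hr.2.le).trans (hY.trans ?_)
        simp
      · exact hY0 ▸ h.relativeAdvance_mono hv.le le_rfl hr.1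
    rw [hY0] at this
    simpa [delayScheme] using this
  | succ i ih =>
    intro hiN t' ht' htt' hY
    replace ih := ih (Nat.le_of_succ_le hiN)
    rcases le_or_gt (Y t') (i / 2 ^ m) with hle | hgt
    · exact (ih t' ht' htt' hle).trans (delayScheme_le_succ w 0 m _ i)
    obtain ⟨σ, hσ, hYσ, hlast⟩ := h.exists_last_time (y := (i : ℝ) / 2 ^ m) ht'
      (by positivity) hgt.le
    replace hYσ : Y σ = i / 2 ^ m := hYσ
    have hSσ := ih σ hσ.1 (hσ.2.trans htt') hYσ.le
    by_cases hno : ∀ r ∈ Ico σ t', ¬ FollowsSlowCar v₂ a ρ τ t₀ X r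
    · exact (hfree' σ t' hσ.1 hσ.2 hno).trans (hSσ.trans (delayScheme_le_succ w 0 m _ i))
    -- any slow car followed after `σ` lies in the cell and is met after `σ`
    have hfol : ∀ r ∈ Ico σ t', FollowsSlowCar v₂ a ρ τ t₀ X r →
        ∃ j u, IsLeast (meetingTimes v₂ (a j) (ρ j) t₀ X) u ∧ u ≤ r ∧
          ENNReal.ofReal (r - u) < τ j ∧ SlowCarPresent v₂ (a j) (ρ j) r ∧
          comovingCoord v₂ (x₀ - v₂ * t₀) (a j) ∈ dyadicCell 0 m i ∧ σ < u := by
      intro r hr hf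
      obtain ⟨j, u, hu, hur, hτ, hp, e⟩ := h.exists_of_follows hf
      have hYu := (eq_slowCarPosition_iff (x₀ := x₀) (t₀ := t₀)).1 hu.1.2.2
      have hlow : (i : ℝ) / 2 ^ m < Y u := by
        have h1 : (i : ℝ) / 2 ^ m ≤ Y u := by
          rw [hYdef, hYu, ← e, ← hYσ]
          exact h.relativeAdvance_mono hv.le hσ.1 hr.1
        -- A car standing exactly on the left edge of the cell would still be followed a little
        -- after `r`. This would keep the advance on the edge beyond its last time `σ`.
        refine lt_of_le_of_ne h1 fun heq => ?_
        obtain ⟨c, hc1, hc2⟩ := exists_between hτ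
        obtain ⟨d, rfl⟩ : ∃ d : ℝ, c = ENNReal.ofReal d :=
          ⟨c.toReal, (ENNReal.ofReal_toReal hc2.ne_top).symm⟩
        have hd : r - u < d := (ENNReal.ofReal_lt_ofReal_iff_of_nonneg (sub_nonneg.2 hur)).1 hc1
        have hrs : r < min (u + d) (min t' ((a j).2 + ρ j / v₂)) :=
          lt_min (by linarith) (lt_min hr.2 hp.2)
        set s := min (u + d) (min t' ((a j).2 + ρ j / v₂))
        have hs1 : s ≤ u + d := min_le_left _ _
        have hs2 : s ≤ t' := (min_le_right _ _).trans (min_le_left _ _)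
        have hs3 : s ≤ (a j).2 + ρ j / v₂ := (min_le_right _ _).trans (min_le_right _ _)
        have hYs := h.relativeAdvance_eq_of_isLeast hu (hur.trans hrs.le)
          ((ENNReal.ofReal_le_ofReal (by linarith)).trans hc2.le) hs3
        have := hlast s ⟨hu.1.1.trans (hur.trans hrs.le), hs2⟩
          (by rw [hYs, ← hYu]; exact heq.symm)
        linarith [hr.1]
      refine ⟨j, u, hu, hur, hτ, hp, ?_, ?_⟩
      · rw [← hYu]
        refine ⟨by simpa using hlow, ?_⟩
        refine (h.relativeAdvance_mono hv.le hu.1.1 (hur.trans hr.2.le)).trans (hY.trans ?_)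
        simp
      · by_contra! hle
        have := h.relativeAdvance_mono hv.le hu.1.1 hle
        exact (hlow.trans_le this).ne hYσ.symm
    push Not at hno
    obtain ⟨r, hr, hfr⟩ := hno
    obtain ⟨j, u, hu, hur, hτ, hp, hyj, hσu⟩ := hfol r hr hfr
    have hYu := (eq_slowCarPosition_iff (x₀ := x₀) (t₀ := t₀)).1 hu.1.2.2
    have honly : ∀ s ∈ Ico σ t', FollowsSlowCar v₂ a ρ τ t₀ X s → u ≤ s ∧
        ENNReal.ofReal (s - u) < τ j ∧ SlowCarPresent v₂ (a j) (ρ j) s := by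
      intro s hs hf
      obtain ⟨k, u', hu', hus, hτ', hp', hyk, -⟩ := hfol s hs hf
      obtain rfl := hcell i hiN j k (hp.1.trans (hr.2.le.trans htt'))
        (hp'.1.trans (hs.2.le.trans htt')) hyj hyk
      obtain rfl := hu.unique hu'
      exact ⟨hus, hτ', hp'⟩
    have hut' : u ≤ t' := hur.trans hr.2.le
    have hSu := hfree σ u hσ.1 hσu.le fun s hs hf =>
      hs.2.not_ge (honly s ⟨hs.1, hs.2.trans_le hut'⟩ hf).1
    -- The strict loss of sheared time on the free run from `σ` to `u` makes the start of car `j`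
    -- strictly smaller than `V` below.
    have hpos1 : 0 < (κ * (v₁ - v₂) - v₂) * (u - σ) :=
      mul_pos (by linarith) (sub_pos.2 hσu)
    rw [delayScheme]
    set V := delayScheme w 0 m (v₂ * t₀) i
    set y := comovingCoord v₂ (x₀ - v₂ * t₀) (a j) with hydef
    have hypos : 0 < y := lt_of_le_of_lt (by positivity) hyj.1
    replace hYu : Y u = y := hYu
    rw [hYu] at hSu
    have htj : v₂ * (a j).2 ≤ v₂ * u := mul_le_mul_of_nonneg_left hu.1.2.1.1 hv₂.le
    have hbV : v₂ * (a j).2 - κ * y < V := by linarith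
    -- the time at which car `j` stops delaying
    have hend : ∃ f ∈ Icc u t', ENNReal.ofReal (f - u) ≤ τ j ∧ f ≤ (a j).2 + ρ j / v₂ ∧
        ∀ s ∈ Ico f t', ¬ FollowsSlowCar v₂ a ρ τ t₀ X s := by
      have hue : u ≤ (a j).2 + ρ j / v₂ := hu.1.2.1.2.le
      -- The remaining stay on the road bounds the following time, even if overtaking is impossible.
      have hd : min (ENNReal.ofReal ((a j).2 + ρ j / v₂ - u)) (τ j) ≠ ∞ :=
        ne_top_of_le_ne_top ENNReal.ofReal_ne_top (min_le_left _ _)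
      set d := min (ENNReal.ofReal ((a j).2 + ρ j / v₂ - u)) (τ j) with hddef
      have hd1 : d.toReal ≤ (a j).2 + ρ j / v₂ - u := by
        rw [← ENNReal.toReal_ofReal (sub_nonneg.2 hue)]
        exact ENNReal.toReal_mono ENNReal.ofReal_ne_top (min_le_left _ _)
      refine ⟨min (u + d.toReal) t', ⟨le_min (by simp) hut', min_le_right _ _⟩, ?_, ?_, ?_⟩
      · calc ENNReal.ofReal (min (u + d.toReal) t' - u) ≤ ENNReal.ofReal d.toReal :=
              ENNReal.ofReal_le_ofReal (by linarith [min_le_left (u + d.toReal) t'])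
          _ = d := ENNReal.ofReal_toReal hd
          _ ≤ τ j := min_le_right _ _
      · linarith [min_le_left (u + d.toReal) t']
      · intro s hs hf
        have hs' : u + d.toReal ≤ s := by
          rcases min_le_iff.1 hs.1 with h1 | h1
          · exact h1
          · exact absurd hs.2 h1.not_gt
        have hus : u ≤ s := le_trans (by simp) hs'
        obtain ⟨-, h2, h3⟩ := honly s ⟨hσu.le.trans hus, hs.2⟩ hf
        have h4 : d ≤ ENNReal.ofReal (s - u) := by
          rw [← ENNReal.ofReal_toReal hd]
          exact ENNReal.ofReal_le_ofReal (by linarith)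
        rcases min_le_iff.1 h4 with h5 | h5
        · rw [ENNReal.ofReal_le_ofReal_iff (by linarith)] at h5
          linarith [h3.2]
        · exact h5.not_gt h2
    obtain ⟨f, hf, hfτ, hfe, hff⟩ := hend
    have hSf := hfree' f t' (hu.1.1.trans hf.1) hf.2 hff
    have hYf := h.relativeAdvance_eq_of_isLeast hu hf.1 hfτ hfe
    replace hYf : Y f = y := hYf
    rw [hYf] at hSf
    have hcd : ENNReal.ofReal (v₂ * t' - κ * Y t' - V) ≤ cellDelay (dyadicCell 0 m i) w V := by
      have hwj : w j = ((y, v₂ * (a j).2 - κ * y), ρ j, ENNReal.ofReal v₂ * τ j) := by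
        rw [hw, foldedCar_of_pos hypos]
      refine le_trans ?_ (carDelay_le_cellDelay (j := j) (by rw [hwj]; exact hyj) V)
      rw [hwj, carDelay, if_pos hbV]
      refine le_min ?_ (ENNReal.ofReal_le_ofReal ?_)
      · calc ENNReal.ofReal (v₂ * t' - κ * Y t' - V) ≤ ENNReal.ofReal (v₂ * (f - u)) :=
              ENNReal.ofReal_le_ofReal (by linarith)
          _ = ENNReal.ofReal v₂ * ENNReal.ofReal (f - u) := ENNReal.ofReal_mul hv₂.le
          _ ≤ ENNReal.ofReal v₂ * τ j := by gcongr
      · have := mul_le_mul_of_nonneg_left hfe hv₂.le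
        rw [mul_add, mul_div_cancel₀ (ρ j) hv₂.ne'] at this
        dsimp only
        linarith
    have := (ENNReal.ofReal_le_iff_le_toReal (hfin.ne_top 0 m i V)).1 hcd
    linarith

end IsFastTrajectory

end Trajectory

/-! ### From bounds on the advance to the mean speed -/

section Trajectory

variable {v₁ v₂ : ℝ} {a : ℕ → ℝ × ℝ} {ρ : ℕ → ℝ} {τ : ℕ → ℝ≥0∞} {x₀ t₀ : ℝ} {X : ℝ → ℝ}

/-- Finitely many slow cars enter a bounded part of the road in bounded time, and none enters
before time `0`. -/
structure LocallyFiniteEntrances (a : ℕ → ℝ × ℝ) : Prop where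
  nonneg : ∀ j, 0 ≤ (a j).2
  finite : ∀ R : ℕ, {j | |(a j).1| ≤ R ∧ (a j).2 ≤ R}.Finite

theorem LocallyFiniteEntrances.finite_comovingCoord (ha : LocallyFiniteEntrances a) (hv₂ : 0 < v₂)
    (y₀ R t : ℝ) : {j | |comovingCoord v₂ y₀ (a j)| ≤ R ∧ (a j).2 ≤ t}.Finite := by
  obtain ⟨n, hn⟩ := exists_nat_ge (max (R + |y₀| + v₂ * t) t)
  refine (ha.finite n).subset fun j ⟨h1, h2⟩ => ⟨?_, h2.trans ((le_max_right _ _).trans hn)⟩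
  refine le_trans ?_ ((le_max_left _ _).trans hn)
  have h3 : v₂ * (a j).2 ≤ v₂ * t := mul_le_mul_of_nonneg_left h2 hv₂.le
  have h4 : 0 ≤ v₂ * (a j).2 := mul_nonneg hv₂.le (ha.nonneg j)
  unfold comovingCoord at h1
  rw [abs_le] at h1 ⊢
  have := neg_abs_le y₀
  have := le_abs_self y₀
  constructor <;> linarith [h1.1, h1.2]

theorem exists_mesh_injOn {y : ℕ → ℝ} {J : Set ℕ} (hJ : J.Finite) (hinj : InjOn y J) :
    ∃ m : ℕ, ∀ i, ∀ j ∈ J, ∀ k ∈ J, y j ∈ dyadicCell 0 m i → y k ∈ dyadicCell 0 m i → j = k := by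
  have hev : ∀ j ∈ J, ∀ k ∈ J, ∀ᶠ m : ℕ in atTop,
      ∀ i, y j ∈ dyadicCell 0 m i → y k ∈ dyadicCell 0 m i → j = k := by
    intro j hj k hk
    by_cases hjk : j = k
    · exact Eventually.of_forall fun _ _ _ _ => hjk
    have hpos : 0 < |y j - y k| := abs_pos.2 (sub_ne_zero.2 fun e => hjk (hinj hj hk e))
    have hlim : Tendsto (fun m : ℕ => ((1 : ℝ) / 2) ^ m) atTop (𝓝 0) :=
      tendsto_pow_atTop_nhds_zero_of_lt_one (by norm_num) (by norm_num)
    filter_upwards [hlim.eventually_lt_const hpos] with m hm i h1 h2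
    exfalso
    have e : ((i : ℝ) + 1) / 2 ^ m = i / 2 ^ m + (1 / 2) ^ m := by
      rw [add_div, one_div_pow]
    unfold dyadicCell at h1 h2
    rw [e] at h1 h2
    refine hm.not_ge (abs_le.2 ⟨?_, ?_⟩) <;> linarith [h1.1, h1.2, h2.1, h2.2]
  have := (eventually_all_finite hJ).2 fun j hj => (eventually_all_finite hJ).2 (hev j hj)
  obtain ⟨m, hm⟩ := this.exists
  exact ⟨m, fun i j hj k hk => hm j hj k hk i⟩

namespace IsFastTrajectory

/-- Up to time `t` only finitely many cars have entered within distance `n`, at distinct comoving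
positions, so some mesh separates them. This mesh depends on `t`, which is why a bound `L` uniform
in `m` is assumed. -/
theorem sub_le_of_forall_delayScheme_le (h : IsFastTrajectory v₁ v₂ a ρ τ x₀ t₀ X) (hv₂ : 0 < v₂)
    (hv : v₂ < v₁) (ha : LocallyFiniteEntrances a)
    {κ : ℝ} (hκ : v₂ / (v₁ - v₂) < κ) {w : ℕ → MarkedCar}
    (hw : ∀ j, w j = foldedCar v₂ κ (x₀ - v₂ * t₀) (a j) (ρ j) (τ j)) (hfin : FiniteDelays w)
    (h0 : ∀ j, comovingCoord v₂ (x₀ - v₂ * t₀) (a j) ≠ 0)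
    (hinj : Function.Injective fun j => comovingCoord v₂ (x₀ - v₂ * t₀) (a j)) {n : ℕ} {t L : ℝ}
    (ht : t₀ ≤ t) (hn : relativeAdvance v₂ x₀ t₀ X t ≤ n)
    (hL : ∀ m, delayScheme w 0 m (v₂ * t₀) (n * 2 ^ m) ≤ L) :
    v₂ * t - κ * relativeAdvance v₂ x₀ t₀ X t ≤ L := by
  obtain ⟨m, hm⟩ := exists_mesh_injOn (y := fun j => comovingCoord v₂ (x₀ - v₂ * t₀) (a j))
    (ha.finite_comovingCoord hv₂ (x₀ - v₂ * t₀) n t) (hinj.injOn)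
  have hpow : (0 : ℝ) < 2 ^ m := by positivity
  refine (h.le_delayScheme hv₂ hv hκ hw hfin h0 (N := n * 2 ^ m) (t := t) (m := m) ?_ _ le_rfl t ht
    le_rfl ?_).trans (hL m)
  · intro i hi j k hj hk hyj hyk
    have hb : ∀ j, comovingCoord v₂ (x₀ - v₂ * t₀) (a j) ∈ dyadicCell 0 m i →
        |comovingCoord v₂ (x₀ - v₂ * t₀) (a j)| ≤ n := by
      intro j hj
      have h1 : 0 < comovingCoord v₂ (x₀ - v₂ * t₀) (a j) := lt_of_le_of_lt (by positivity) hj.1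
      rw [abs_of_pos h1]
      refine hj.2.trans ?_
      rw [Nat.cast_zero, zero_add, div_le_iff₀ hpow]
      exact_mod_cast hi
    exact hm i j ⟨hb j hyj, hj⟩ k ⟨hb k hyk, hk⟩ hyj hyk
  · push_cast
    rwa [mul_div_cancel_right₀ _ hpow.ne']

/-- If the advance stayed below an integer `n`, the bound would keep `v₂ t` below `L n + κ n`. -/
theorem _root_.tendsto_relativeAdvance (hv₂ : 0 < v₂) {κ : ℝ} (hκ : 0 ≤ κ) {L : ℕ → ℝ}
    (hL : ∀ (n : ℕ) (t : ℝ), t₀ ≤ t → relativeAdvance v₂ x₀ t₀ X t ≤ n →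
      v₂ * t - κ * relativeAdvance v₂ x₀ t₀ X t ≤ L n) :
    Tendsto (relativeAdvance v₂ x₀ t₀ X) atTop atTop := by
  refine tendsto_atTop.2 fun b => ?_
  obtain ⟨n, hn⟩ := exists_nat_ge b
  filter_upwards [eventually_ge_atTop t₀, eventually_gt_atTop ((L n + κ * n) / v₂)] with t ht ht2
  by_contra! hlt
  have h1 := hL n t ht (hlt.le.trans hn)
  rw [div_lt_iff₀ hv₂] at ht2
  have := mul_le_mul_of_nonneg_left (hlt.le.trans hn) hκ
  linarith

/-- Asymptotics of the relative advance, from bounds that hold at integer distances. -/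
theorem _root_.tendsto_div_relativeAdvance (hv₂ : 0 < v₂) {κ R : ℝ} (hκ : 0 < κ)
    {K : ℕ} {Ll : ℕ → ℝ} {Lu : ℕ → ℕ → ℝ}
    (hl : ∀ (n : ℕ) (t : ℝ), t₀ ≤ t → (K : ℝ) + n < relativeAdvance v₂ x₀ t₀ X t →
      Ll n ≤ v₂ * t - κ * relativeAdvance v₂ x₀ t₀ X t)
    (hu : ∀ (k n : ℕ) (t : ℝ), t₀ ≤ t → relativeAdvance v₂ x₀ t₀ X t ≤ n →
      v₂ * t - (κ + 1 / (k + 1)) * relativeAdvance v₂ x₀ t₀ X t ≤ Lu k n)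
    (hLl : Tendsto (fun n : ℕ => Ll n / n) atTop (𝓝 R))
    (hLu : ∀ k, Tendsto (fun n : ℕ => Lu k n / n) atTop (𝓝 R)) :
    Tendsto (fun t => v₂ * t / relativeAdvance v₂ x₀ t₀ X t) atTop (𝓝 (κ + R)) := by
  have hY := tendsto_relativeAdvance hv₂ (κ := κ + 1 / ((0 : ℕ) + 1)) (by positivity) (hu 0)
  set Y := relativeAdvance v₂ x₀ t₀ X
  have hceil : Tendsto (fun t => ⌈Y t⌉₊) atTop atTop := tendsto_nat_ceil_atTop.comp hY
  have hratio : Tendsto (fun t => ((⌈Y t⌉₊ : ℕ) : ℝ) / Y t) atTop (𝓝 1) :=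
    (tendsto_nat_ceil_div_atTop (R := ℝ)).comp hY
  have hYpos := hY.eventually_gt_atTop 0
  refine tendsto_order.2 ⟨fun b hb => ?_, fun b hb => ?_⟩
  -- With `n = ⌈Y⌉ - (K + 1)` one has `K + n = ⌈Y⌉ - 1 < Y`, the strict inequality that the lower
  -- bound requires.
  · have hsub : Tendsto (fun t => ⌈Y t⌉₊ - (K + 1)) atTop atTop :=
      (tendsto_sub_atTop_nat _).comp hceil
    have hr2 : Tendsto (fun t => ((⌈Y t⌉₊ - (K + 1) : ℕ) : ℝ) / Y t) atTop (𝓝 1) := by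
      have : Tendsto (fun t => ((⌈Y t⌉₊ : ℕ) : ℝ) / Y t - (K + 1) / Y t) atTop (𝓝 (1 - 0)) :=
        hratio.sub (hY.const_div_atTop _)
      rw [sub_zero] at this
      refine this.congr' ?_
      filter_upwards [hceil.eventually_ge_atTop (K + 1)] with t ht
      rw [Nat.cast_sub ht]
      push_cast
      ring
    have hlow : Tendsto (fun t => κ + Ll (⌈Y t⌉₊ - (K + 1)) / Y t) atTop (𝓝 (κ + R)) := by
      refine Tendsto.const_add _ ?_
      have := (hLl.comp hsub).mul hr2
      rw [mul_one] at this
      refine this.congr' ?_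
      filter_upwards [hsub.eventually_gt_atTop 0] with t ht
      have : ((⌈Y t⌉₊ - (K + 1) : ℕ) : ℝ) ≠ 0 := by exact_mod_cast ht.ne'
      simp only [Function.comp]
      field_simp
    filter_upwards [hlow.eventually_const_lt hb, hYpos, eventually_ge_atTop t₀,
      hceil.eventually_ge_atTop (K + 1)] with t h1 h2 h3 h4
    refine h1.trans_le ?_
    rw [le_div_iff₀ h2, add_mul, div_mul_cancel₀ _ h2.ne']
    have := hl (⌈Y t⌉₊ - (K + 1)) t h3 (by
      rw [Nat.cast_sub h4]
      push_cast
      have := Nat.ceil_lt_add_one h2.le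
      linarith)
    linarith
  -- The excess over the critical `κ` is arbitrarily small, so it is chosen to fit below `b`.
  · obtain ⟨k, hk⟩ : ∃ k : ℕ, κ + 1 / ((k : ℝ) + 1) + R < b := by
      obtain ⟨k, hk⟩ := exists_nat_one_div_lt (sub_pos.2 hb)
      exact ⟨k, by linarith⟩
    have hup : Tendsto (fun t => κ + 1 / ((k : ℝ) + 1) + Lu k ⌈Y t⌉₊ / Y t) atTop
        (𝓝 (κ + 1 / ((k : ℝ) + 1) + R)) := by
      refine Tendsto.const_add _ ?_
      have := ((hLu k).comp hceil).mul hratio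
      rw [mul_one] at this
      refine this.congr' ?_
      filter_upwards [hceil.eventually_gt_atTop 0] with t ht
      have : ((⌈Y t⌉₊ : ℕ) : ℝ) ≠ 0 := by exact_mod_cast ht.ne'
      simp only [Function.comp]
      field_simp
    filter_upwards [hup.eventually_lt_const hk, hYpos, eventually_ge_atTop t₀] with t h1 h2 h3
    refine lt_of_le_of_lt ?_ h1
    rw [div_le_iff₀ h2, add_mul, div_mul_cancel₀ _ h2.ne']
    have := hu k _ t h3 (Nat.le_ceil _)
    linarith

/-- The speed is at least `v₂ > 0`, so `X` is strictly increasing and the infimum is attained at the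
unique solution. -/
theorem travelTime_spec (h : IsFastTrajectory v₁ v₂ a ρ τ x₀ t₀ X) (hv₂ : 0 < v₂) (hv : v₂ ≤ v₁)
    {x : ℝ} (hx : 0 ≤ x) :
    0 ≤ travelTime t₀ X x ∧ X (t₀ + travelTime t₀ X x) = X t₀ + x := by
  have hcont : ContinuousOn (fun T => X (t₀ + T)) (Icc 0 (x / v₂)) :=
    h.continuousOn.comp (by fun_prop) fun T hT => by
      simpa using hT.1
  have hx0 : 0 ≤ x / v₂ := by positivity
  have hmem : X t₀ + x ∈ Icc (X (t₀ + 0)) (X (t₀ + x / v₂)) := by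
    have := h.le_sub hv (t := t₀ + x / v₂) le_rfl (by linarith)
    rw [add_sub_cancel_left, mul_div_cancel₀ _ hv₂.ne'] at this
    exact ⟨by simpa using hx, by linarith⟩
  obtain ⟨T, hT, hXT⟩ := intermediate_value_Icc hx0 hcont hmem
  dsimp only at hXT
  have : travelTime t₀ X x = T := by
    refine le_antisymm (csInf_le ⟨0, fun s hs => hs.1⟩ ⟨hT.1, hXT.ge⟩)
      (le_csInf ⟨T, hT.1, hXT.ge⟩ fun s hs => ?_)
    by_contra! hlt
    have := h.le_sub hv (s := t₀ + s) (t := t₀ + T) (by linarith [hs.1]) (by linarith)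
    have h2 : 0 < v₂ * (t₀ + T - (t₀ + s)) := mul_pos hv₂ (by linarith)
    linarith [hs.2]
  rw [this]
  exact ⟨hT.1, hXT⟩

/-- The travelled distance is `Y + v₂ (t - t₀)`, so its ratio to elapsed time tends to `v₂ + v₂ /
q`; the travel times themselves tend to infinity because the speed is at most `v₁`. -/
theorem tendsto_div_travelTime (h : IsFastTrajectory v₁ v₂ a ρ τ x₀ t₀ X) (hv₂ : 0 < v₂)
    (hv : v₂ < v₁) {q : ℝ} (hq : 0 < q)
    (hlim : Tendsto (fun t => v₂ * t / relativeAdvance v₂ x₀ t₀ X t) atTop (𝓝 q)) :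
    Tendsto (fun x => x / travelTime t₀ X x) atTop (𝓝 (v₂ + v₂ / q)) := by
  have hv₁ : 0 < v₁ := hv₂.trans hv
  have hT : Tendsto (fun x => t₀ + travelTime t₀ X x) atTop atTop := by
    refine tendsto_atTop_add_const_left _ _ ?_
    refine tendsto_atTop_mono' _ ?_ (tendsto_id.atTop_div_const hv₁)
    filter_upwards [eventually_ge_atTop 0] with x hx
    obtain ⟨h1, h2⟩ := h.travelTime_spec hv₂ hv.le hx
    have := h.sub_le hv.le (t := t₀ + travelTime t₀ X x) le_rfl (by linarith)
    rw [h2, add_sub_cancel_left, add_sub_cancel_left] at this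
    rw [id, div_le_iff₀ hv₁]
    linarith
  have h1 : Tendsto (fun t => (X t - X t₀) / (t - t₀)) atTop (𝓝 (v₂ + v₂ / q)) := by
    have e1 : Tendsto (fun t : ℝ => t / (t - t₀)) atTop (𝓝 1) := by
      have : Tendsto (fun t : ℝ => 1 + t₀ / (t - t₀)) atTop (𝓝 (1 + 0)) :=
        ((tendsto_atTop_add_const_right _ (-t₀) tendsto_id).const_div_atTop t₀).const_add 1
      rw [add_zero] at this
      refine this.congr' ?_
      filter_upwards [eventually_gt_atTop t₀] with t ht
      have : t - t₀ ≠ 0 := (sub_pos.2 ht).ne'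
      field_simp
      ring
    have e2 := ((hlim.inv₀ hq.ne').const_mul v₂).mul e1
    rw [mul_one] at e2
    refine (e2.const_add v₂).congr' ?_
    filter_upwards [eventually_gt_atTop t₀, eventually_gt_atTop 0] with t ht ht0
    have : t - t₀ ≠ 0 := (sub_pos.2 ht).ne'
    have hX : X t - X t₀ = relativeAdvance v₂ x₀ t₀ X t + v₂ * (t - t₀) := by
      rw [h.initial]
      unfold relativeAdvance
      ring
    rw [hX]
    field_simp
    ring
  refine (h1.comp hT).congr' ?_
  filter_upwards [eventually_ge_atTop 0] with x hx
  simp only [Function.comp]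
  rw [(h.travelTime_spec hv₂ hv.le hx).2, add_sub_cancel_left, add_sub_cancel_left]

end IsFastTrajectory

end Trajectory

/-! ### Existence of trajectories -/

section Existence

variable {v₁ v₂ : ℝ} {a : ℕ → ℝ × ℝ} {ρ : ℕ → ℝ} {τ : ℕ → ℝ≥0∞} {x₀ t₀ : ℝ}

/-- At time `s`, a fast car with trajectory `X` has the speed that the rules prescribe. -/
def ObeysSpeed (v₁ v₂ : ℝ) (a : ℕ → ℝ × ℝ) (ρ : ℕ → ℝ) (τ : ℕ → ℝ≥0∞) (t₀ : ℝ) (X : ℝ → ℝ)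
    (s : ℝ) : Prop :=
  (FollowsSlowCar v₂ a ρ τ t₀ X s → HasDerivWithinAt X v₂ (Ici s) s) ∧
    (¬ FollowsSlowCar v₂ a ρ τ t₀ X s → HasDerivWithinAt X v₁ (Ici s) s)

/-- The rules are causal: a first meeting by time `T` depends on the trajectory only up to `T`. This
is what allows partial trajectories to be prolonged and glued. -/
theorem isLeast_meetingTimes_congr {X X' : ℝ → ℝ} {b : ℝ × ℝ} {r u T : ℝ}
    (hX : EqOn X X' (Icc t₀ T)) (huT : u ≤ T) (hu : IsLeast (meetingTimes v₂ b r t₀ X) u) :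
    IsLeast (meetingTimes v₂ b r t₀ X') u := by
  refine ⟨⟨hu.1.1, hu.1.2.1, (hX ⟨hu.1.1, huT⟩).symm.trans hu.1.2.2⟩, fun s hs => ?_⟩
  by_contra! hlt
  exact hlt.not_ge (hu.2 ⟨hs.1, hs.2.1, (hX ⟨hs.1, hlt.le.trans huT⟩).trans hs.2.2⟩)

theorem FollowsSlowCar.congr {X X' : ℝ → ℝ} {s T : ℝ} (hX : EqOn X X' (Icc t₀ T)) (hsT : s ≤ T)
    (h : FollowsSlowCar v₂ a ρ τ t₀ X s) : FollowsSlowCar v₂ a ρ τ t₀ X' s := by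
  obtain ⟨j, u, hu, hus, h⟩ := h
  exact ⟨j, u, isLeast_meetingTimes_congr hX (hus.trans hsT) hu, hus, h⟩

theorem ObeysSpeed.congr {X X' : ℝ → ℝ} {s T : ℝ} (hX : EqOn X X' (Icc t₀ T))
    (hs : s ∈ Ico t₀ T) (h : ObeysSpeed v₁ v₂ a ρ τ t₀ X s) :
    ObeysSpeed v₁ v₂ a ρ τ t₀ X' s := by
  have hev : X' =ᶠ[𝓝[≥] s] X := by
    filter_upwards [Icc_mem_nhdsGE hs.2] with t ht
    exact (hX ⟨hs.1.trans ht.1, ht.2⟩).symm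
  have hat := (hX ⟨hs.1, hs.2.le⟩).symm
  exact ⟨fun hf => (h.1 (hf.congr hX.symm hs.2.le)).congr_of_eventuallyEq hev hat,
    fun hf => (h.2 fun hf' => hf (hf'.congr hX hs.2.le)).congr_of_eventuallyEq hev hat⟩

/-- The function equal to `X` up to time `T` and affine with slope `c` afterwards. -/
noncomputable def affineContinuation (X : ℝ → ℝ) (T c t : ℝ) : ℝ :=
  if t ≤ T then X t else X T + c * (t - T)

theorem affineContinuation_of_le {X : ℝ → ℝ} {T c t : ℝ} (ht : t ≤ T) :
    affineContinuation X T c t = X t := if_pos ht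

theorem affineContinuation_of_ge {X : ℝ → ℝ} {T c t : ℝ} (ht : T ≤ t) :
    affineContinuation X T c t = X T + c * (t - T) := by
  unfold affineContinuation
  split_ifs with h
  · rw [le_antisymm h ht]
    ring
  · rfl

theorem lipschitzWith_affineContinuation {K : ℝ≥0} {X : ℝ → ℝ} (hX : LipschitzWith K X) (T : ℝ)
    {c : ℝ} (hc : |c| ≤ K) : LipschitzWith K (affineContinuation X T c) := by
  have key : ∀ s t, s ≤ t →
      |affineContinuation X T c s - affineContinuation X T c t| ≤ K * (t - s) := by
    intro s t hst
    have hdist : ∀ s t, s ≤ t → |X s - X t| ≤ K * (t - s) := fun s t hst => by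
      have := hX.dist_le_mul s t
      rwa [Real.dist_eq, Real.dist_eq, abs_sub_comm s t, abs_of_nonneg (sub_nonneg.2 hst)] at this
    have hlin : ∀ s t, s ≤ t → |c * (s - t)| ≤ K * (t - s) := fun s t hst => by
      rw [abs_mul, abs_sub_comm s t, abs_of_nonneg (sub_nonneg.2 hst)]
      exact mul_le_mul_of_nonneg_right hc (sub_nonneg.2 hst)
    rcases le_total t T with h1 | h1
    · rw [affineContinuation_of_le h1, affineContinuation_of_le (hst.trans h1)]
      exact hdist s t hst
    rcases le_total s T with h2 | h2
    · rw [affineContinuation_of_le h2, affineContinuation_of_ge h1]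
      calc |X s - (X T + c * (t - T))| = |(X s - X T) + c * (T - t)| := by ring_nf
        _ ≤ |X s - X T| + |c * (T - t)| := abs_add_le _ _
        _ ≤ K * (T - s) + K * (t - T) := add_le_add (hdist s T h2) (hlin T t h1)
        _ = K * (t - s) := by ring
    · rw [affineContinuation_of_ge h2, affineContinuation_of_ge h1]
      calc |X T + c * (s - T) - (X T + c * (t - T))| = |c * (s - t)| := by ring_nf
        _ ≤ K * (t - s) := hlin s t hst
  refine LipschitzWith.of_dist_le_mul fun s t => ?_
  rw [Real.dist_eq, Real.dist_eq]
  rcases le_total s t with hst | hst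
  · rw [abs_sub_comm s t, abs_of_nonneg (sub_nonneg.2 hst)]
    exact key s t hst
  · rw [abs_of_nonneg (sub_nonneg.2 hst), abs_sub_comm]
    exact key t s hst

theorem hasDerivWithinAt_affineContinuation (X : ℝ → ℝ) (c : ℝ) {T s : ℝ} (hs : T ≤ s) :
    HasDerivWithinAt (affineContinuation X T c) c (Ici s) s := by
  have h1 : HasDerivWithinAt (fun t => X T + c * (t - T)) c (Ici s) s := by
    have := ((((hasDerivAt_id s).sub_const T).const_mul c).const_add (X T)).hasDerivWithinAt
      (s := Ici s)
    simpa using this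
  exact h1.congr (fun t ht => affineContinuation_of_ge (hs.trans ht))
    (affineContinuation_of_ge hs)

/-- If some car is being followed at `T`, this persists for a positive time. Otherwise local
finiteness leaves a gap of positive length ahead in the comoving frame, and any car first met at or
before `T` and followed shortly afterwards would already be followed at `T`. -/
theorem exists_obeysSpeed_extension (ha : LocallyFiniteEntrances a) (hv₂ : 0 < v₂) (hv : v₂ < v₁)
    {K : ℝ≥0} (hK : v₁ ≤ K) {X : ℝ → ℝ} {T : ℝ} (hX : LipschitzWith K X)
    (hrule : ∀ s ∈ Ico t₀ T, ObeysSpeed v₁ v₂ a ρ τ t₀ X s) :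
    ∃ T' > T, ∃ X' : ℝ → ℝ, LipschitzWith K X' ∧ EqOn X X' (Icc t₀ T) ∧
      ∀ s ∈ Ico t₀ T', ObeysSpeed v₁ v₂ a ρ τ t₀ X' s := by
  have hEq : ∀ c, EqOn X (affineContinuation X T c) (Icc t₀ T) := fun c t ht =>
    (affineContinuation_of_le ht.2).symm
  have hpast : ∀ c, ∀ s ∈ Ico t₀ T, ObeysSpeed v₁ v₂ a ρ τ t₀ (affineContinuation X T c) s :=
    fun c s hs => (hrule s hs).congr (hEq c) hs
  by_cases hf : FollowsSlowCar v₂ a ρ τ t₀ X T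
  · obtain ⟨j, u, hu, huT, hτ, hp⟩ := hf
    obtain ⟨c, hc1, hc2⟩ := exists_between hτ
    obtain ⟨d, rfl⟩ : ∃ d : ℝ, c = ENNReal.ofReal d :=
      ⟨c.toReal, (ENNReal.ofReal_toReal hc2.ne_top).symm⟩
    have hd : T - u < d := (ENNReal.ofReal_lt_ofReal_iff_of_nonneg (sub_nonneg.2 huT)).1 hc1
    refine ⟨min (u + d) ((a j).2 + ρ j / v₂), lt_min (by linarith) hp.2,
      affineContinuation X T v₂, lipschitzWith_affineContinuation hX T
        (by rw [abs_of_pos hv₂]; exact hv.le.trans hK), hEq v₂, fun s hs => ?_⟩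
    rcases lt_or_ge s T with hsT | hsT
    · exact hpast v₂ s ⟨hs.1, hsT⟩
    · refine ⟨fun _ => hasDerivWithinAt_affineContinuation X v₂ hsT, fun hn => ?_⟩
      refine absurd ⟨j, u, isLeast_meetingTimes_congr (hEq v₂) huT hu, huT.trans hsT, ?_, ?_⟩ hn
      · refine lt_of_le_of_lt (ENNReal.ofReal_le_ofReal ?_) hc2
        linarith [hs.2.trans_le (min_le_left (u + d) ((a j).2 + ρ j / v₂))]
      · exact ⟨hp.1.trans hsT, hs.2.trans_le (min_le_right _ _)⟩
  · have hw : 0 < v₁ - v₂ := sub_pos.2 hv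
    have hfin := ha.finite_comovingCoord hv₂ (X T - v₂ * T) (v₁ - v₂) (T + 1)
    have hev : ∀ᶠ ε : ℝ in 𝓝[>] 0, ∀ j ∈ {j | |comovingCoord v₂ (X T - v₂ * T) (a j)| ≤ v₁ - v₂ ∧
        (a j).2 ≤ T + 1}, 0 < comovingCoord v₂ (X T - v₂ * T) (a j) →
          (v₁ - v₂) * ε < comovingCoord v₂ (X T - v₂ * T) (a j) := by
      refine (eventually_all_finite hfin).2 fun j _ => ?_
      by_cases hpos : 0 < comovingCoord v₂ (X T - v₂ * T) (a j)
      · filter_upwards [Ioo_mem_nhdsGT (div_pos hpos hw)] with ε hε _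
        have := (lt_div_iff₀ hw).1 hε.2
        linarith
      · exact Eventually.of_forall fun _ h => absurd h hpos
    obtain ⟨ε, hε, hε01⟩ := (hev.and (Ioo_mem_nhdsGT one_pos)).exists
    have hfree : ∀ s, T ≤ s → s < T + ε →
        ¬ FollowsSlowCar v₂ a ρ τ t₀ (affineContinuation X T v₁) s := by
      rintro s hTs hs ⟨j, u, hu, hus, hτ, hp⟩
      rcases le_or_gt u T with huT | huT
      · exact hf ⟨j, u, isLeast_meetingTimes_congr (hEq v₁).symm huT hu, huT,
          (ENNReal.ofReal_le_ofReal (by linarith)).trans_lt hτ, hu.1.2.1.1.trans huT,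
          hTs.trans_lt hp.2⟩
      · have hpos := hu.1.2.2
        rw [affineContinuation_of_ge huT.le] at hpos
        have e : comovingCoord v₂ (X T - v₂ * T) (a j) = (v₁ - v₂) * (u - T) := by
          unfold slowCarPosition at hpos
          unfold comovingCoord
          linarith
        have h1 : u - T < ε := by linarith
        have h2 : 0 < (v₁ - v₂) * (u - T) := mul_pos hw (sub_pos.2 huT)
        have h3 := hε j ⟨?_, ?_⟩ (e ▸ h2)
        · rw [e] at h3
          exact h1.not_gt (lt_of_mul_lt_mul_left h3 hw.le)
        · rw [e, abs_of_pos h2]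
          exact mul_le_of_le_one_right hw.le (h1.le.trans hε01.2.le)
        · linarith [hu.1.2.1.1, hε01.2]
    refine ⟨T + ε, by linarith [hε01.1], affineContinuation X T v₁,
      lipschitzWith_affineContinuation hX T
        (by rw [abs_of_pos (hv₂.trans hv)]; exact hK), hEq v₁, fun s hs => ?_⟩
    rcases lt_or_ge s T with hsT | hsT
    · exact hpast v₁ s ⟨hs.1, hsT⟩
    · exact ⟨fun h => absurd h (hfree s hsT hs.2),
        fun _ => hasDerivWithinAt_affineContinuation X v₁ hsT⟩

/-- Compatible partial trajectories have a common continuation. -/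
theorem exists_lipschitzWith_glue {K : ℝ≥0} {c : Set (ℝ × (ℝ → ℝ))}
    (hlip : ∀ p ∈ c, LipschitzWith K p.2)
    (hc : ∀ p ∈ c, ∀ q ∈ c, ∀ t, t₀ ≤ t → t ≤ p.1 → t ≤ q.1 → p.2 t = q.2 t) :
    ∃ X : ℝ → ℝ, LipschitzWith K X ∧ ∀ p ∈ c, EqOn p.2 X (Icc t₀ p.1) := by
  classical
  let f : ℝ → ℝ := fun t => if h : ∃ p ∈ c, t ≤ p.1 then h.choose.2 t else 0
  have hf : ∀ p ∈ c, ∀ t, t₀ ≤ t → t ≤ p.1 → f t = p.2 t := by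
    intro p hp t ht htp
    have h : ∃ p ∈ c, t ≤ p.1 := ⟨p, hp, htp⟩
    simp only [f, dif_pos h]
    exact hc _ h.choose_spec.1 p hp t ht h.choose_spec.2 htp
  have hlf : LipschitzOnWith K f {t | t₀ ≤ t ∧ ∃ p ∈ c, t ≤ p.1} := by
    refine LipschitzOnWith.of_dist_le_mul ?_
    rintro s ⟨hs, p, hp, hsp⟩ t ⟨ht, q, hq, htq⟩
    rcases le_total s t with hst | hst
    · rw [hf q hq s hs (hst.trans htq), hf q hq t ht htq]
      exact (hlip q hq).dist_le_mul s t
    · rw [hf p hp s hs hsp, hf p hp t ht (hst.trans hsp)]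
      exact (hlip p hp).dist_le_mul s t
  -- The Lipschitz extension supplies the value at the supremum of the end times, which need not
  -- belong to any member of the chain.
  obtain ⟨X, hX, hfX⟩ := hlf.extend_real
  exact ⟨X, hX, fun p hp t ht => (hf p hp t ht.1 ht.2).symm.trans (hfX ⟨ht.1, p, hp, ht.2⟩)⟩

/-- Zorn's lemma for partial trajectories with common Lipschitz constant `v₁`, ordered by
prolongation: a maximal one would have a finite end time and could still be prolonged. -/
theorem exists_isFastTrajectory (ha : LocallyFiniteEntrances a) (hv₂ : 0 < v₂) (hv : v₂ < v₁) :
    ∃ X : ℝ → ℝ, IsFastTrajectory v₁ v₂ a ρ τ x₀ t₀ X := by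
  by_contra hno
  have hv₁ := hv₂.trans hv
  have hglobal : ∀ (K : ℝ≥0) (X : ℝ → ℝ), X t₀ = x₀ → LipschitzWith K X →
      ¬ ∀ s, t₀ ≤ s → ObeysSpeed v₁ v₂ a ρ τ t₀ X s := fun K X h0 hl hr =>
    hno ⟨X, h0, hl.continuous.continuousOn, fun s hs => (hr s hs).1, fun s hs => (hr s hs).2⟩
  let K : ℝ≥0 := ⟨v₁, hv₁.le⟩
  let Good : Set (ℝ × (ℝ → ℝ)) := {p | t₀ ≤ p.1 ∧ p.2 t₀ = x₀ ∧ LipschitzWith K p.2 ∧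
    ∀ s ∈ Ico t₀ p.1, ObeysSpeed v₁ v₂ a ρ τ t₀ p.2 s}
  let r : Good → Good → Prop := fun p q => p.1.1 ≤ q.1.1 ∧ EqOn p.1.2 q.1.2 (Icc t₀ p.1.1)
  obtain ⟨m, hm⟩ : ∃ m : Good, ∀ q, r m q → r q m := by
    refine exists_maximal_of_chains_bounded (fun c hc => ?_) fun {p q s} h1 h2 =>
      ⟨h1.1.trans h2.1, fun t ht => (h1.2 ht).trans (h2.2 ⟨ht.1, ht.2.trans h1.1⟩)⟩
    rcases c.eq_empty_or_nonempty with rfl | ⟨p₀, hp₀⟩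
    · refine ⟨⟨(t₀, fun _ => x₀), le_rfl, rfl, LipschitzWith.const' x₀, fun s hs => ?_⟩,
        fun q hq => absurd hq (notMem_empty q)⟩
      exact absurd hs.2 hs.1.not_gt
    obtain ⟨X, hXl, hX⟩ := exists_lipschitzWith_glue (t₀ := t₀) (K := K)
      (c := Subtype.val '' c) (by rintro _ ⟨p, -, rfl⟩; exact p.2.2.2.1) (by
        rintro _ ⟨p, hp, rfl⟩ _ ⟨q, hq, rfl⟩ t ht htp htq
        by_cases hpq : p = q
        · rw [hpq]
        rcases hc hp hq hpq with h | h
        · exact h.2 ⟨ht, htp⟩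
        · exact (h.2 ⟨ht, htq⟩).symm)
    have hX' : ∀ p ∈ c, EqOn p.1.2 X (Icc t₀ p.1.1) := fun p hp => hX _ ⟨p, hp, rfl⟩
    have hobey : ∀ p ∈ c, ∀ s ∈ Ico t₀ p.1.1, ObeysSpeed v₁ v₂ a ρ τ t₀ X s := fun p hp s hs =>
      (p.2.2.2.2 s hs).congr (hX' p hp) hs
    have hXt₀ : X t₀ = x₀ := by
      rw [← hX' p₀ hp₀ ⟨le_rfl, p₀.2.1⟩]
      exact p₀.2.2.1
    by_cases hbdd : BddAbove ((fun p : Good => p.1.1) '' c)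
    · refine ⟨⟨(sSup ((fun p : Good => p.1.1) '' c), X), ?_, hXt₀, hXl, fun s hs => ?_⟩,
        fun p hp => ⟨le_csSup hbdd ⟨p, hp, rfl⟩, hX' p hp⟩⟩
      · exact p₀.2.1.trans (le_csSup hbdd ⟨p₀, hp₀, rfl⟩)
      · obtain ⟨_, ⟨p, hp, rfl⟩, hsp⟩ := exists_lt_of_lt_csSup (Nonempty.image _ ⟨p₀, hp₀⟩) hs.2
        exact hobey p hp s ⟨hs.1, hsp⟩
    -- A chain with unbounded end times glues to a global trajectory, contrary to the assumption
    -- that none exists.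
    · refine absurd (fun s hs => ?_) (hglobal K X hXt₀ hXl)
      obtain ⟨_, ⟨p, hp, rfl⟩, hsp⟩ := not_bddAbove_iff.1 hbdd s
      exact hobey p hp s ⟨hs, hsp⟩
  obtain ⟨⟨T, X⟩, hT, h0, hl, hr⟩ := m
  obtain ⟨T', hTT', X', hl', hE, hr'⟩ := exists_obeysSpeed_extension ha hv₂ hv (K := K) le_rfl hl hr
  have := hm ⟨(T', X'), hT.trans hTT'.le, (hE ⟨le_rfl, hT⟩).symm.trans h0, hl', hr'⟩ ⟨hTT'.le, hE⟩
  exact hTT'.not_ge this.1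

end Existence

/-! ### Almost sure properties of the entrance field -/

theorem poissonMeasure_two_le (r : ℝ≥0) : poissonMeasure r {n | 2 ≤ n} ≤ (r : ℝ≥0∞) ^ 2 := by
  have hS : {n : ℕ | 2 ≤ n} = ({0} ∪ {1})ᶜ := by
    ext n
    simp only [mem_ofPred_eq, mem_compl_iff, mem_union, mem_singleton_iff]
    omega
  have h1 : (poissonMeasure r).real {n | 2 ≤ n} ≤ (r : ℝ) ^ 2 := by
    rw [hS, probReal_compl_eq_one_sub (by measurability), measureReal_union (by simp) (by simp),
      poissonMeasure_real_singleton, poissonMeasure_real_singleton]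
    have := Real.add_one_le_exp (-(r : ℝ))
    have hr : (0 : ℝ) ≤ r := r.2
    simp only [pow_zero, Nat.factorial_zero, Nat.factorial_one, pow_one, Nat.cast_one]
    nlinarith
  rw [← ENNReal.ofReal_toReal (measure_ne_top (poissonMeasure r) {n | 2 ≤ n}),
    ← ENNReal.ofReal_coe_nnreal, ← ENNReal.ofReal_pow r.coe_nonneg]
  exact ENNReal.ofReal_le_ofReal h1

section Field

variable {Ω : Type*} [MeasurableSpace Ω] {P : Measure Ω} [IsProbabilityMeasure P]

theorem IsPoissonField.measure_two_le_pointCount {E : Type*} [MeasurableSpace E]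
    {p : ℕ → Ω → E} {ν : Measure E} (h : IsPoissonField p ν P) {B : Set E} (hB : MeasurableSet B)
    (hν : ν B ≠ ∞) : P {ω | 2 ≤ pointCount (fun j => p j ω) B} ≤ ν B ^ 2 := by
  have hm : MeasurableSet {x : ℝ≥0∞ | 2 ≤ x} := measurableSet_Ici
  have h1 := h.lintegral_comp_count hB hν
    (f := {x : ℝ≥0∞ | 2 ≤ x}.indicator fun _ => 1) (measurable_const.indicator hm)
  have e1 : ∀ ω, {x : ℝ≥0∞ | 2 ≤ x}.indicator (fun _ => (1 : ℝ≥0∞))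
      (pointCount (fun j => p j ω) B)
      = {ω | 2 ≤ pointCount (fun j => p j ω) B}.indicator (fun _ => 1) ω := fun _ => rfl
  have e2 : ∀ n : ℕ, {x : ℝ≥0∞ | 2 ≤ x}.indicator (fun _ => (1 : ℝ≥0∞)) (n : ℝ≥0∞)
      = {n : ℕ | 2 ≤ n}.indicator (fun _ => 1) n := fun n => by
    simp only [indicator, mem_ofPred_eq]
    congr 1
    simp
  simp_rw [e1, e2] at h1
  have hm2 : MeasurableSet {ω | 2 ≤ pointCount (fun j => p j ω) B} :=
    measurable_pointCount h.measurable hB hm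
  rw [lintegral_indicator_const hm2, one_mul,
    lintegral_indicator_const (MeasurableSet.of_discrete), one_mul] at h1
  rw [h1]
  refine (poissonMeasure_two_le _).trans_eq ?_
  rw [ENNReal.coe_toNNReal hν]

variable {a : ℕ → Ω → ℝ × ℝ} {lam : ℝ}

theorem spaceTimeIntensity_comovingCoord_mem (lam v₂ y₀ : ℝ) {A B : Set ℝ} (hA : MeasurableSet A)
    (hB : MeasurableSet B) :
    spaceTimeIntensity lam {b | comovingCoord v₂ y₀ b ∈ A ∧ b.2 ∈ B}
      = ENNReal.ofReal lam * (volume (B ∩ Ioi 0) * volume A) := by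
  have hm : MeasurableSet {b : ℝ × ℝ | b.1 ∈ A ∧ b.2 ∈ B} := hA.prod hB
  have h := lintegral_comovingCoord lam v₂ y₀
    (f := {b : ℝ × ℝ | b.1 ∈ A ∧ b.2 ∈ B}.indicator fun _ => 1) (measurable_const.indicator hm)
  have hm' : MeasurableSet {b | comovingCoord v₂ y₀ b ∈ A ∧ b.2 ∈ B} :=
    (measurable_comovingCoord v₂ y₀ hA).inter (measurable_snd hB)
  rw [← lintegral_indicator_one hm']
  refine Eq.trans (lintegral_congr fun b => rfl) (h.trans ?_)
  congr 1
  have e : ∀ t, ∫⁻ y, {b : ℝ × ℝ | b.1 ∈ A ∧ b.2 ∈ B}.indicator (fun _ => (1 : ℝ≥0∞)) (y, t)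
      = B.indicator (fun _ => volume A) t := by
    intro t
    by_cases ht : t ∈ B
    · rw [indicator_of_mem ht, ← lintegral_indicator_one hA]
      refine lintegral_congr fun y => ?_
      by_cases hy : y ∈ A <;> simp [ht, hy]
    · rw [indicator_of_notMem ht]
      simp [indicator, ht]
  simp_rw [e]
  rw [lintegral_indicator_const hB, Measure.restrict_apply hB, mul_comm]

theorem ae_locallyFiniteEntrances (ha : IsPoissonField a (spaceTimeIntensity lam) P) :
    ∀ᵐ ω ∂P, LocallyFiniteEntrances fun j => a j ω := by
  -- With both parameters `0` the comoving coordinate is the plain position.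
  have h1 : ∀ᵐ ω ∂P, ∀ j, a j ω ∉ {b : ℝ × ℝ | comovingCoord 0 0 b ∈ univ ∧ b.2 ∈ Iio 0} := by
    refine ha.ae_notMem ((measurable_comovingCoord 0 0 MeasurableSet.univ).inter
      (measurable_snd measurableSet_Iio)) ?_
    rw [spaceTimeIntensity_comovingCoord_mem _ _ _ MeasurableSet.univ measurableSet_Iio,
      Iio_inter_Ioi, Ioo_self]
    simp
  have h2 : ∀ᵐ ω ∂P, ∀ R : ℕ, {j | a j ω ∈
      {b : ℝ × ℝ | comovingCoord 0 0 b ∈ Icc (-(R : ℝ)) R ∧ b.2 ∈ Iic (R : ℝ)}}.Finite := by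
    rw [ae_all_iff]
    intro R
    refine ha.ae_finite ((measurable_comovingCoord 0 0 measurableSet_Icc).inter
      (measurable_snd measurableSet_Iic)) ?_
    rw [spaceTimeIntensity_comovingCoord_mem _ _ _ measurableSet_Icc measurableSet_Iic,
      Iic_inter_Ioi, Real.volume_Ioc, Real.volume_Icc]
    exact ENNReal.mul_ne_top ENNReal.ofReal_ne_top
      (ENNReal.mul_ne_top ENNReal.ofReal_ne_top ENNReal.ofReal_ne_top)
  filter_upwards [h1, h2] with ω hω1 hω2
  refine ⟨fun j => ?_, fun R => (hω2 R).subset fun j hj => ?_⟩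
  · by_contra! hlt
    exact hω1 j ⟨mem_univ _, hlt⟩
  · refine ⟨?_, hj.2⟩
    simpa [comovingCoord] using abs_le.1 hj.1

theorem ae_comovingCoord_ne_zero (ha : IsPoissonField a (spaceTimeIntensity lam) P)
    (v₂ y₀ : ℝ) : ∀ᵐ ω ∂P, ∀ j, comovingCoord v₂ y₀ (a j ω) ≠ 0 := by
  have h1 : ∀ᵐ ω ∂P, ∀ j, a j ω ∉
      {b : ℝ × ℝ | comovingCoord v₂ y₀ b ∈ ({0} : Set ℝ) ∧ b.2 ∈ univ} := by
    refine ha.ae_notMem ((measurable_comovingCoord v₂ y₀ (measurableSet_singleton 0)).inter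
      (measurable_snd MeasurableSet.univ)) ?_
    rw [spaceTimeIntensity_comovingCoord_mem _ _ _ (measurableSet_singleton 0) MeasurableSet.univ]
    simp
  filter_upwards [h1] with ω hω j hj using hω j ⟨hj, mem_univ _⟩

theorem two_le_pointCount {E : Type*} {q : ℕ → E} {B : Set E} {j k : ℕ} (hjk : j ≠ k)
    (hj : q j ∈ B) (hk : q k ∈ B) : 2 ≤ pointCount q B := by
  have := ENNReal.sum_le_tsum (f := fun j => B.indicator (fun _ => (1 : ℝ≥0∞)) (q j)) {j, k}
  rw [Finset.sum_pair hjk, indicator_of_mem hj, indicator_of_mem hk, one_add_one_eq_two] at this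
  exact this

/-- In a bounded window, `2 R M` cells of width `1 / M` each contain two points with probability at
most `(lam R / M)²`. The sum is of order `1 / M`, and a coincidence would put two points into one
cell for every `M`. -/
theorem ae_injective_comovingCoord (ha : IsPoissonField a (spaceTimeIntensity lam) P)
    (v₂ y₀ : ℝ) :
    ∀ᵐ ω ∂P, Function.Injective fun j => comovingCoord v₂ y₀ (a j ω) := by
  have key : ∀ R : ℕ, ∀ᵐ ω ∂P, ∀ j k, j ≠ k → comovingCoord v₂ y₀ (a j ω) ∈ Ico (-(R : ℝ)) R →
      (a j ω).2 ≤ R → (a k ω).2 ≤ R →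
      comovingCoord v₂ y₀ (a j ω) ≠ comovingCoord v₂ y₀ (a k ω) := by
    intro R
    set S := {ω | ¬ ∀ j k, j ≠ k → comovingCoord v₂ y₀ (a j ω) ∈ Ico (-(R : ℝ)) R →
      (a j ω).2 ≤ R → (a k ω).2 ≤ R →
      comovingCoord v₂ y₀ (a j ω) ≠ comovingCoord v₂ y₀ (a k ω)} with hS
    change P S = 0
    have hbound : ∀ M : ℕ, 0 < M → P S ≤
        ENNReal.ofReal (2 * R * (lam * R) ^ 2 * (1 / (M : ℝ))) := by
      intro M hM
      have hM' : (0 : ℝ) < M := by exact_mod_cast hM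
      let B : ℤ → Set (ℝ × ℝ) := fun i =>
        {b | comovingCoord v₂ y₀ b ∈ Ico ((i : ℝ) / M) ((i + 1) / M) ∧ b.2 ∈ Iic (R : ℝ)}
      have hBm : ∀ i, MeasurableSet (B i) := fun i =>
        (measurable_comovingCoord v₂ y₀ measurableSet_Ico).inter (measurable_snd measurableSet_Iic)
      have hνB : ∀ i, spaceTimeIntensity lam (B i)
          = ENNReal.ofReal lam * (ENNReal.ofReal R * ENNReal.ofReal (1 / M)) := by
        intro i
        rw [spaceTimeIntensity_comovingCoord_mem _ _ _ measurableSet_Ico measurableSet_Iic,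
          Iic_inter_Ioi, Real.volume_Ioc, Real.volume_Ico]
        congr 3
        · ring
        · ring
      have hsub : S ⊆ ⋃ i ∈ Finset.Ico (-((R : ℤ) * M)) (R * M),
          {ω | 2 ≤ pointCount (fun j => a j ω) (B i)} := by
        intro ω hω
        rw [hS, mem_ofPred_eq] at hω
        push Not at hω
        obtain ⟨j, k, hjk, hy, hj, hk, e⟩ := hω
        have hmem : ∀ l, comovingCoord v₂ y₀ (a l ω) = comovingCoord v₂ y₀ (a j ω) →
            (a l ω).2 ≤ R → a l ω ∈ B ⌊comovingCoord v₂ y₀ (a j ω) * M⌋ := by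
          intro l hl hl2
          refine ⟨⟨?_, ?_⟩, hl2⟩
          · rw [hl, div_le_iff₀ hM']
            exact Int.floor_le _
          · rw [hl, lt_div_iff₀ hM']
            exact Int.lt_floor_add_one _
        refine mem_iUnion₂.2 ⟨⌊comovingCoord v₂ y₀ (a j ω) * M⌋, ?_,
          two_le_pointCount hjk (hmem j rfl hj) (hmem k e.symm hk)⟩
        rw [Finset.mem_Ico, Int.le_floor, Int.floor_lt]
        push_cast
        constructor
        · rw [← neg_mul]
          exact mul_le_mul_of_nonneg_right hy.1 hM'.le
        · exact mul_lt_mul_of_pos_right hy.2 hM'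
      calc P S ≤ ∑ i ∈ Finset.Ico (-((R : ℤ) * M)) (R * M),
            P {ω | 2 ≤ pointCount (fun j => a j ω) (B i)} :=
            (measure_mono hsub).trans (measure_biUnion_finset_le _ _)
        _ ≤ ∑ i ∈ Finset.Ico (-((R : ℤ) * M)) (R * M),
            (ENNReal.ofReal lam * (ENNReal.ofReal R * ENNReal.ofReal (1 / M))) ^ 2 := by
            refine Finset.sum_le_sum fun i _ => ?_
            rw [← hνB i]
            refine ha.measure_two_le_pointCount (hBm i) ?_
            rw [hνB i]
            exact ENNReal.mul_ne_top ENNReal.ofReal_ne_top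
              (ENNReal.mul_ne_top ENNReal.ofReal_ne_top ENNReal.ofReal_ne_top)
        _ ≤ ENNReal.ofReal (2 * R * (lam * R) ^ 2 * (1 / (M : ℝ))) := by
            rw [Finset.sum_const, Int.card_Ico, nsmul_eq_mul,
              show ((R : ℤ) * M - -((R : ℤ) * M)).toNat = 2 * R * M by
                rw [show (R : ℤ) * M - -((R : ℤ) * M) = ((2 * R * M : ℕ) : ℤ) by push_cast; ring,
                  Int.toNat_natCast], ← ENNReal.ofReal_natCast]
            rcases le_or_gt lam 0 with hl | hl
            · rw [ENNReal.ofReal_of_nonpos hl]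
              simp
            rw [← ENNReal.ofReal_mul (by positivity), ← ENNReal.ofReal_mul hl.le,
              ← ENNReal.ofReal_pow (by positivity), ← ENNReal.ofReal_mul (by positivity)]
            refine ENNReal.ofReal_le_ofReal (le_of_eq ?_)
            push_cast
            field_simp
    have hlim : Tendsto (fun M : ℕ => ENNReal.ofReal (2 * R * (lam * R) ^ 2 * (1 / (M : ℝ))))
        atTop (𝓝 (ENNReal.ofReal (2 * R * (lam * R) ^ 2 * 0))) :=
      ENNReal.tendsto_ofReal (tendsto_one_div_atTop_nhds_zero_nat.const_mul _)
    rw [mul_zero, ENNReal.ofReal_zero] at hlim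
    refine le_antisymm (ge_of_tendsto hlim ?_) (zero_le)
    filter_upwards [eventually_gt_atTop 0] with M hM using hbound M hM
  filter_upwards [ae_all_iff.2 key] with ω hω
  intro j k e
  by_contra hjk
  obtain ⟨R, hR⟩ := exists_nat_gt
    (max |comovingCoord v₂ y₀ (a j ω)| (max (a j ω).2 (a k ω).2))
  rw [max_lt_iff, max_lt_iff, abs_lt] at hR
  exact hω R j k hjk ⟨hR.1.1.le, hR.1.2⟩ hR.2.1.le hR.2.2.le e

end Field

/-! ### The folded marked field -/

section Marked

variable {Ω : Type*} [MeasurableSpace Ω] {P : Measure Ω} [IsProbabilityMeasure P]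
  {lam v₂ : ℝ} {G : Measure ℝ} [IsProbabilityMeasure G] {F : Measure ℝ≥0∞} [IsProbabilityMeasure F]
  {a : ℕ → Ω → ℝ × ℝ} {ρ : ℕ → Ω → ℝ}

theorem measurable_foldedCar (v₂ κ y₀ : ℝ) :
    Measurable fun q : (ℝ × ℝ) × ℝ × ℝ≥0∞ => foldedCar v₂ κ y₀ q.1 q.2.1 q.2.2 := by
  unfold foldedCar
  exact ((measurable_foldedPoint v₂ κ y₀).comp measurable_fst).prodMk
    (measurable_snd.fst.prodMk (measurable_snd.snd.const_mul _))

theorem carIntensity_apply (hlam : 0 < lam) (hv₂ : 0 < v₂) (κ y₀ : ℝ) {A : Set MarkedCar}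
    (hA : MeasurableSet A) :
    carIntensity (lam / v₂) G (F.map fun t => ENNReal.ofReal v₂ * t) A
      = ∫⁻ x, ∫⁻ r, F {t | foldedCar v₂ κ y₀ x r t ∈ A} ∂G ∂(spaceTimeIntensity lam) := by
  have hmul : Measurable fun t : ℝ≥0∞ => ENNReal.ofReal v₂ * t := by fun_prop
  have hFp : IsProbabilityMeasure (F.map fun t => ENNReal.ofReal v₂ * t) :=
    Measure.isProbabilityMeasure_map hmul.aemeasurable
  rw [carIntensity, ← map_foldedPoint (κ := κ) (y₀ := y₀) hlam hv₂, Measure.prod_apply hA,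
    lintegral_map (measurable_measure_prodMk_left hA) (measurable_foldedPoint v₂ κ y₀)]
  refine lintegral_congr fun x => ?_
  have hA1 : MeasurableSet (Prod.mk (foldedPoint v₂ κ y₀ x) ⁻¹' A) := measurable_prodMk_left hA
  rw [Measure.prod_apply hA1]
  refine lintegral_congr fun r => ?_
  rw [Measure.map_apply hmul (measurable_prodMk_left hA1)]
  rfl

/-- Folding is a measurable map of the marked points, so the avoidance function is that of the
original marked field at the preimage. -/
theorem hasPoissonAvoidance_foldedCar (hlam : 0 < lam) (hv₂ : 0 < v₂)
    (ha : IsPoissonField a (spaceTimeIntensity lam) P)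
    (hρ : ∀ j, Measurable (ρ j)) (hρl : ∀ j, P.map (ρ j) = G) (hρi : iIndepFun ρ P)
    {τ : ℕ → Ω → ℝ≥0∞} (hτ : ∀ j, Measurable (τ j)) (hτl : ∀ j, P.map (τ j) = F)
    (hτi : iIndepFun τ P)
    (h₁ : IndepFun (fun ω j => a j ω) (fun ω j => ρ j ω) P)
    (h₂ : IndepFun (fun ω => ((fun j => a j ω), (fun j => ρ j ω))) (fun ω j => τ j ω) P)
    (κ y₀ : ℝ) :
    HasPoissonAvoidance (fun j ω => foldedCar v₂ κ y₀ (a j ω) (ρ j ω) (τ j ω))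
      (carIntensity (lam / v₂) G (F.map fun t => ENNReal.ofReal v₂ * t)) P := by
  refine ⟨fun j => (measurable_foldedCar v₂ κ y₀).comp
    ((ha.measurable j).prodMk ((hρ j).prodMk (hτ j))), fun A hA hfin => ?_⟩
  rw [carIntensity_apply hlam hv₂ κ y₀ hA] at hfin ⊢
  exact ha.measure_forall_marked_notMem hρ hρl hρi hτ hτl hτi h₁ h₂
    (A := (fun q : (ℝ × ℝ) × ℝ × ℝ≥0∞ => foldedCar v₂ κ y₀ q.1 q.2.1 q.2.2) ⁻¹' A)
    (measurable_foldedCar v₂ κ y₀ hA) hfin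

/-- Only finitely many reflected slow cars outlast a given non-negative time. -/
theorem ae_exists_forall_reflected_le (hv₂ : 0 < v₂) {κ : ℝ} (hκ : 0 < κ) (y₀ : ℝ) {s₀ : ℝ}
    (hs₀ : 0 ≤ s₀) (hG : Integrable (fun r : ℝ => r ^ 2) G)
    (ha : IsPoissonField a (spaceTimeIntensity lam) P)
    (hρ : ∀ j, Measurable (ρ j)) (hρl : ∀ j, P.map (ρ j) = G)
    (h₁ : IndepFun (fun ω j => a j ω) (fun ω j => ρ j ω) P) :
    ∀ᵐ ω ∂P, ∃ K : ℕ, ∀ j, comovingCoord v₂ y₀ (a j ω) ≤ 0 →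
      (K : ℝ) < (foldedPoint v₂ κ y₀ (a j ω)).1 →
      (foldedPoint v₂ κ y₀ (a j ω)).2 + ρ j ω ≤ s₀ := by
  have hm := measurable_comovingCoord v₂ y₀
  -- Since `s₀ ≥ 0`, a reflected car outlasts `s₀` only if its route is longer than `v₂ t + κ |y|`.
  -- The expected number of such cars is a double integral of the tail of `G`.
  have hA : MeasurableSet {q : (ℝ × ℝ) × ℝ | comovingCoord v₂ y₀ q.1 ≤ 0 ∧
      v₂ * q.1.2 + κ * -comovingCoord v₂ y₀ q.1 < q.2} :=
    (measurableSet_le (hm.comp measurable_fst) measurable_const).inter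
      (measurableSet_lt (by fun_prop) measurable_snd)
  have hB : MeasurableSet {q : (ℝ × ℝ) × ℝ | q.1.1 ≤ 0 ∧ v₂ * q.1.2 + κ * -q.1.1 < q.2} :=
    (measurableSet_le (f := fun q : (ℝ × ℝ) × ℝ => q.1.1) (by fun_prop) measurable_const).inter
      (measurableSet_lt (f := fun q : (ℝ × ℝ) × ℝ => v₂ * q.1.2 + κ * -q.1.1) (by fun_prop)
        measurable_snd)
  have hfin : ∫⁻ x, G {r | (x, r) ∈ {q : (ℝ × ℝ) × ℝ | comovingCoord v₂ y₀ q.1 ≤ 0 ∧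
      v₂ * q.1.2 + κ * -comovingCoord v₂ y₀ q.1 < q.2}} ∂(spaceTimeIntensity lam) ≠ ∞ := by
    have h := lintegral_comovingCoord lam v₂ y₀
      (f := fun b => G {r | (b, r) ∈ {q : (ℝ × ℝ) × ℝ | q.1.1 ≤ 0 ∧
        v₂ * q.1.2 + κ * -q.1.1 < q.2}}) (measurable_measure_prodMk_left hB)
    refine ne_of_eq_of_ne h (ENNReal.mul_ne_top ENNReal.ofReal_ne_top ?_)
    refine ne_of_eq_of_ne (setLIntegral_congr_fun measurableSet_Ioi fun t _ => ?_)
      (lintegral_tail_prod_ne_top hv₂ hκ hG)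
    have hgm : Measurable fun y => G (Ioi (v₂ * t + κ * -y)) :=
      Measurable.comp (g := fun x => G (Ioi x))
        (Antitone.measurable fun x y hxy => measure_mono (Ioi_subset_Ioi hxy)) (by fun_prop)
    have e : ∀ y, G {r | ((y, t), r) ∈ {q : (ℝ × ℝ) × ℝ | q.1.1 ≤ 0 ∧
        v₂ * q.1.2 + κ * -q.1.1 < q.2}}
        = (Iic (0 : ℝ)).indicator (fun y => G (Ioi (v₂ * t + κ * -y))) y := by
      intro y
      by_cases hy : y ≤ 0
      · rw [indicator_of_mem (mem_Iic.2 hy)]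
        congr 1
        ext r
        simp [hy]
      · rw [indicator_of_notMem (by simpa using hy)]
        simp [hy]
    simp_rw [e]
    rw [lintegral_indicator measurableSet_Iic, setLIntegral_Iic_eq_neg hgm]
    simp_rw [neg_neg]
  filter_upwards [ha.ae_finite_marked hρ hρl h₁ hA hfin] with ω hω
  obtain ⟨M, hM⟩ := (hω.image fun j => -comovingCoord v₂ y₀ (a j ω)).bddAbove
  obtain ⟨K, hK⟩ := exists_nat_ge M
  refine ⟨K, fun j hj hKj => ?_⟩
  rw [foldedPoint, if_neg hj.not_gt] at hKj ⊢
  by_contra! hlt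
  dsimp only at hKj hlt
  have := hM ⟨j, ⟨hj, by linarith⟩, rfl⟩
  dsimp only at this
  linarith

end Marked

/-! ### Conclusion -/

theorem meanFollowingConst_nonneg (v₂ : ℝ) (F : Measure ℝ≥0∞) (G : Measure ℝ) :
    0 ≤ meanFollowingConst v₂ F G :=
  integral_nonneg fun _ => ENNReal.toReal_nonneg

theorem tendsto_const_add_div_natCast {u : ℕ → ℝ} {R : ℝ} (s : ℝ)
    (hu : Tendsto (fun n : ℕ => u n / n) atTop (𝓝 R)) :
    Tendsto (fun n : ℕ => (s + u n) / n) atTop (𝓝 R) := by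
  have := (tendsto_const_div_atTop_nhds_zero_nat s).add hu
  simpa [add_div] using this

theorem mainTheorem2 {Ω : Type*} [MeasurableSpace Ω] (P : Measure Ω) [IsProbabilityMeasure P]
    {ι : Type*} (v₁ v₂ lam : ℝ) (hv₂ : 0 < v₂) (hv : v₂ < v₁) (hlam : 0 < lam)
    (F : Measure ℝ≥0∞) [IsProbabilityMeasure F]
    (G : Measure ℝ) [IsProbabilityMeasure G]
    (hG_nonneg : ∀ᵐ r ∂G, 0 ≤ r) (hG_mean : 0 < ∫ r, r ∂G)
    (hG_sq : Integrable (fun r : ℝ => r ^ 2) G)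
    -- slow cars: entrance points and times, and lengths of the routes
    (a : ℕ → Ω → ℝ × ℝ) (ha : IsPoissonField a (spaceTimeIntensity lam) P)
    (ρ : ℕ → Ω → ℝ) (hρ_meas : ∀ j, Measurable (ρ j)) (hρ_law : ∀ j, P.map (ρ j) = G)
    (hρ_indep : iIndepFun ρ P)
    -- overtaking time of slow car `j` by fast car `i`
    (τ : ι → ℕ → Ω → ℝ≥0∞) (hτ_meas : ∀ i j, Measurable (τ i j))
    (hτ_law : ∀ i j, P.map (τ i j) = F)
    (hτ_indep : iIndepFun (fun (q : ι × ℕ) => τ q.1 q.2) P)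
    -- the entrance field, the route lengths and the overtaking times are independent
    (h_indep₁ : IndepFun (fun ω j => a j ω) (fun ω j => ρ j ω) P)
    (h_indep₂ : IndepFun (fun ω => ((fun j => a j ω), (fun j => ρ j ω)))
      (fun ω i j => τ i j ω) P)
    -- entrance points and times of the fast cars
    (x₀ t₀ : ι → ℝ) (ht₀ : ∀ i, 0 ≤ t₀ i)
    (d c : ℝ) (hd : d = lam * (∫ r, r ∂G) * (v₂⁻¹ - v₁⁻¹))
    (hc : c = meanFollowingConst v₂ F G) (i : ι) :
    ∀ᵐ ω ∂P,
      (∃ X : ℝ → ℝ, IsFastTrajectory v₁ v₂ (fun j => a j ω) (fun j => ρ j ω)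
        (fun j => τ i j ω) (x₀ i) (t₀ i) X) ∧
      ∀ X : ℝ → ℝ, IsFastTrajectory v₁ v₂ (fun j => a j ω) (fun j => ρ j ω)
        (fun j => τ i j ω) (x₀ i) (t₀ i) X →
        Tendsto (fun x : ℝ => x / travelTime (t₀ i) X x) atTop
          (𝓝 ((1 + d * c) / (1 + d * c * v₁ * v₂⁻¹) * v₁)) := by
  have hv₁ : 0 < v₁ := hv₂.trans hv
  have hw : 0 < v₁ - v₂ := sub_pos.2 hv
  have hτi : iIndepFun (fun j => τ i j) P :=
    hτ_indep.precomp (g := fun j => (i, j)) (Prod.mk_right_injective i)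
  have h₂ : IndepFun (fun ω => ((fun j => a j ω), (fun j => ρ j ω))) (fun ω j => τ i j ω) P :=
    h_indep₂.comp measurable_id (measurable_pi_apply i)
  set y₀ := x₀ i - v₂ * t₀ i with hy₀
  set s₀ := v₂ * t₀ i with hs₀
  have hs₀' : 0 ≤ s₀ := mul_nonneg hv₂.le (ht₀ i)
  set κ := v₂ / (v₁ - v₂) with hκ
  have hκ0 : 0 < κ := div_pos hv₂ hw
  have hlam' : 0 ≤ lam / v₂ := (div_pos hlam hv₂).le
  have hFp : IsProbabilityMeasure (F.map fun t => ENNReal.ofReal v₂ * t) :=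
    Measure.isProbabilityMeasure_map (by fun_prop)
  let z : ℝ → ℕ → Ω → MarkedCar := fun κ j ω => foldedCar v₂ κ y₀ (a j ω) (ρ j ω) (τ i j ω)
  have hz : ∀ κ, HasPoissonAvoidance (z κ)
      (carIntensity (lam / v₂) G (F.map fun t => ENNReal.ofReal v₂ * t)) P := fun κ =>
    hasPoissonAvoidance_foldedCar hlam hv₂ ha hρ_meas hρ_law hρ_indep (hτ_meas i) (hτ_law i) hτi
      h_indep₁ h₂ κ y₀
  set R := lam / v₂ * (∫⁻ r in Ioi 0, delayTail (F.map fun t => ENNReal.ofReal v₂ * t) G r).toReal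
    with hR
  have hR0 : 0 ≤ R := mul_nonneg hlam' ENNReal.toReal_nonneg
  have hRc : R = lam / v₂ * ((∫ r, r ∂G) * c) := by rw [hR, toReal_lintegral_delayTail hG_mean, hc]
  -- With clock rate `κ + R` per unit of advance the mean speed is `v₂ + v₂ / (κ + R)`; this is the
  -- stated form of it.
  have hval : v₂ + v₂ / (κ + R) = (1 + d * c) / (1 + d * c * v₁ * v₂⁻¹) * v₁ := by
    have hc0 : 0 ≤ c := hc ▸ meanFollowingConst_nonneg v₂ F G
    set μ := (∫ r, r ∂G) * c with hμ
    have hμ0 : 0 ≤ μ := mul_nonneg hG_mean.le hc0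
    have hdc : d * c = lam * μ * ((v₁ - v₂) / (v₁ * v₂)) := by
      rw [hd, hμ]
      field_simp
    rw [hdc, hRc, hκ]
    have h1 : 0 < v₂ ^ 2 + lam * μ * (v₁ - v₂) := by positivity
    have e1 : v₂ / (v₁ - v₂) + lam / v₂ * μ
        = (v₂ ^ 2 + lam * μ * (v₁ - v₂)) / (v₂ * (v₁ - v₂)) := by
      field_simp
    have e2 : 1 + lam * μ * ((v₁ - v₂) / (v₁ * v₂)) * v₁ * v₂⁻¹
        = (v₂ ^ 2 + lam * μ * (v₁ - v₂)) / v₂ ^ 2 := by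
      field_simp
    rw [e1, e2]
    field_simp
    ring
  -- The folded field changes with `κ`, so a countable sequence decreasing to the critical value
  -- keeps the exceptional set null.
  have hup : ∀ᵐ ω ∂P, ∀ k : ℕ, FiniteDelays (fun j => z (κ + 1 / (k + 1)) j ω) ∧
      (∀ n m, delayScheme (fun j => z (κ + 1 / (k + 1)) j ω) 0 m s₀ (n * 2 ^ m)
        ≤ s₀ + (limitDelay (z (κ + 1 / (k + 1))) 0 s₀ n ω).toReal) ∧
      Tendsto (fun n : ℕ => (s₀ + (limitDelay (z (κ + 1 / (k + 1))) 0 s₀ n ω).toReal) / n) atTop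
        (𝓝 R) := by
    rw [ae_all_iff]
    intro k
    filter_upwards [(hz (κ + 1 / (k + 1))).ae_finiteDelays hlam' hG_sq,
      ae_tendsto_delayScheme (hz (κ + 1 / (k + 1))) hlam' hG_sq 0 s₀,
      ae_tendsto_limitDelay_div (hz (κ + 1 / (k + 1))) hlam' hG_sq 0 s₀] with ω h1 h2 h3
    exact ⟨h1, fun n => (h2 n).1, tendsto_const_add_div_natCast s₀ h3⟩
  -- All starting points `K` are treated at once, because the one used depends on `ω`.
  have hlow : ∀ᵐ ω ∂P, ∀ K : ℕ,
      (∀ n, Tendsto (fun m => delayScheme (fun j => z κ j ω) K m s₀ (n * 2 ^ m)) atTop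
        (𝓝 (s₀ + (limitDelay (z κ) K s₀ n ω).toReal))) ∧
      Tendsto (fun n : ℕ => (s₀ + (limitDelay (z κ) K s₀ n ω).toReal) / n) atTop (𝓝 R) := by
    rw [ae_all_iff]
    intro K
    filter_upwards [ae_tendsto_delayScheme (hz κ) hlam' hG_sq K s₀,
      ae_tendsto_limitDelay_div (hz κ) hlam' hG_sq K s₀] with ω h2 h3
    exact ⟨fun n => (h2 n).2, tendsto_const_add_div_natCast s₀ h3⟩
  filter_upwards [ae_locallyFiniteEntrances ha, ae_comovingCoord_ne_zero ha v₂ y₀,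
    ae_injective_comovingCoord ha v₂ y₀, hup, hlow,
    ae_exists_forall_reflected_le hv₂ hκ0 y₀ hs₀' hG_sq ha hρ_meas hρ_law h_indep₁]
    with ω hloc hne hinj hupω hlowω ⟨K, hK⟩
  refine ⟨exists_isFastTrajectory hloc hv₂ hv, fun X hX => ?_⟩
  rw [← hval]
  refine hX.tendsto_div_travelTime hv₂ hv (by positivity) ?_
  refine tendsto_div_relativeAdvance hv₂ hκ0 (K := K)
    (Ll := fun n => s₀ + (limitDelay (z κ) K s₀ n ω).toReal)
    (Lu := fun k n => s₀ + (limitDelay (z (κ + 1 / (k + 1))) 0 s₀ n ω).toReal)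
    (fun n t ht hn => ?_) (fun k n t ht hn => ?_) (hlowω K).2 fun k => (hupω k).2.2
  · refine le_of_tendsto' ((hlowω K).1 n) fun m => ?_
    refine hX.delayScheme_le hv₂ hv hκ (fun j => rfl) hK m (n * 2 ^ m) t ht ?_
    push_cast
    rwa [mul_div_cancel_right₀ _ (by positivity)]
  · exact hX.sub_le_of_forall_delayScheme_le hv₂ hv hloc (lt_add_of_pos_right κ (by positivity))
      (fun j => rfl) (hupω k).1 hne hinj ht hn ((hupω k).2.1 n)
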